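/- Let $(M,\lambda_1,\dots,\lambda_n)$ be an absolute parallelism (AP) space: an $n$-dimensional smooth manifold with $n$ smooth global vector fields $\lambda_i$ that are linearly independent at every point. In any chart let $\lambda_i{}^{\mu}$ be their components and let $\lambda_{i\mu}$ be given by $\sum_i\lambda_i{}^{\mu}\lambda_{i\nu}=\delta^\mu_\nu$; put $g_{\mu\nu}=\sum_i\lambda_{i\mu}\lambda_{i\nu}$ and $\lambda=\det(\lambda_{i\mu})$. Let $\{{}^{\alpha}_{\mu\nu}\}$ be the Levi-Civita connection of $g$, with covariant derivative denoted by $;$. Let $\Gamma^\alpha{}_{\mu\nu}=\sum_i\lambda_i{}^\alpha\lambda_{i\mu,\nu}$ be the Weitzenböck connection, $\gamma^\alpha{}_{\mu\nu}=\sum_i\lambda_i{}^\alpha\lambda_{i\mu;\nu}$ the contortion, and, for a real parameter $b$, $\nabla^\alpha{}_{\mu\nu}=\{{}^{\alpha}_{\mu\nu}\}+b\,\gamma^\alpha{}_{\mu\nu}$ the parameterized (PAP) connection. The dual of a connection $C$ is $\widetilde C^\alpha{}_{\mu\nu}=C^\alpha{}_{\nu\mu}$. The divergence of $E^\mu{}_\nu$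 with respect to a connection $C$ is $$E^\mu{}_{\nu,\mu}+E^\alpha{}_\nu C^\mu{}_{\alpha\mu}-E^\mu{}_\alpha C^\alpha{}_{\nu\mu};$$ write $E^\mu{}_{\nu|\mu}$ for it if $C=\widetilde\Gamma$ (the AP dual connection), $E^\mu{}_{\nu\|\mu}$ if $C=\widetilde\nabla$ (the PAP dual connection), and $E^\mu{}_{\nu;\mu}$ for the Levi-Civita connection. A Lagrangian function is a function $L(\lambda_{i\mu},\lambda_{i\mu,\nu},\lambda_{i\mu,\nu\sigma})$, smooth where $\lambda\neq0$, whose value is a scalar under smooth changes of coordinates. With $\mathcal L=\lambda L$ put $$\frac{\delta L}{\delta\lambda_{i\beta}}=\frac1\lambda\left[\frac{\partial\mathcal L}{\partial\lambda_{i\beta}}-\frac{\partial}{\partial x^\gamma}\frac{\partial\mathcal L}{\partial\lambda_{i\beta,\gamma}}+\frac{\partial^2}{\partial x^\gamma\partial x^\sigma}\frac{\partial\mathcal L}{\partial\lambda_{i\beta,\gamma\sigma}}\right],\qquad E^\mu{}_\nu=\sum_i\frac{\delta L}{\delta\lambda_{i\mu}}\lambda_{i\nu}.\tag{1}$$ **(a)**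 For every $C^1$ symmetric tensor field $E^{\mu\nu}$ on $M$, with $E^\mu{}_\nu=E^{\mu\alpha}g_{\alpha\nu}$, and for every real $b$, in every chart $$E^\mu{}_{\nu\|\mu}=E^\mu{}_{\nu|\mu}=E^\mu{}_{\nu;\mu}.$$ **(b)** The Ricci scalar $R$ of $g$, as a function of $\lambda_{i\mu}$ and their first and second derivatives, is a Lagrangian function. For $L=cR$, $c\in\mathbb R$, the tensor (1) is $E^\mu{}_\nu=-2c\,G^\mu{}_\nu$, where $G^\mu{}_\nu=R^\mu{}_\nu-\tfrac12\delta^\mu_\nu R$ is the Einstein tensor (so it is exactly the Einstein tensor for $L=-\tfrac12R$), and $E^\mu{}_{\nu;\mu}\equiv0$. Moreover, for every Lagrangian function $L$ and every chart in which the tensor (1) is symmetric ($E^{\mu\nu}=E^{\nu\mu}$, where $E^{\mu\nu}=E^\mu{}_\alpha g^{\alpha\nu}$), one has in that chart $$E^\mu{}_{\nu|\mu}\equiv0\qquad\text{and}\qquad E^\mu{}_{\nu\|\mu}\equiv0\quad\text{for every real } b.$$ -/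

import Mathlib

open scoped Manifold ContDiff

noncomputable section

namespace PAP

/-! ### Coordinate calculus on open subsets of ℝⁿ -/

/-- The coordinate space ℝⁿ, the model space of the manifold. -/
abbrev Coord (n : ℕ) := EuclideanSpace ℝ (Fin n)

/-- The partial derivative `f_{,μ}` of a function of the coordinates. -/
def pderiv {n : ℕ} (μ : Fin n) (f : Coord n → ℝ) (y : Coord n) : ℝ :=
  fderiv ℝ f y (EuclideanSpace.single μ 1)

/-- An `n × n` array of functions of the coordinates: the components `θ i μ` of `n` one-forms, or
of `n` vector fields, or of a second order tensor. -/
abbrev Field2 (n : ℕ) := Fin n → Fin n → Coord n → ℝ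

/-- An array of functions with three indices; a connection `Γ^α_{μν}` is `Γ α μ ν`. -/
abbrev Field3 (n : ℕ) := Fin n → Fin n → Fin n → Coord n → ℝ

/-- The matrix of values at a point. -/
def matAt {n : ℕ} (a : Field2 n) (y : Coord n) : Matrix (Fin n) (Fin n) ℝ :=
  Matrix.of fun i μ => a i μ y

/-- The covariant components `λ_{iμ}` determined by the contravariant ones `λ_i^μ` through
`∑ i, λ_i^μ λ_{iν} = δ^μ_ν`. -/
def coframe {n : ℕ} (lam : Field2 n) : Field2 n :=
  fun i μ y => ((matAt lam y)⁻¹) μ i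

/-- The metric `g_{μν} = ∑ i, λ_{iμ} λ_{iν}`. -/
def metric {n : ℕ} (θ : Field2 n) : Field2 n :=
  fun μ ν y => ∑ i, θ i μ y * θ i ν y

/-- The inverse metric `g^{μν}`. -/
def invMetric {n : ℕ} (g : Field2 n) : Field2 n :=
  fun μ ν y => ((matAt g y)⁻¹) μ ν

/-- The Levi-Civita connection (Christoffel symbols) of `g`. -/
def christoffel {n : ℕ} (g : Field2 n) : Field3 n :=
  fun α μ ν y => (1 / 2) * ∑ σ, invMetric g α σ y *
    (pderiv ν (g μ σ) y + pderiv μ (g ν σ) y - pderiv σ (g μ ν) y)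

/-- The Ricci tensor of `g`. -/
def ricci {n : ℕ} (g : Field2 n) : Field2 n :=
  fun β ν y =>
    (∑ α, (pderiv α (christoffel g α β ν) y - pderiv ν (christoffel g α β α) y)) +
    ∑ α, ∑ σ, (christoffel g α α σ y * christoffel g σ β ν y
      - christoffel g α ν σ y * christoffel g σ β α y)

/-- The Ricci scalar of `g`. -/
def scalarCurvature {n : ℕ} (g : Field2 n) (y : Coord n) : ℝ :=
  ∑ μ, ∑ ν, invMetric g μ ν y * ricci g μ ν y

/-- The Einstein tensor `G^μ_ν = R^μ_ν - (1/2) δ^μ_ν R` of `g`. -/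
def einstein {n : ℕ} (g : Field2 n) : Field2 n :=
  fun μ ν y => (∑ α, invMetric g μ α y * ricci g α ν y)
    - (1 / 2) * (if μ = ν then 1 else 0) * scalarCurvature g y

/-! ### Connections of AP- and PAP-geometry -/

/-- The Weitzenböck connection `Γ^α_{μν} = ∑ i, λ_i^α λ_{iμ,ν}`. -/
def weitzenbock {n : ℕ} (lam : Field2 n) : Field3 n :=
  fun α μ ν y => ∑ i, lam i α y * pderiv ν (coframe lam i μ) y

/-- The contortion `γ^α_{μν} = ∑ i, λ_i^α λ_{iμ;ν}`, where `;` is the Levi-Civita derivative. -/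
def contortion {n : ℕ} (lam : Field2 n) : Field3 n :=
  fun α μ ν y => ∑ i, lam i α y * (pderiv ν (coframe lam i μ) y
    - ∑ β, coframe lam i β y * christoffel (metric (coframe lam)) β μ ν y)

/-- The parameterized canonical connection `∇^α_{μν} = {α, μν} + b γ^α_{μν}`. -/
def papConnection {n : ℕ} (b : ℝ) (lam : Field2 n) : Field3 n :=
  fun α μ ν y => christoffel (metric (coframe lam)) α μ ν y + b * contortion lam α μ ν y

/-- The dual (transposed) connection. -/
def dual {n : ℕ} (C : Field3 n) : Field3 n :=
  fun α μ ν => C α ν μ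

/-- The divergence `E^μ_{ν:μ}` of a mixed tensor `E^μ_ν` with respect to the connection `C`, the
last lower index of `C` being the direction of differentiation:
`A_{μ:ν} = A_{μ,ν} - A_α C^α_{μν}` and `A^μ_{:ν} = A^μ_{,ν} + A^α C^μ_{αν}`. -/
def divergence {n : ℕ} (C : Field3 n) (E : Field2 n) (ν : Fin n) (y : Coord n) : ℝ :=
  ∑ μ, (pderiv μ (E μ ν) y + (∑ α, E α ν y * C μ α μ y) - ∑ α, E μ α y * C α ν μ y)

/-- Lowering the second index: `E^μ_ν = E^{μα} g_{αν}`. -/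
def lowerSnd {n : ℕ} (g E : Field2 n) : Field2 n :=
  fun μ ν y => ∑ α, E μ α y * g α ν y

/-- Raising the second index: `E^{μν} = E^μ_α g^{αν}`. -/
def raiseSnd {n : ℕ} (g E : Field2 n) : Field2 n :=
  fun μ ν y => ∑ α, E μ α y * invMetric g α ν y

/-! ### Lagrangian functions and Hamiltonian derivatives -/

/-- The variables `(λ_{iμ}, λ_{iμ,ν}, λ_{iμ,νσ})` of a Lagrangian function. -/
abbrev Jet (n : ℕ) := (Fin n → Fin n → ℝ) × (Fin n → Fin n → Fin n → ℝ) ×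
  (Fin n → Fin n → Fin n → Fin n → ℝ)

/-- The components of `n` one-forms with their first and second derivatives at a point. -/
def jetOf {n : ℕ} (θ : Field2 n) (y : Coord n) : Jet n :=
  (fun i μ => θ i μ y, fun i μ ν => pderiv ν (θ i μ) y,
    fun i μ ν σ => pderiv σ (pderiv ν (θ i μ)) y)

/-- The pull-back of `n` one-forms along `φ`, i.e. their components in the new coordinates. -/
def pullback {n : ℕ} (φ : Coord n → Coord n) (θ : Field2 n) : Field2 n :=
  fun i μ y => ∑ ν, θ i ν (φ y) * pderiv μ (fun z => φ z ν) y

/-- A Lagrangian function: smooth where the one-forms are independent, and a scalar, i.e. its value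
does not change under smooth invertible changes of the coordinates. -/
structure IsLagrangian {n : ℕ} (L : Jet n → ℝ) : Prop where
  smooth : ContDiffOn ℝ ∞ L {j | (Matrix.of j.1).det ≠ 0}
  scalar : ∀ φ : OpenPartialHomeomorph (Coord n) (Coord n),
    ContDiffOn ℝ ∞ φ φ.source → ContDiffOn ℝ ∞ φ.symm φ.target →
    ∀ θ : Field2 n, (∀ i μ, ContDiffOn ℝ ∞ (θ i μ) φ.target) →
      (∀ y ∈ φ.target, (matAt θ y).det ≠ 0) →
      ∀ y ∈ φ.source, L (jetOf (pullback φ θ) y) = L (jetOf θ (φ y))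

/-- The Lagrangian density `λ L`, with `λ = det (λ_{iμ})`. -/
def density {n : ℕ} (L : Jet n → ℝ) (j : Jet n) : ℝ :=
  (Matrix.of j.1).det * L j

/-- `∂F/∂λ_{iβ}`. -/
def dJet0 {n : ℕ} (F : Jet n → ℝ) (i β : Fin n) (j : Jet n) : ℝ :=
  fderiv ℝ F j (Pi.single i (Pi.single β 1), 0, 0)

/-- `∂F/∂λ_{iβ,γ}`. -/
def dJet1 {n : ℕ} (F : Jet n → ℝ) (i β γ : Fin n) (j : Jet n) : ℝ :=
  fderiv ℝ F j (0, Pi.single i (Pi.single β (Pi.single γ 1)), 0)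

/-- `∂F/∂λ_{iβ,γσ}`. The arguments `λ_{iβ,γσ}` and `λ_{iβ,σγ}` count as separate variables, as in
the Taylor expansion `∑ γ, ∑ σ, (∂F/∂λ_{iβ,γσ}) h_{iβ,γσ}`. -/
def dJet2 {n : ℕ} (F : Jet n → ℝ) (i β γ σ : Fin n) (j : Jet n) : ℝ :=
  fderiv ℝ F j (0, 0, Pi.single i (Pi.single β (Pi.single γ (Pi.single σ 1))))

/-- The Hamiltonian derivative `δL/δλ_{iβ}`, which includes the factor `1/λ`. -/
def hamiltonianDeriv {n : ℕ} (L : Jet n → ℝ) (θ : Field2 n) (i β : Fin n) (y : Coord n) : ℝ :=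
  (1 / (matAt θ y).det) *
    (dJet0 (density L) i β (jetOf θ y)
      - (∑ γ, pderiv γ (fun z => dJet1 (density L) i β γ (jetOf θ z)) y)
      + ∑ γ, ∑ σ, pderiv γ (pderiv σ (fun z => dJet2 (density L) i β γ σ (jetOf θ z))) y)

/-- The tensor `E^μ_ν = ∑ i, (δL/δλ_{iμ}) λ_{iν}` defined by the variational formula. -/
def variationalTensor {n : ℕ} (L : Jet n → ℝ) (θ : Field2 n) : Field2 n :=
  fun μ ν y => ∑ i, hamiltonianDeriv L θ i μ y * θ i ν y

/-- The one-forms with quadratic components whose variables at the origin are `j`. -/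
def taylorCoframe {n : ℕ} (j : Jet n) : Field2 n :=
  fun i μ y => j.1 i μ + (∑ ν, j.2.1 i μ ν * y ν)
    + (1 / 2) * ∑ ν, ∑ σ, j.2.2 i μ ν σ * y ν * y σ

/-- The Ricci scalar of the metric `∑ i, λ_{iμ} λ_{iν}`, as a function of the variables
`(λ_{iμ}, λ_{iμ,ν}, λ_{iμ,νσ})`. -/
def ricciLagrangian (n : ℕ) (j : Jet n) : ℝ :=
  scalarCurvature (metric (taylorCoframe j)) 0

/-! ### AP-spaces and tensors on manifolds -/

/-- An AP-structure: `n` independent global smooth vector fields on an `n`-dimensional smooth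
manifold. -/
structure APStructure (n : ℕ) (M : Type*) [TopologicalSpace M] [ChartedSpace (Coord n) M]
    [IsManifold (𝓡 n) ∞ M] where
  vf : Fin n → (x : M) → TangentSpace (𝓡 n) x
  smooth : ∀ i, ContMDiff (𝓡 n) (𝓡 n).tangent ∞
    (fun x => (⟨x, vf i x⟩ : TangentBundle (𝓡 n) M))
  independent : ∀ x, LinearIndependent ℝ (fun i => vf i x)

variable {n : ℕ} {M : Type*} [TopologicalSpace M] [ChartedSpace (Coord n) M]

/-- The differential `dx^μ` at `x` of the `μ`-th coordinate function of the chart `e`. -/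
def coordForm (e : OpenPartialHomeomorph M (Coord n)) (μ : Fin n) (x : M) :
    Module.Dual ℝ (TangentSpace (𝓡 n) x) :=
  ((EuclideanSpace.proj μ : Coord n →L[ℝ] ℝ) : Coord n →ₗ[ℝ] ℝ) ∘ₗ
    (mfderiv (𝓡 n) 𝓘(ℝ, Coord n) e x : TangentSpace (𝓡 n) x →L[ℝ] Coord n).toLinearMap

/-- The contravariant components `λ_i^μ` of the vector fields in the chart `e`. -/
def APStructure.frame [IsManifold (𝓡 n) ∞ M] (A : APStructure n M)
    (e : OpenPartialHomeomorph M (Coord n)) : Field2 n :=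
  fun i μ y => coordForm e μ (e.symm y) (A.vf i (e.symm y))

/-- The metric components `g_{μν}` of an AP-structure in the chart `e`. -/
def APStructure.metric [IsManifold (𝓡 n) ∞ M] (A : APStructure n M)
    (e : OpenPartialHomeomorph M (Coord n)) : Field2 n :=
  PAP.metric (coframe (A.frame e))

/-- The components `E^{μν} = E(dx^μ, dx^ν)` in the chart `e` of a contravariant tensor field of
order two. -/
def tensorComp (E : (x : M) → LinearMap.BilinForm ℝ (Module.Dual ℝ (TangentSpace (𝓡 n) x)))
    (e : OpenPartialHomeomorph M (Coord n)) : Field2 n :=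
  fun μ ν y => E (e.symm y) (coordForm e μ (e.symm y)) (coordForm e ν (e.symm y))

/-- A tensor field is continuously differentiable if its components are so in every chart. -/
def IsC1Tensor
    (E : (x : M) → LinearMap.BilinForm ℝ (Module.Dual ℝ (TangentSpace (𝓡 n) x))) : Prop :=
  ∀ e ∈ IsManifold.maximalAtlas (𝓡 n) ∞ M, ∀ μ ν,
    ContDiffOn ℝ 1 (tensorComp E e μ ν) e.target

end PAP

end

/-! Part (a) is linear algebra at a point. The Weitzenböck connection has matrices `W_ν = T⁻¹ ∂_ν
T`, with `T` the coframe matrix, and it is metric because `g = Tᵀ T`. Its difference `K_ν` from the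
Levi-Civita connection is the contortion, and since both connections are metric, `g K_ν` is
antisymmetric (`metric_mul_contortion_antisymm`). In the divergence with respect to a dual
connection, `C` enters only through `tr C_α` and `tr (E C_ν)` (`divergence_dual`). If `E = S g` with
`S` symmetric, replacing `C` by Levi-Civita changes these by `tr (g⁻¹ g K_α)` and `tr (S g K_ν)`, up
to a factor, and both are traces of a symmetric times an antisymmetric matrix. The PAP connection
differs from Levi-Civita by `b K_ν`, so the same argument serves every `b`.

The divergence statements in (b) rest on Noether's second theorem. The coframe is pulled back along
`z ↦ z + t ρ(z) ∂_ν` with `ρ` a test function. The Lagrangian density picks up the Jacobian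
determinant, so its derivative at `t = 0` is the total derivative `∂_ν (ρ λL)`, whose integral is
zero. The first variation formula and the fundamental lemma of the calculus of variations then give
`noether_identity`. In it `∂_μ λ = λ tr W_μ` and `∂_ν T = T W_ν`, which turns it into the vanishing
of the divergence with respect to the dual Weitzenböck connection
(`divergence_weitzenbock_variationalTensor`). Symmetry of the tensor is needed only to pass to the
PAP and Levi-Civita divergences through (a).

For the Ricci scalar there are three points. It depends only on the two-jet of the coframe
(`scalarCurvature_eq_of_jetOf_eq`), so its value on the Taylor coframe is its value on the coframe
itself. It is invariant (`scalarCurvature_pullback`), by the transformation laws of the Christoffel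
symbols and of the curvature. Its variation is `-2 λ tr (G T⁻¹ δT)` plus a divergence, the latter
from `palatini_identity`; testing against single components identifies the Euler-Lagrange
expression. The vanishing divergence of the Einstein tensor then comes from Noether's identity and
its symmetry, in place of a computation with the Bianchi identities. -/

open scoped Manifold ContDiff

noncomputable section

namespace PAP

open Filter Topology

/-! ### Directional derivatives of matrix-valued functions -/

section MatrixCalculus

variable {E : Type*} [NormedAddCommGroup E] [NormedSpace ℝ E] {n : ℕ}

/-- The entries of the matrix-valued function `A` are smooth at `x`. -/
def MSmooth (A : E → Matrix (Fin n) (Fin n) ℝ) (x : E) : Prop :=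
  ∀ i j, ContDiffAt ℝ ∞ (fun z => A z i j) x

/-- The entrywise derivative of `A` at `x` in the direction `v`. -/
def matDeriv (v : E) (A : E → Matrix (Fin n) (Fin n) ℝ) (x : E) : Matrix (Fin n) (Fin n) ℝ :=
  Matrix.of fun i j => fderiv ℝ (fun z => A z i j) x v

theorem matDeriv_apply (v : E) (A : E → Matrix (Fin n) (Fin n) ℝ) (x : E) (i j : Fin n) :
    matDeriv v A x i j = fderiv ℝ (fun z => A z i j) x v := rfl

theorem matDeriv_congr {v : E} {A B : E → Matrix (Fin n) (Fin n) ℝ} {x : E}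
    (h : A =ᶠ[𝓝 x] B) : matDeriv v A x = matDeriv v B x := by
  ext i j
  rw [matDeriv_apply, matDeriv_apply]
  rw [Filter.EventuallyEq.fderiv_eq]
  filter_upwards [h] with z hz
  rw [hz]

theorem _root_.ContDiffAt.diffAt {F : Type*} [NormedAddCommGroup F] [NormedSpace ℝ F]
    {f : E → F} {x : E} (h : ContDiffAt ℝ ∞ f x) : DifferentiableAt ℝ f x :=
  h.differentiableAt (by simp)

theorem fderiv_mul_apply {f g : E → ℝ} {x : E} (v : E) (hf : DifferentiableAt ℝ f x)
    (hg : DifferentiableAt ℝ g x) :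
    fderiv ℝ (fun z => f z * g z) x v = fderiv ℝ f x v * g x + f x * fderiv ℝ g x v := by
  rw [fderiv_fun_mul hf hg]
  simp
  ring

theorem fderiv_sum_apply {ι : Type*} (s : Finset ι) {f : ι → E → ℝ} {x : E} (v : E)
    (hf : ∀ i, DifferentiableAt ℝ (f i) x) :
    fderiv ℝ (fun z => ∑ i ∈ s, f i z) x v = ∑ i ∈ s, fderiv ℝ (f i) x v := by
  rw [fderiv_fun_sum (fun i _ => hf i)]
  simp

theorem fderiv_add_apply {f g : E → ℝ} {x : E} (v : E) (hf : DifferentiableAt ℝ f x)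
    (hg : DifferentiableAt ℝ g x) :
    fderiv ℝ (fun z => f z + g z) x v = fderiv ℝ f x v + fderiv ℝ g x v := by
  rw [fderiv_fun_add hf hg]
  simp

theorem fderiv_sub_apply {f g : E → ℝ} {x : E} (v : E) (hf : DifferentiableAt ℝ f x)
    (hg : DifferentiableAt ℝ g x) :
    fderiv ℝ (fun z => f z - g z) x v = fderiv ℝ f x v - fderiv ℝ g x v := by
  rw [fderiv_fun_sub hf hg]
  simp

theorem fderiv_const_mul_apply {f : E → ℝ} {x : E} (v : E) (c : ℝ)
    (hf : DifferentiableAt ℝ f x) :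
    fderiv ℝ (fun z => c * f z) x v = c * fderiv ℝ f x v := by
  rw [fderiv_const_mul hf]
  simp

theorem MSmooth.mul {A B : E → Matrix (Fin n) (Fin n) ℝ} {x : E} (hA : MSmooth A x)
    (hB : MSmooth B x) : MSmooth (fun z => A z * B z) x := by
  intro i j
  simp only [Matrix.mul_apply]
  exact ContDiffAt.sum fun k _ => (hA i k).mul (hB k j)

theorem MSmooth.transpose {A : E → Matrix (Fin n) (Fin n) ℝ} {x : E} (hA : MSmooth A x) :
    MSmooth (fun z => (A z).transpose) x := fun i j => hA j i

theorem MSmooth.smul {f : E → ℝ} {B : E → Matrix (Fin n) (Fin n) ℝ} {x : E}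
    (hf : ContDiffAt ℝ ∞ f x)
    (hB : MSmooth B x) : MSmooth (fun z => f z • B z) x := fun i j => hf.mul (hB i j)

theorem MSmooth.sum {ι : Type*} {s : Finset ι} {A : ι → E → Matrix (Fin n) (Fin n) ℝ} {x : E}
    (hA : ∀ i, MSmooth (A i) x) : MSmooth (fun z => ∑ i ∈ s, A i z) x := by
  intro i j
  simp only [Matrix.sum_apply]
  exact ContDiffAt.sum fun k _ => hA k i j

theorem MSmooth.det {A : E → Matrix (Fin n) (Fin n) ℝ} {x : E} (hA : MSmooth A x) :
    ContDiffAt ℝ ∞ (fun z => (A z).det) x := by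
  simp only [Matrix.det_apply]
  refine ContDiffAt.sum fun σ _ => ContDiffAt.const_smul _ ?_
  exact contDiffAt_prod fun i _ => hA _ _

theorem MSmooth.inv {A : E → Matrix (Fin n) (Fin n) ℝ} {x : E} (hA : MSmooth A x)
    (h : (A x).det ≠ 0) : MSmooth (fun z => (A z)⁻¹) x := by
  intro i j
  simp only [Matrix.inv_def, Matrix.smul_apply, smul_eq_mul, Ring.inverse_eq_inv',
    Matrix.adjugate_apply]
  refine (hA.det.inv h).mul (MSmooth.det fun k l => ?_)
  by_cases hk : k = j
  · subst hk
    simpa using contDiffAt_const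
  · simpa [Matrix.updateRow_ne hk] using hA k l

theorem matDeriv_mul {v : E} {A B : E → Matrix (Fin n) (Fin n) ℝ} {x : E} (hA : MSmooth A x)
    (hB : MSmooth B x) :
    matDeriv v (fun z => A z * B z) x = matDeriv v A x * B x + A x * matDeriv v B x := by
  ext i j
  rw [matDeriv_apply, Matrix.add_apply, Matrix.mul_apply, Matrix.mul_apply,
    ← Finset.sum_add_distrib]
  simp only [Matrix.mul_apply]
  rw [fderiv_sum_apply _ _ fun k => ((hA i k).mul (hB k j)).diffAt]
  exact Finset.sum_congr rfl fun k _ => fderiv_mul_apply v (hA i k).diffAt (hB k j).diffAt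

theorem matDeriv_transpose {v : E} {A : E → Matrix (Fin n) (Fin n) ℝ} {x : E} :
    matDeriv v (fun z => (A z).transpose) x = (matDeriv v A x).transpose := rfl

theorem matDeriv_add {v : E} {A B : E → Matrix (Fin n) (Fin n) ℝ} {x : E} (hA : MSmooth A x)
    (hB : MSmooth B x) :
    matDeriv v (fun z => A z + B z) x = matDeriv v A x + matDeriv v B x := by
  ext i j
  exact fderiv_add_apply v (hA i j).diffAt (hB i j).diffAt

theorem matDeriv_const {v : E} {A : Matrix (Fin n) (Fin n) ℝ} {x : E} :
    matDeriv v (fun _ => A) x = 0 := by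
  ext i j
  simp [matDeriv_apply]

theorem matDeriv_smul {v : E} {f : E → ℝ} {A : E → Matrix (Fin n) (Fin n) ℝ} {x : E}
    (hf : ContDiffAt ℝ ∞ f x) (hA : MSmooth A x) :
    matDeriv v (fun z => f z • A z) x = fderiv ℝ f x v • A x + f x • matDeriv v A x := by
  ext i j
  exact fderiv_mul_apply v hf.diffAt (hA i j).diffAt

/-- Differentiate `A A⁻¹ = 1`, which holds in a whole neighbourhood of `x` because the determinant
is continuous. -/
theorem matDeriv_inv {v : E} {A : E → Matrix (Fin n) (Fin n) ℝ} {x : E} (hA : MSmooth A x)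
    (h : (A x).det ≠ 0) :
    matDeriv v (fun z => (A z)⁻¹) x = -((A x)⁻¹ * matDeriv v A x * (A x)⁻¹) := by
  have hu : IsUnit (A x).det := isUnit_iff_ne_zero.mpr h
  have h1 : matDeriv v (fun z => A z * (A z)⁻¹) x = 0 := by
    rw [← matDeriv_const (v := v) (A := (1 : Matrix (Fin n) (Fin n) ℝ)) (x := x)]
    apply matDeriv_congr
    filter_upwards [hA.det.continuousAt.eventually_ne h] with z hz
    exact Matrix.mul_nonsing_inv _ (isUnit_iff_ne_zero.mpr hz)
  rw [matDeriv_mul hA (hA.inv h)] at h1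
  have h2 : (A x)⁻¹ * (matDeriv v A x * (A x)⁻¹ + A x * matDeriv v (fun z => (A z)⁻¹) x) = 0 := by
    rw [h1, mul_zero]
  rw [mul_add, ← mul_assoc, ← mul_assoc, Matrix.nonsing_inv_mul _ hu, one_mul] at h2
  exact eq_neg_of_add_eq_zero_right h2

/-- `Matrix.det_one_add_smul` writes the determinant as `1 + t tr B + t² p(t)`; the two `divX` strip
the constant and linear terms and leave the polynomial `p`. -/
theorem hasDerivAt_det_one_add_smul (B : Matrix (Fin n) (Fin n) ℝ) :
    HasDerivAt (fun t : ℝ => (1 + t • B).det) B.trace 0 := by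
  set p := (Matrix.det (1 + (Polynomial.X : Polynomial ℝ) • B.map Polynomial.C)).divX.divX with hp
  have h0 : (fun t : ℝ => (1 + t • B).det) = fun t => 1 + B.trace * t + p.eval t * t ^ 2 :=
    funext fun t => Matrix.det_one_add_smul t B
  rw [h0]
  have h1 : HasDerivAt (fun t : ℝ => 1 + B.trace * t) B.trace 0 := by
    simpa using ((hasDerivAt_id (0 : ℝ)).const_mul B.trace).const_add 1
  have h2 : HasDerivAt (fun t : ℝ => p.eval t * t ^ 2) 0 0 := by
    simpa using (p.hasDerivAt 0).fun_mul (hasDerivAt_pow 2 (0 : ℝ))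
  simpa using h1.fun_add h2

/-- Jacobi's formula. The determinant is viewed as a function of the array of entries, so that only
its derivative along the line `A + t W`, `W = matDeriv v A x`, is needed; there `det (A + t W) = det
A · det (1 + t A⁻¹ W)`. -/
theorem fderiv_det {v : E} {A : E → Matrix (Fin n) (Fin n) ℝ} {x : E} (hA : MSmooth A x)
    (h : (A x).det ≠ 0) :
    fderiv ℝ (fun z => (A z).det) x v = (A x).det * ((A x)⁻¹ * matDeriv v A x).trace := by
  have hu : IsUnit (A x).det := isUnit_iff_ne_zero.mpr h
  let D : (Fin n → Fin n → ℝ) → ℝ := fun a => (Matrix.of a).det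
  let a : E → Fin n → Fin n → ℝ := fun z i j => A z i j
  have hD : ∀ b, ContDiffAt ℝ ∞ D b := fun b =>
    MSmooth.det (A := fun a : Fin n → Fin n → ℝ => Matrix.of a) (x := b) fun i j => by
      simp only [Matrix.of_apply]
      fun_prop
  have ha : HasFDerivAt a (ContinuousLinearMap.pi fun i => ContinuousLinearMap.pi fun j =>
      fderiv ℝ (fun z => A z i j) x) x :=
    hasFDerivAt_pi.mpr fun i => hasFDerivAt_pi.mpr fun j => (hA i j).diffAt.hasFDerivAt
  have hc := ((hD (a x)).diffAt.hasFDerivAt.comp x ha).fderiv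
  have hv : fderiv ℝ (fun z => (A z).det) x v
      = fderiv ℝ D (a x) (fun i j => matDeriv v A x i j) := by
    have : (fun z => (A z).det) = D ∘ a := rfl
    rw [this, hc]
    rfl
  rw [hv]
  set w : Fin n → Fin n → ℝ := fun i j => matDeriv v A x i j
  have hline : HasDerivAt (fun t : ℝ => a x + t • w) w 0 := by
    simpa using ((hasDerivAt_id (0 : ℝ)).smul_const w).const_add (a x)
  have h0 : a x + (0 : ℝ) • w = a x := by simp
  have h1 : HasDerivAt (fun t : ℝ => D (a x + t • w)) (fderiv ℝ D (a x) w) 0 := by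
    have hDx : HasFDerivAt D (fderiv ℝ D (a x)) (a x + (0 : ℝ) • w) := by
      rw [h0]; exact (hD (a x)).diffAt.hasFDerivAt
    exact hDx.comp_hasDerivAt (0 : ℝ) hline
  have h2 : (fun t : ℝ => D (a x + t • w))
      = fun t : ℝ => (A x).det * (1 + t • ((A x)⁻¹ * matDeriv v A x)).det := by
    funext t
    rw [← Matrix.det_mul, mul_add, mul_one, Matrix.mul_smul, ← mul_assoc,
      Matrix.mul_nonsing_inv _ hu, one_mul]
    rfl
  rw [h2] at h1
  exact h1.unique ((hasDerivAt_det_one_add_smul _).const_mul _)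

end MatrixCalculus

/-! ### Partial derivatives and families depending on a parameter -/

section Families

variable {P : Type*} [NormedAddCommGroup P] [NormedSpace ℝ P] {n : ℕ}

/-- Joint smoothness at `(p, y)` of a function of the coordinates depending on a parameter. -/
def FamSmooth (f : P → Coord n → ℝ) (p : P) (y : Coord n) : Prop :=
  ContDiffAt ℝ ∞ (fun q : P × Coord n => f q.1 q.2) (p, y)

theorem FamSmooth.slice {f : P → Coord n → ℝ} {p : P} {y : Coord n} (h : FamSmooth f p y) :
    ContDiffAt ℝ ∞ (f p) y :=
  ContDiffAt.comp (f := fun z : Coord n => (p, z))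
    (g := fun q : P × Coord n => f q.1 q.2) y h (by fun_prop)

theorem FamSmooth.param {f : P → Coord n → ℝ} {p : P} {y : Coord n} (h : FamSmooth f p y) :
    ContDiffAt ℝ ∞ (fun q => f q y) p :=
  ContDiffAt.comp (f := fun q : P => (q, y))
    (g := fun q : P × Coord n => f q.1 q.2) p h (by fun_prop)

theorem famSmooth_const {f : Coord n → ℝ} {p : P} {y : Coord n} (h : ContDiffAt ℝ ∞ f y) :
    FamSmooth (fun _ : P => f) p y :=
  ContDiffAt.comp (f := fun q : P × Coord n => q.2) (g := f) (p, y) h (by fun_prop)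

theorem FamSmooth.pderiv {f : P → Coord n → ℝ} {p : P} {y : Coord n} (h : FamSmooth f p y)
    (μ : Fin n) : FamSmooth (fun q => pderiv μ (f q)) p y := by
  have h1 : ContDiffAt ℝ ∞ (fun q : P × Coord n => fderiv ℝ (f q.1) q.2) (p, y) := by
    refine ContDiffAt.fderiv (n := ∞) (f := fun (q : P × Coord n) z => f q.1 z)
      (g := fun q : P × Coord n => q.2) ?_ (by fun_prop) (by simp)
    exact ContDiffAt.comp (f := fun r : (P × Coord n) × Coord n => (r.1.1, r.2))
      (g := fun q : P × Coord n => f q.1 q.2) ((p, y), y) h (by fun_prop)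
  exact h1.clm_apply contDiffAt_const

/-- A function of the coordinates alone is a family constant in a dummy real parameter. The same
device later specialises the family versions for the metric, the connection and the curvature to a
single coframe. -/
theorem contDiffAt_pderiv {f : Coord n → ℝ} {y : Coord n} (h : ContDiffAt ℝ ∞ f y) (μ : Fin n) :
    ContDiffAt ℝ ∞ (pderiv μ f) y :=
  ((famSmooth_const (P := ℝ) (p := 0) h).pderiv μ).slice

/-- For `∞` the neighbourhoods may shrink with the order of differentiability, so the argument
descends to order one, which persists near the point. -/
theorem contDiffAt_infty_eventually {E : Type*} [NormedAddCommGroup E] [NormedSpace ℝ E]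
    {f : E → ℝ} {x : E} (h : ContDiffAt ℝ ∞ f x) : ∀ᶠ z in 𝓝 x, DifferentiableAt ℝ f z := by
  have h1 : ContDiffAt ℝ 1 f x := h.of_le (by exact_mod_cast le_top)
  filter_upwards [h1.eventually (by simp)] with z hz
  exact hz.differentiableAt (by simp)

theorem isSymm_fderiv_fderiv {E : Type*} [NormedAddCommGroup E] [NormedSpace ℝ E]
    {f : E → ℝ} {x : E} (h : ContDiffAt ℝ ∞ f x) : IsSymmSndFDerivAt ℝ f x :=
  h.isSymmSndFDerivAt (by
    simpa using (WithTop.coe_le_coe.2 le_top : ((2 : ℕ∞) : ℕ∞ω) ≤ ((⊤ : ℕ∞) : ℕ∞ω)))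

theorem differentiableAt_fderiv {E : Type*} [NormedAddCommGroup E] [NormedSpace ℝ E]
    {f : E → ℝ} {x : E} (h : ContDiffAt ℝ ∞ f x) : DifferentiableAt ℝ (fderiv ℝ f) x :=
  (h.fderiv_right (m := ∞) (by simp)).diffAt

theorem fderiv_fderiv_apply {E : Type*} [NormedAddCommGroup E] [NormedSpace ℝ E]
    {f : E → ℝ} {x : E} (h : ContDiffAt ℝ ∞ f x) (v w : E) :
    fderiv ℝ (fun z => fderiv ℝ f z v) x w = fderiv ℝ (fderiv ℝ f) x w v := by
  rw [fderiv_clm_apply (differentiableAt_fderiv h) (differentiableAt_const v)]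
  simp

theorem pderiv_comm {f : Coord n → ℝ} {y : Coord n} (h : ContDiffAt ℝ ∞ f y) (μ ν : Fin n) :
    pderiv μ (pderiv ν f) y = pderiv ν (pderiv μ f) y := by
  unfold pderiv
  rw [fderiv_fderiv_apply h, fderiv_fderiv_apply h]
  exact isSymm_fderiv_fderiv h _ _

theorem pderiv_congr {f g : Coord n → ℝ} {y : Coord n} (h : f =ᶠ[𝓝 y] g) (μ : Fin n) :
    pderiv μ f y = pderiv μ g y := by
  unfold pderiv
  rw [h.fderiv_eq]

theorem pderiv_eventuallyEq {f g : Coord n → ℝ} {y : Coord n} (h : f =ᶠ[𝓝 y] g) (μ : Fin n) :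
    pderiv μ f =ᶠ[𝓝 y] pderiv μ g := by
  filter_upwards [h.eventuallyEq_nhds] with z hz
  exact pderiv_congr hz μ

/-- The derivative of a one-parameter family with respect to its parameter at `0`. -/
def variation (f : ℝ → Coord n → ℝ) : Coord n → ℝ := fun z => deriv (fun t => f t z) 0

theorem FamSmooth.fderiv_eq {f : P → Coord n → ℝ} {p : P} {y : Coord n}
    (h : DifferentiableAt ℝ (fun q : P × Coord n => f q.1 q.2) (p, y)) (μ : Fin n) :
    PAP.pderiv μ (f p) y
      = fderiv ℝ (fun q : P × Coord n => f q.1 q.2) (p, y) (0, EuclideanSpace.single μ 1) := by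
  have h1 : HasFDerivAt (fun z : Coord n => (p, z)) (ContinuousLinearMap.inr ℝ P (Coord n)) y :=
    hasFDerivAt_prodMk_right p y
  have h2 := HasFDerivAt.comp (f := fun z : Coord n => (p, z))
    (g := fun q : P × Coord n => f q.1 q.2) y h.hasFDerivAt h1
  have h3 : PAP.pderiv μ (f p) y = _ :=
    congrArg (fun L : Coord n →L[ℝ] ℝ => L (EuclideanSpace.single μ 1)) h2.fderiv
  rw [h3]
  simp

theorem variation_eq {f : ℝ → Coord n → ℝ} {y : Coord n}
    (h : DifferentiableAt ℝ (fun q : ℝ × Coord n => f q.1 q.2) (0, y)) :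
    variation f y = fderiv ℝ (fun q : ℝ × Coord n => f q.1 q.2) (0, y) (1, 0) := by
  have h1 : HasFDerivAt (fun t : ℝ => (t, y)) (ContinuousLinearMap.inl ℝ ℝ (Coord n)) 0 :=
    hasFDerivAt_prodMk_left 0 y
  have h2 := HasFDerivAt.comp (f := fun t : ℝ => (t, y))
    (g := fun q : ℝ × Coord n => f q.1 q.2) 0 h.hasFDerivAt h1
  have h3 : variation f y = _ :=
    congrArg (fun L : ℝ →L[ℝ] ℝ => L 1) h2.fderiv
  rw [h3]
  simp

theorem FamSmooth.contDiffAt_variation {f : ℝ → Coord n → ℝ} {y : Coord n}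
    (h : FamSmooth f 0 y) : ContDiffAt ℝ ∞ (variation f) y := by
  have h1 : ContDiffAt ℝ ∞ (fun z : Coord n =>
      fderiv ℝ (fun q : ℝ × Coord n => f q.1 q.2) (0, z) (1, 0)) y := by
    have h2 : ContDiffAt ℝ ∞ (fderiv ℝ (fun q : ℝ × Coord n => f q.1 q.2)) (0, y) :=
      ContDiffAt.fderiv_right h (by simp)
    exact (ContDiffAt.comp (f := fun z : Coord n => ((0 : ℝ), z)) y h2 (by fun_prop)).clm_apply
      contDiffAt_const
  refine h1.congr_of_eventuallyEq ?_
  have hz : Tendsto (fun z : Coord n => ((0 : ℝ), z)) (𝓝 y) (𝓝 (0, y)) :=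
    (by fun_prop : Continuous fun z : Coord n => ((0 : ℝ), z)).tendsto y
  filter_upwards [hz.eventually (contDiffAt_infty_eventually h)] with z hz
  exact variation_eq hz

theorem FamSmooth.hasDerivAt {f : ℝ → Coord n → ℝ} {y : Coord n}
    (h : FamSmooth f 0 y) : HasDerivAt (fun t => f t y) (variation f y) 0 :=
  h.param.diffAt.hasDerivAt

/-- Both sides are second derivatives of the joint function of parameter and coordinates, in the
directions `(1, 0)` and `(0, ∂_μ)`, and the second derivative is symmetric. -/
theorem variation_pderiv {f : ℝ → Coord n → ℝ} {y : Coord n}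
    (h : FamSmooth f 0 y) (μ : Fin n) :
    variation (fun t => PAP.pderiv μ (f t)) y = PAP.pderiv μ (variation f) y := by
  have hev := contDiffAt_infty_eventually h
  have hz : Tendsto (fun z : Coord n => ((0 : ℝ), z)) (𝓝 y) (𝓝 (0, y)) :=
    (by fun_prop : Continuous fun z : Coord n => ((0 : ℝ), z)).tendsto y
  have ht : Tendsto (fun t : ℝ => (t, y)) (𝓝 0) (𝓝 (0, y)) :=
    (by fun_prop : Continuous fun t : ℝ => (t, y)).tendsto 0
  set F := fun q : ℝ × Coord n => f q.1 q.2
  have e1 : (fun t => PAP.pderiv μ (f t) y) =ᶠ[𝓝 0]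
      fun t => fderiv ℝ F (t, y) (0, EuclideanSpace.single μ 1) := by
    filter_upwards [ht.eventually hev] with t ht
    exact FamSmooth.fderiv_eq ht μ
  have e2 : variation f =ᶠ[𝓝 y] fun z => fderiv ℝ F (0, z) (1, 0) := by
    filter_upwards [hz.eventually hev] with z hz
    exact variation_eq hz
  rw [pderiv_congr e2]
  have hS := fderiv_fderiv_apply (f := F) h
  have hd : ∀ v, DifferentiableAt ℝ (fun q => fderiv ℝ F q v) ((0 : ℝ), y) := fun v =>
    (differentiableAt_fderiv (f := F) h).clm_apply (differentiableAt_const v)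
  have a1 : variation (fun t => PAP.pderiv μ (f t)) y
      = fderiv ℝ (fderiv ℝ F) (0, y) (1, 0) (0, EuclideanSpace.single μ 1) := by
    unfold variation
    rw [e1.deriv_eq, ← hS]
    exact variation_eq (f := fun t z => fderiv ℝ F (t, z) (0, EuclideanSpace.single μ 1)) (hd _)
  rw [a1, isSymm_fderiv_fderiv (f := F) h, ← hS]
  exact (FamSmooth.fderiv_eq (f := fun t z => fderiv ℝ F (t, z) (1, 0)) (hd _) μ).symm

end Families

/-! ### Smoothness of the geometric objects -/

section FamilySmoothness

variable {P : Type*} [NormedAddCommGroup P] [NormedSpace ℝ P] {n : ℕ} {p : P} {y : Coord n}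

theorem matAt_metric (θ : Field2 n) (y : Coord n) :
    matAt (metric θ) y = (matAt θ y).transpose * matAt θ y := by
  ext μ ν
  rfl

theorem metric_symm (θ : Field2 n) (μ ν : Fin n) : metric θ μ ν = metric θ ν μ := by
  funext y
  exact Finset.sum_congr rfl fun i _ => mul_comm _ _

theorem det_metric_ne_zero {θ : Field2 n} {y : Coord n} (h : (matAt θ y).det ≠ 0) :
    (matAt (metric θ) y).det ≠ 0 := by
  rw [matAt_metric, Matrix.det_mul, Matrix.det_transpose]
  exact mul_ne_zero h h

theorem FamSmooth.mul {f g : P → Coord n → ℝ} (hf : FamSmooth f p y) (hg : FamSmooth g p y) :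
    FamSmooth (fun q z => f q z * g q z) p y := ContDiffAt.mul hf hg

theorem FamSmooth.add {f g : P → Coord n → ℝ} (hf : FamSmooth f p y) (hg : FamSmooth g p y) :
    FamSmooth (fun q z => f q z + g q z) p y := ContDiffAt.add hf hg

theorem FamSmooth.sub {f g : P → Coord n → ℝ} (hf : FamSmooth f p y) (hg : FamSmooth g p y) :
    FamSmooth (fun q z => f q z - g q z) p y := ContDiffAt.sub hf hg

theorem FamSmooth.sum {ι : Type*} {s : Finset ι} {f : ι → P → Coord n → ℝ}
    (hf : ∀ i, FamSmooth (f i) p y) : FamSmooth (fun q z => ∑ i ∈ s, f i q z) p y :=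
  ContDiffAt.sum fun i _ => hf i

theorem FamSmooth.const_mul {f : P → Coord n → ℝ} (c : ℝ) (hf : FamSmooth f p y) :
    FamSmooth (fun q z => c * f q z) p y := ContDiffAt.mul contDiffAt_const hf

/-- A family of `n × n` arrays is jointly smooth in the parameter and the coordinates. -/
def FamSmooth2 (a : P → Field2 n) (p : P) (y : Coord n) : Prop :=
  ∀ i μ, FamSmooth (fun q => a q i μ) p y

theorem famSmooth2_const {θ : Field2 n} (h : MSmooth (matAt θ) y) :
    FamSmooth2 (fun _ : P => θ) p y := fun i μ => famSmooth_const (h i μ)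

theorem FamSmooth2.slice {a : P → Field2 n} (h : FamSmooth2 a p y) : MSmooth (matAt (a p)) y :=
  fun i μ => (h i μ).slice

theorem FamSmooth2.metric {a : P → Field2 n} (h : FamSmooth2 a p y) :
    FamSmooth2 (fun q => metric (a q)) p y := fun μ ν =>
  FamSmooth.sum fun i => (h i μ).mul (h i ν)

theorem FamSmooth2.invMetric {a : P → Field2 n} (h : FamSmooth2 a p y)
    (hd : (matAt (a p) y).det ≠ 0) : FamSmooth2 (fun q => invMetric (a q)) p y := fun μ ν =>
  MSmooth.inv (A := fun q : P × Coord n => matAt (a q.1) q.2) (x := (p, y)) h hd μ ν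

theorem FamSmooth2.christoffel {a : P → Field2 n} (h : FamSmooth2 a p y)
    (hd : (matAt (a p) y).det ≠ 0) (α μ ν : Fin n) :
    FamSmooth (fun q => christoffel (a q) α μ ν) p y :=
  FamSmooth.const_mul _ <| FamSmooth.sum fun σ => (h.invMetric hd α σ).mul <|
    (((h μ σ).pderiv ν).add ((h ν σ).pderiv μ)).sub ((h μ ν).pderiv σ)

theorem FamSmooth2.ricci {a : P → Field2 n} (h : FamSmooth2 a p y)
    (hd : (matAt (a p) y).det ≠ 0) : FamSmooth2 (fun q => ricci (a q)) p y := fun β ν => by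
  have hc := h.christoffel hd
  exact (FamSmooth.sum fun α => ((hc α β ν).pderiv α).sub ((hc α β α).pderiv ν)).add
    (FamSmooth.sum fun α => FamSmooth.sum fun σ => ((hc α α σ).mul (hc σ β ν)).sub
      ((hc α ν σ).mul (hc σ β α)))

theorem FamSmooth2.scalarCurvature {a : P → Field2 n} (h : FamSmooth2 a p y)
    (hd : (matAt (a p) y).det ≠ 0) : FamSmooth (fun q => scalarCurvature (a q)) p y :=
  FamSmooth.sum fun μ => FamSmooth.sum fun ν => (h.invMetric hd μ ν).mul (h.ricci hd μ ν)

/-- The one-forms `θ` are smooth and independent at `y`. -/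
structure IsCoframeAt (θ : Field2 n) (y : Coord n) : Prop where
  smooth : MSmooth (matAt θ) y
  det_ne : (matAt θ y).det ≠ 0

end FamilySmoothness

/-! ### The Levi-Civita connection -/

section LeviCivita

variable {n : ℕ} {θ g : Field2 n} {y : Coord n}

/-- The coordinate vector `∂/∂x^μ`. -/
abbrev basisVec (μ : Fin n) : Coord n := EuclideanSpace.single μ 1

/-- The matrix `(Γ^α_{βν})_{αβ}` of a connection. -/
def connMat (C : Field3 n) (ν : Fin n) (y : Coord n) : Matrix (Fin n) (Fin n) ℝ :=
  Matrix.of fun α β => C α β ν y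

theorem IsCoframeAt.metric_smooth (h : IsCoframeAt θ y) : MSmooth (matAt (metric θ)) y :=
  ((famSmooth2_const (P := ℝ) (p := 0) h.smooth).metric).slice

theorem IsCoframeAt.invMetric_smooth (h : IsCoframeAt θ y) (μ ν : Fin n) :
    ContDiffAt ℝ ∞ (invMetric (metric θ) μ ν) y :=
  ((famSmooth2_const (P := ℝ) (p := 0) h.smooth).metric.invMetric
    (det_metric_ne_zero h.det_ne) μ ν).slice

theorem IsCoframeAt.christoffel_smooth (h : IsCoframeAt θ y) (α μ ν : Fin n) :
    ContDiffAt ℝ ∞ (christoffel (metric θ) α μ ν) y :=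
  ((famSmooth2_const (P := ℝ) (p := 0) h.smooth).metric.christoffel
    (det_metric_ne_zero h.det_ne) α μ ν).slice

theorem christoffel_symm (hg : ∀ μ ν, g μ ν = g ν μ) (α μ ν : Fin n) :
    christoffel g α μ ν = christoffel g α ν μ := by
  funext y
  unfold christoffel
  simp only [hg μ ν]
  congr 1
  exact Finset.sum_congr rfl fun σ _ => by ring

theorem sum_metric_christoffel (hd : (matAt g y).det ≠ 0) (α μ ν : Fin n) :
    ∑ σ, g α σ y * christoffel g σ μ ν y
      = (1 / 2) * (pderiv ν (g μ α) y + pderiv μ (g ν α) y - pderiv α (g μ ν) y) := by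
  have hu : IsUnit (matAt g y).det := isUnit_iff_ne_zero.mpr hd
  let w : Fin n → ℝ := fun σ => pderiv ν (g μ σ) y + pderiv μ (g ν σ) y - pderiv σ (g μ ν) y
  have h1 : (fun σ => christoffel g σ μ ν y) = (1 / 2 : ℝ) • ((matAt g y)⁻¹).mulVec w := by
    funext σ
    rfl
  have h2 : (matAt g y).mulVec (fun σ => christoffel g σ μ ν y) = (1 / 2 : ℝ) • w := by
    rw [h1, Matrix.mulVec_smul, Matrix.mulVec_mulVec, Matrix.mul_nonsing_inv _ hu,
      Matrix.one_mulVec]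
  exact congrFun h2 α

/-- The Levi-Civita connection is metric. -/
theorem matDeriv_metric_eq (hg : ∀ μ ν, g μ ν = g ν μ) (hd : (matAt g y).det ≠ 0) (ν : Fin n) :
    matDeriv (basisVec ν) (matAt g) y
      = (connMat (christoffel g) ν y).transpose * matAt g y
        + matAt g y * connMat (christoffel g) ν y := by
  ext α β
  have h1 : ((connMat (christoffel g) ν y).transpose * matAt g y) α β
      = ∑ σ, g β σ y * christoffel g σ α ν y := by
    rw [Matrix.mul_apply]
    refine Finset.sum_congr rfl fun σ _ => ?_
    rw [mul_comm, hg β σ]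
    rfl
  have h2 : (matAt g y * connMat (christoffel g) ν y) α β
      = ∑ σ, g α σ y * christoffel g σ β ν y := rfl
  rw [Matrix.add_apply, h1, h2, sum_metric_christoffel hd, sum_metric_christoffel hd]
  change pderiv ν (g α β) y = _
  rw [hg β α, hg ν β, hg ν α]
  ring

/-- A symmetric metric connection is the Levi-Civita connection. -/
theorem christoffel_unique (hg : ∀ μ ν, g μ ν = g ν μ) (hd : (matAt g y).det ≠ 0)
    (C : Fin n → Matrix (Fin n) (Fin n) ℝ) (hC : ∀ α μ ν, C ν α μ = C μ α ν)
    (h : ∀ ν, matDeriv (basisVec ν) (matAt g) y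
      = (C ν).transpose * matAt g y + matAt g y * C ν) (ν : Fin n) :
    connMat (christoffel g) ν y = C ν := by
  have hu : IsUnit (matAt g y).det := isUnit_iff_ne_zero.mpr hd
  have hl : ∀ α β ν, pderiv ν (g α β) y
      = (matAt g y * C ν) β α + (matAt g y * C ν) α β := by
    intro α β ν
    have := congrFun (congrFun (h ν) α) β
    rw [Matrix.add_apply] at this
    have h1 : ((C ν).transpose * matAt g y) α β = (matAt g y * C ν) β α := by
      rw [Matrix.mul_apply, Matrix.mul_apply]
      refine Finset.sum_congr rfl fun σ _ => ?_
      rw [mul_comm, Matrix.transpose_apply]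
      change g σ β y * _ = g β σ y * _
      rw [hg σ β]
    rw [h1] at this
    exact this
  have hs : ∀ α μ ν, (matAt g y * C ν) α μ = (matAt g y * C μ) α ν := fun α μ ν => by
    rw [Matrix.mul_apply, Matrix.mul_apply]
    exact Finset.sum_congr rfl fun σ _ => by rw [hC]
  -- Koszul's argument: the metric equation in three index positions, together with the symmetry of
  -- `C` in its lower indices, gives `g C` as the combination of derivatives of `g` that defines the
  -- lowered Christoffel symbols.
  have key : matAt g y * connMat (christoffel g) ν y = matAt g y * C ν := by
    ext α β
    have h2 : (matAt g y * connMat (christoffel g) ν y) α β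
      = ∑ σ, g α σ y * christoffel g σ β ν y := rfl
    rw [h2, sum_metric_christoffel hd, hl, hl, hl, hs ν α β, hs α ν β, hs β ν α]
    ring
  have := congrArg (fun A => (matAt g y)⁻¹ * A) key
  simpa only [← mul_assoc, Matrix.nonsing_inv_mul _ hu, one_mul] using this

theorem matDeriv_metric_coframe (h : IsCoframeAt θ y) (v : Coord n) :
    matDeriv v (matAt (metric θ)) y
      = (matDeriv v (matAt θ) y).transpose * matAt θ y
        + (matAt θ y).transpose * matDeriv v (matAt θ) y := by
  have : matAt (metric θ) = fun z => (matAt θ z).transpose * matAt θ z :=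
    funext fun z => matAt_metric θ z
  rw [this, matDeriv_mul h.smooth.transpose h.smooth, matDeriv_transpose]

/-- The difference `T⁻¹ ∂_ν T - Γ_ν` of the Weitzenböck and Levi-Civita connections is
antisymmetric after lowering the index. -/
theorem metric_mul_contortion_antisymm (h : IsCoframeAt θ y) (ν : Fin n) :
    (matAt (metric θ) y * ((matAt θ y)⁻¹ * matDeriv (basisVec ν) (matAt θ) y
        - connMat (christoffel (metric θ)) ν y)).transpose
      = -(matAt (metric θ) y * ((matAt θ y)⁻¹ * matDeriv (basisVec ν) (matAt θ) y
        - connMat (christoffel (metric θ)) ν y)) := by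
  have hu : IsUnit (matAt θ y).det := isUnit_iff_ne_zero.mpr h.det_ne
  -- The derivative of `g` is computed twice: through the Levi-Civita connection, and from `g = Tᵀ
  -- T`, where it exhibits the Weitzenböck connection as metric.
  have h1 := matDeriv_metric_eq (metric_symm θ) (det_metric_ne_zero h.det_ne) ν
  rw [matDeriv_metric_coframe h] at h1
  have h2 : matAt (metric θ) y * ((matAt θ y)⁻¹ * matDeriv (basisVec ν) (matAt θ) y)
      = (matAt θ y).transpose * matDeriv (basisVec ν) (matAt θ) y := by
    rw [matAt_metric, ← mul_assoc, mul_assoc _ (matAt θ y), Matrix.mul_nonsing_inv _ hu, mul_one]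
  have hgs : (matAt (metric θ) y).transpose = matAt (metric θ) y := by
    rw [matAt_metric, Matrix.transpose_mul, Matrix.transpose_transpose]
  rw [mul_sub, h2, Matrix.transpose_sub, Matrix.transpose_mul, Matrix.transpose_mul,
    Matrix.transpose_transpose, hgs, neg_sub, sub_eq_sub_iff_add_eq_add, h1]
  abel

/-- Transposing changes the sign of the trace. This is the algebraic core of part (a). -/
theorem trace_mul_eq_zero {S A : Matrix (Fin n) (Fin n) ℝ} (hS : S.transpose = S)
    (hA : A.transpose = -A) : (S * A).trace = 0 := by
  have h := Matrix.trace_transpose (S * A)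
  rw [Matrix.transpose_mul, hS, hA, Matrix.neg_mul, Matrix.trace_neg, Matrix.trace_mul_comm] at h
  linarith

theorem invMetric_transpose (θ : Field2 n) (y : Coord n) :
    ((matAt (metric θ) y)⁻¹).transpose = (matAt (metric θ) y)⁻¹ := by
  rw [Matrix.transpose_nonsing_inv, matAt_metric, Matrix.transpose_mul, Matrix.transpose_transpose]

theorem trace_eq_zero_of_antisymm (hd : (matAt (metric θ) y).det ≠ 0)
    {K : Matrix (Fin n) (Fin n) ℝ}
    (hK : (matAt (metric θ) y * K).transpose = -(matAt (metric θ) y * K)) : K.trace = 0 := by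
  have := trace_mul_eq_zero (invMetric_transpose θ y) hK
  rwa [← mul_assoc, Matrix.nonsing_inv_mul _ (isUnit_iff_ne_zero.mpr hd), one_mul] at this

/-- `∂_ν λ = λ Γ^α_{αν}`. -/
theorem pderiv_det (h : IsCoframeAt θ y) (ν : Fin n) :
    pderiv ν (fun z => (matAt θ z).det) y
      = (matAt θ y).det * ∑ α, christoffel (metric θ) α α ν y := by
  -- The contortion is traceless, so the trace in Jacobi's formula may be taken with the Levi-Civita
  -- connection.
  have h1 := trace_eq_zero_of_antisymm (det_metric_ne_zero h.det_ne)
    (metric_mul_contortion_antisymm h ν)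
  rw [Matrix.trace_sub, sub_eq_zero] at h1
  unfold pderiv
  rw [fderiv_det h.smooth h.det_ne, h1]
  rfl

/-- `∂_ν g⁻¹ = -(Γ_ν g⁻¹ + g⁻¹ Γ_νᵀ)`. -/
theorem matDeriv_invMetric (h : IsCoframeAt θ y) (ν : Fin n) :
    matDeriv (basisVec ν) (fun z => (matAt (metric θ) z)⁻¹) y
      = -(connMat (christoffel (metric θ)) ν y * (matAt (metric θ) y)⁻¹
        + (matAt (metric θ) y)⁻¹ * (connMat (christoffel (metric θ)) ν y).transpose) := by
  have hd := det_metric_ne_zero h.det_ne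
  have hu : IsUnit (matAt (metric θ) y).det := isUnit_iff_ne_zero.mpr hd
  rw [matDeriv_inv h.metric_smooth hd, matDeriv_metric_eq (metric_symm θ) hd, mul_add, add_mul,
    ← mul_assoc, mul_assoc _ (matAt (metric θ) y), Matrix.mul_nonsing_inv _ hu, mul_one,
    ← mul_assoc, Matrix.nonsing_inv_mul _ hu, one_mul, add_comm]

/-- The only term not visibly symmetric is `∂_ν Γ^α_{βα}`. There `Γ^α_{βα} = ∂_β log |λ|`, so second
derivatives commute; the proof uses `∂_β λ = λ f_β` and divides by `λ` at the end, avoiding the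
logarithm. -/
theorem ricci_symm (h : ∀ᶠ z in 𝓝 y, IsCoframeAt θ z) (β ν : Fin n) :
    ricci (metric θ) β ν y = ricci (metric θ) ν β y := by
  have h0 : IsCoframeAt θ y := h.self_of_nhds
  set G := christoffel (metric θ) with hG
  have hs : ∀ α μ ν, G α μ ν = G α ν μ := christoffel_symm (metric_symm θ)
  have hsm : ∀ α μ ν, ContDiffAt ℝ ∞ (G α μ ν) y := h0.christoffel_smooth
  set l : Coord n → ℝ := fun z => (matAt θ z).det with hl
  have hlsm : ContDiffAt ℝ ∞ l y := h0.smooth.det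
  let f : Fin n → Coord n → ℝ := fun β z => ∑ α, G α β α z
  have hfsm : ∀ β, ContDiffAt ℝ ∞ (f β) y := fun β => ContDiffAt.sum fun α _ => hsm α β α
  have hlf : ∀ β, pderiv β l =ᶠ[𝓝 y] fun z => l z * f β z := fun β => by
    filter_upwards [h] with z hz
    rw [hl, pderiv_det hz]
    congr 1
    exact Finset.sum_congr rfl fun α _ => by rw [← hG, hs]
  have hpf : ∀ β ν, ∑ α, pderiv ν (G α β α) y = pderiv ν (f β) y := fun β ν =>
    (fderiv_sum_apply _ _ fun α => (hsm α β α).diffAt).symm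
  have hder : ∀ β ν, pderiv ν (pderiv β l) y
      = l y * f ν y * f β y + l y * pderiv ν (f β) y := fun β ν => by
    have e := (hlf ν).self_of_nhds
    simp only at e
    rw [pderiv_congr (hlf β), ← e]
    exact fderiv_mul_apply _ hlsm.diffAt (hfsm β).diffAt
  have hff : pderiv ν (f β) y = pderiv β (f ν) y := by
    have e1 := hder β ν
    have e2 := hder ν β
    rw [pderiv_comm hlsm] at e1
    have : l y * (pderiv ν (f β) y - pderiv β (f ν) y) = 0 := by linarith
    rcases mul_eq_zero.mp this with h1 | h1
    · exact absurd h1 h0.det_ne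
    · linarith
  unfold ricci
  rw [← hG]
  simp only [Finset.sum_sub_distrib]
  rw [hpf, hpf, hff]
  have e1 : ∑ α, ∑ σ, G α ν σ y * G σ β α y = ∑ α, ∑ σ, G α β σ y * G σ ν α y := by
    rw [Finset.sum_comm]
    exact Finset.sum_congr rfl fun α _ => Finset.sum_congr rfl fun σ _ => mul_comm _ _
  rw [e1]
  simp only [hs _ ν β]

end LeviCivita

/-! ### Divergences of symmetric tensors -/

section Divergence

variable {n : ℕ} {θ : Field2 n} {y : Coord n}

/-- This form shows the role of the dual connection: after transposition the two connection terms
become traces over the first two indices of `C`, exactly the pair in which the contortion is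
antisymmetric. -/
theorem divergence_dual (C : Field3 n) (E : Field2 n) (ν : Fin n) (y : Coord n) :
    divergence (dual C) E ν y = (∑ μ, pderiv μ (E μ ν) y)
      + (∑ α, E α ν y * (connMat C α y).trace) - (matAt E y * connMat C ν y).trace := by
  unfold divergence
  rw [Finset.sum_sub_distrib, Finset.sum_add_distrib, Finset.sum_comm (s := Finset.univ)]
  simp only [← Finset.mul_sum]
  rfl

theorem dual_christoffel (θ : Field2 n) :
    dual (christoffel (metric θ)) = christoffel (metric θ) := by
  funext α μ ν
  exact christoffel_symm (metric_symm θ) α ν μ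

/-- Two connections have the same divergence on symmetric tensors if the first two indices of their
difference are antisymmetric. -/
theorem divergence_dual_eq_christoffel (hd : (matAt θ y).det ≠ 0) {C : Field3 n}
    (hC : ∀ ν, (matAt (metric θ) y
        * (connMat C ν y - connMat (christoffel (metric θ)) ν y)).transpose
      = -(matAt (metric θ) y * (connMat C ν y - connMat (christoffel (metric θ)) ν y)))
    {E : Field2 n} {S : Matrix (Fin n) (Fin n) ℝ} (hS : S.transpose = S)
    (hE : matAt E y = S * matAt (metric θ) y) (ν : Fin n) :
    divergence (dual C) E ν y = divergence (christoffel (metric θ)) E ν y := by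
  rw [← dual_christoffel θ, divergence_dual, divergence_dual]
  -- The two connection terms are treated by the same pairing: the first pairs the antisymmetric
  -- difference with `g⁻¹`, the second with `S`.
  have h1 : ∀ α, (connMat C α y).trace = (connMat (christoffel (metric θ)) α y).trace := by
    intro α
    have := trace_eq_zero_of_antisymm (det_metric_ne_zero hd) (hC α)
    rwa [Matrix.trace_sub, sub_eq_zero] at this
  have h2 : (matAt E y * connMat C ν y).trace
      = (matAt E y * connMat (christoffel (metric θ)) ν y).trace := by
    have := trace_mul_eq_zero hS (hC ν)
    rw [← mul_assoc, ← hE, mul_sub, Matrix.trace_sub, sub_eq_zero] at this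
    exact this
  simp only [h1, h2]

theorem matAt_coframe (lam : Field2 n) (y : Coord n) :
    matAt (coframe lam) y = ((matAt lam y)⁻¹).transpose := rfl

theorem connMat_weitzenbock {lam : Field2 n} (ν : Fin n)
    (hd : (matAt lam y).det ≠ 0) :
    connMat (weitzenbock lam) ν y
      = (matAt (coframe lam) y)⁻¹ * matDeriv (basisVec ν) (matAt (coframe lam)) y := by
  have : (matAt (coframe lam) y)⁻¹ = (matAt lam y).transpose := by
    rw [matAt_coframe, ← Matrix.transpose_nonsing_inv,
      Matrix.nonsing_inv_nonsing_inv _ (isUnit_iff_ne_zero.mpr hd)]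
  rw [this]
  rfl

theorem connMat_contortion {lam : Field2 n} (ν : Fin n) (hd : (matAt lam y).det ≠ 0) :
    connMat (contortion lam) ν y = connMat (weitzenbock lam) ν y
      - connMat (christoffel (metric (coframe lam))) ν y := by
  have h1 : (matAt lam y).transpose * matAt (coframe lam) y = 1 := by
    rw [matAt_coframe, ← Matrix.transpose_mul,
      Matrix.nonsing_inv_mul _ (isUnit_iff_ne_zero.mpr hd), Matrix.transpose_one]
  have h2 : connMat (contortion lam) ν y = (matAt lam y).transpose *
      (matDeriv (basisVec ν) (matAt (coframe lam)) y
        - matAt (coframe lam) y * connMat (christoffel (metric (coframe lam))) ν y) := rfl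
  rw [h2, mul_sub, ← mul_assoc, h1, one_mul]
  rfl

theorem divergence_weitzenbock {lam : Field2 n} (hd : (matAt lam y).det ≠ 0)
    (h : IsCoframeAt (coframe lam) y)
    {E : Field2 n} {S : Matrix (Fin n) (Fin n) ℝ} (hS : S.transpose = S)
    (hE : matAt E y = S * matAt (metric (coframe lam)) y) (ν : Fin n) :
    divergence (dual (weitzenbock lam)) E ν y
      = divergence (christoffel (metric (coframe lam))) E ν y := by
  refine divergence_dual_eq_christoffel h.det_ne (fun ν => ?_) hS hE ν
  rw [connMat_weitzenbock ν hd]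
  exact metric_mul_contortion_antisymm h ν

/-- The difference from Levi-Civita is the contortion times `b`, and antisymmetry survives scaling.
-/
theorem divergence_papConnection {lam : Field2 n} (hd : (matAt lam y).det ≠ 0)
    (h : IsCoframeAt (coframe lam) y)
    {E : Field2 n} {S : Matrix (Fin n) (Fin n) ℝ} (hS : S.transpose = S)
    (hE : matAt E y = S * matAt (metric (coframe lam)) y) (b : ℝ) (ν : Fin n) :
    divergence (dual (papConnection b lam)) E ν y
      = divergence (christoffel (metric (coframe lam))) E ν y := by
  refine divergence_dual_eq_christoffel h.det_ne (fun ν => ?_) hS hE ν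
  have h1 : connMat (papConnection b lam) ν y - connMat (christoffel (metric (coframe lam))) ν y
      = b • connMat (contortion lam) ν y := by
    ext α β
    simp [connMat, papConnection]
  rw [h1, connMat_contortion ν hd, connMat_weitzenbock ν hd, Matrix.mul_smul,
    Matrix.transpose_smul, metric_mul_contortion_antisymm h ν, smul_neg]

theorem matAt_lowerSnd (g E : Field2 n) (y : Coord n) :
    matAt (lowerSnd g E) y = matAt E y * matAt g y := rfl

theorem matAt_raiseSnd (g E : Field2 n) (y : Coord n) :
    matAt (raiseSnd g E) y = matAt E y * (matAt g y)⁻¹ := rfl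

theorem matAt_eq_raiseSnd_mul {g E : Field2 n} (hd : (matAt g y).det ≠ 0) :
    matAt E y = matAt (raiseSnd g E) y * matAt g y := by
  rw [matAt_raiseSnd, mul_assoc, Matrix.nonsing_inv_mul _ (isUnit_iff_ne_zero.mpr hd), mul_one]

end Divergence

/-! ### The scalar curvature depends only on the two-jet -/

section JetDependence

variable {n : ℕ}

/-- Two functions that are smooth at `y` and at `y'` and have there the same value and the same
first derivatives. -/
structure AgreeToFirstOrder (f f' : Coord n → ℝ) (y y' : Coord n) : Prop where
  smooth : ContDiffAt ℝ ∞ f y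
  smooth' : ContDiffAt ℝ ∞ f' y'
  val : f y = f' y'
  der : ∀ σ, pderiv σ f y = pderiv σ f' y'

namespace AgreeToFirstOrder

variable {f f' h h' : Coord n → ℝ} {y y' : Coord n}

theorem mul (H : AgreeToFirstOrder f f' y y') (K : AgreeToFirstOrder h h' y y') :
    AgreeToFirstOrder (fun z => f z * h z) (fun z => f' z * h' z) y y' where
  smooth := H.smooth.mul K.smooth
  smooth' := H.smooth'.mul K.smooth'
  val := by rw [H.val, K.val]
  der σ := by
    have e1 := fderiv_mul_apply (basisVec σ) H.smooth.diffAt K.smooth.diffAt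
    have e2 := fderiv_mul_apply (basisVec σ) H.smooth'.diffAt K.smooth'.diffAt
    have e3 := H.der σ
    have e4 := K.der σ
    unfold pderiv at *
    rw [e1, e2, e3, e4, H.val, K.val]

theorem add (H : AgreeToFirstOrder f f' y y') (K : AgreeToFirstOrder h h' y y') :
    AgreeToFirstOrder (fun z => f z + h z) (fun z => f' z + h' z) y y' where
  smooth := H.smooth.add K.smooth
  smooth' := H.smooth'.add K.smooth'
  val := by rw [H.val, K.val]
  der σ := by
    have e1 := fderiv_add_apply (basisVec σ) H.smooth.diffAt K.smooth.diffAt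
    have e2 := fderiv_add_apply (basisVec σ) H.smooth'.diffAt K.smooth'.diffAt
    have e3 := H.der σ
    have e4 := K.der σ
    unfold pderiv at *
    rw [e1, e2, e3, e4]

theorem const_mul (c : ℝ) (H : AgreeToFirstOrder f f' y y') :
    AgreeToFirstOrder (fun z => c * f z) (fun z => c * f' z) y y' where
  smooth := contDiffAt_const.mul H.smooth
  smooth' := contDiffAt_const.mul H.smooth'
  val := by rw [H.val]
  der σ := by
    have e1 := fderiv_const_mul_apply (basisVec σ) c H.smooth.diffAt
    have e2 := fderiv_const_mul_apply (basisVec σ) c H.smooth'.diffAt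
    have e3 := H.der σ
    unfold pderiv at *
    rw [e1, e2, e3]

theorem sub (H : AgreeToFirstOrder f f' y y') (K : AgreeToFirstOrder h h' y y') :
    AgreeToFirstOrder (fun z => f z - h z) (fun z => f' z - h' z) y y' := by
  have := H.add (K.const_mul (-1))
  simpa only [neg_one_mul, ← sub_eq_add_neg] using this

theorem sum {ι : Type*} {s : Finset ι} {f f' : ι → Coord n → ℝ}
    (H : ∀ i, AgreeToFirstOrder (f i) (f' i) y y') :
    AgreeToFirstOrder (fun z => ∑ i ∈ s, f i z) (fun z => ∑ i ∈ s, f' i z) y y' where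
  smooth := ContDiffAt.sum fun i _ => (H i).smooth
  smooth' := ContDiffAt.sum fun i _ => (H i).smooth'
  val := Finset.sum_congr rfl fun i _ => (H i).val
  der σ := by
    have e1 := fderiv_sum_apply s (basisVec σ) fun i => (H i).smooth.diffAt
    have e2 := fderiv_sum_apply s (basisVec σ) fun i => (H i).smooth'.diffAt
    unfold pderiv
    rw [e1, e2]
    exact Finset.sum_congr rfl fun i _ => (H i).der σ

theorem congr {k k' : Coord n → ℝ} (H : AgreeToFirstOrder f f' y y') (e : k =ᶠ[𝓝 y] f)
    (e' : k' =ᶠ[𝓝 y'] f') : AgreeToFirstOrder k k' y y' where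
  smooth := H.smooth.congr_of_eventuallyEq e
  smooth' := H.smooth'.congr_of_eventuallyEq e'
  val := by rw [e.self_of_nhds, e'.self_of_nhds, H.val]
  der σ := by rw [pderiv_congr e, pderiv_congr e', H.der]

end AgreeToFirstOrder

theorem pderiv_metric {θ : Field2 n} {z : Coord n}
    (h : ∀ i μ, DifferentiableAt ℝ (θ i μ) z) (μ ν κ : Fin n) :
    pderiv κ (metric θ μ ν) z
      = ∑ i, (pderiv κ (θ i μ) z * θ i ν z + θ i μ z * pderiv κ (θ i ν) z) := by
  unfold pderiv metric
  rw [fderiv_sum_apply _ _ fun i => (h i μ).fun_mul (h i ν)]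
  exact Finset.sum_congr rfl fun i _ => fderiv_mul_apply _ (h i μ) (h i ν)

/-- The scalar curvatures of two coframes with the same two-jet are equal. -/
theorem scalarCurvature_eq_of_jetOf_eq {θ θ' : Field2 n} {y y' : Coord n} (h : IsCoframeAt θ y)
    (h' : IsCoframeAt θ' y') (hj : jetOf θ y = jetOf θ' y') :
    scalarCurvature (metric θ) y = scalarCurvature (metric θ') y' := by
  have j0 : ∀ i μ, θ i μ y = θ' i μ y' := fun i μ => congrFun (congrFun (congrArg Prod.fst hj) i) μ
  have j1 : ∀ i μ ν, pderiv ν (θ i μ) y = pderiv ν (θ' i μ) y' := fun i μ ν =>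
    congrFun (congrFun (congrFun (congrArg (fun j => j.2.1) hj) i) μ) ν
  have j2 : ∀ i μ ν σ, pderiv σ (pderiv ν (θ i μ)) y = pderiv σ (pderiv ν (θ' i μ)) y' :=
    fun i μ ν σ => congrFun (congrFun (congrFun (congrFun (congrArg (fun j => j.2.2) hj) i) μ) ν) σ
  -- The Ricci tensor differentiates the Christoffel symbols once, so every ingredient up to them is
  -- compared to first order. The second derivatives of the coframe enter only through `a1`.
  have a0 : ∀ i μ, AgreeToFirstOrder (θ i μ) (θ' i μ) y y' := fun i μ =>
    ⟨h.smooth i μ, h'.smooth i μ, j0 i μ, j1 i μ⟩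
  have a1 : ∀ i μ ν, AgreeToFirstOrder (pderiv ν (θ i μ)) (pderiv ν (θ' i μ)) y y' := fun i μ ν =>
    ⟨contDiffAt_pderiv (h.smooth i μ) ν, contDiffAt_pderiv (h'.smooth i μ) ν, j1 i μ ν, j2 i μ ν⟩
  have g0 : ∀ μ ν, AgreeToFirstOrder (metric θ μ ν) (metric θ' μ ν) y y' := fun μ ν =>
    AgreeToFirstOrder.sum fun i => (a0 i μ).mul (a0 i ν)
  -- To compare derivatives of `∂g`, the formula for `∂g` in terms of the coframe must hold on a
  -- neighbourhood, not merely at the point.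
  have ev : ∀ {θ : Field2 n} {y : Coord n}, IsCoframeAt θ y → ∀ μ ν κ,
      pderiv κ (metric θ μ ν) =ᶠ[𝓝 y] fun z =>
        ∑ i, (pderiv κ (θ i μ) z * θ i ν z + θ i μ z * pderiv κ (θ i ν) z) := by
    intro θ y h μ ν κ
    have : ∀ᶠ z in 𝓝 y, ∀ i μ, DifferentiableAt ℝ (θ i μ) z :=
      eventually_all.mpr fun i => eventually_all.mpr fun μ =>
        contDiffAt_infty_eventually (h.smooth i μ)
    filter_upwards [this] with z hz
    exact pderiv_metric hz μ ν κ
  have g1 : ∀ μ ν κ, AgreeToFirstOrder (pderiv κ (metric θ μ ν)) (pderiv κ (metric θ' μ ν)) y y' :=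
    fun μ ν κ => AgreeToFirstOrder.congr (AgreeToFirstOrder.sum fun i =>
      ((a1 i μ κ).mul (a0 i ν)).add ((a0 i μ).mul (a1 i ν κ))) (ev h μ ν κ) (ev h' μ ν κ)
  have gm : matAt (metric θ) y = matAt (metric θ') y' := by
    ext μ ν
    exact (g0 μ ν).val
  have gi : ∀ μ ν, AgreeToFirstOrder (invMetric (metric θ) μ ν) (invMetric (metric θ') μ ν) y y' :=
    fun μ ν => by
    refine ⟨h.invMetric_smooth μ ν, h'.invMetric_smooth μ ν, ?_, fun σ => ?_⟩
    · unfold invMetric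
      rw [gm]
    · have e1 := matDeriv_inv (v := basisVec σ) h.metric_smooth (det_metric_ne_zero h.det_ne)
      have e2 := matDeriv_inv (v := basisVec σ) h'.metric_smooth (det_metric_ne_zero h'.det_ne)
      have e3 : matDeriv (basisVec σ) (matAt (metric θ)) y
          = matDeriv (basisVec σ) (matAt (metric θ')) y' := by
        ext μ ν
        exact (g0 μ ν).der σ
      rw [gm, e3, ← e2] at e1
      exact congrFun (congrFun e1 μ) ν
  have c0 : ∀ α μ ν, AgreeToFirstOrder (christoffel (metric θ) α μ ν)
      (christoffel (metric θ') α μ ν) y y' := fun α μ ν =>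
    AgreeToFirstOrder.const_mul _ <| AgreeToFirstOrder.sum fun σ =>
      (gi α σ).mul (((g1 μ σ ν).add (g1 ν σ μ)).sub (g1 μ ν σ))
  have r0 : ∀ β ν, ricci (metric θ) β ν y = ricci (metric θ') β ν y' := fun β ν => by
    unfold ricci
    simp only [(c0 _ _ _).der, (c0 _ _ _).val]
  unfold scalarCurvature
  simp only [r0, (gi _ _).val]

/-! ### The Taylor coframe of a jet and the Ricci Lagrangian -/

theorem pderiv_proj (μ ν : Fin n) (y : Coord n) :
    pderiv μ (fun z : Coord n => z ν) y = if ν = μ then 1 else 0 := by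
  have : HasFDerivAt (fun z : Coord n => z ν) (EuclideanSpace.proj ν : Coord n →L[ℝ] ℝ) y :=
    (EuclideanSpace.proj ν : Coord n →L[ℝ] ℝ).hasFDerivAt
  unfold pderiv
  rw [this.fderiv]
  simp

/-- A general jet need not be symmetric in its second-derivative slots, so differentiating the
quadratic part symmetrises them. -/
theorem pderiv_taylorCoframe (j : Jet n) (i μ κ : Fin n) (y : Coord n) :
    pderiv κ (taylorCoframe j i μ) y
      = j.2.1 i μ κ + (1 / 2) * ∑ σ, (j.2.2 i μ κ σ + j.2.2 i μ σ κ) * y σ := by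
  have hp : ∀ ν, DifferentiableAt ℝ (fun z : Coord n => z ν) y := fun ν => by fun_prop
  have hq : ∀ ν, fderiv ℝ (fun z : Coord n => z ν) y (basisVec κ) = if ν = κ then 1 else 0 :=
    fun ν => pderiv_proj κ ν y
  unfold pderiv taylorCoframe
  rw [fderiv_add_apply _ (by fun_prop) (by fun_prop), fderiv_add_apply _ (by fun_prop)
    (by fun_prop), fderiv_sum_apply _ _ fun ν => by fun_prop,
    fderiv_const_mul_apply _ _ (by fun_prop), fderiv_sum_apply _ _ fun ν => by fun_prop]
  have e1 : ∀ ν, fderiv ℝ (fun z : Coord n => ∑ σ, j.2.2 i μ ν σ * z ν * z σ) y (basisVec κ)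
      = (∑ σ, j.2.2 i μ ν σ * y σ) * (if ν = κ then 1 else 0) + j.2.2 i μ ν κ * y ν := by
    intro ν
    rw [fderiv_sum_apply _ _ fun σ => by fun_prop]
    have : ∀ σ, fderiv ℝ (fun z : Coord n => j.2.2 i μ ν σ * z ν * z σ) y (basisVec κ)
        = j.2.2 i μ ν σ * y σ * (if ν = κ then 1 else 0)
          + j.2.2 i μ ν σ * y ν * (if σ = κ then 1 else 0) := by
      intro σ
      rw [fderiv_mul_apply _ (by fun_prop) (by fun_prop), fderiv_const_mul_apply _ _ (hp ν), hq, hq]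
      ring
    simp only [this, Finset.sum_add_distrib, ← Finset.sum_mul]
    simp
  have e2 : ∀ ν, fderiv ℝ (fun z : Coord n => j.2.1 i μ ν * z ν) y (basisVec κ)
      = j.2.1 i μ ν * (if ν = κ then 1 else 0) := by
    intro ν
    rw [fderiv_const_mul_apply _ _ (hp ν), hq]
  simp only [e1, e2, Finset.sum_add_distrib, add_mul]
  simp

theorem pderiv_pderiv_taylorCoframe (j : Jet n) (i μ κ τ : Fin n) (y : Coord n) :
    pderiv τ (pderiv κ (taylorCoframe j i μ)) y
      = (1 / 2) * (j.2.2 i μ κ τ + j.2.2 i μ τ κ) := by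
  have hp : ∀ ν, DifferentiableAt ℝ (fun z : Coord n => z ν) y := fun ν => by fun_prop
  have hq : ∀ ν, fderiv ℝ (fun z : Coord n => z ν) y (basisVec τ) = if ν = τ then 1 else 0 :=
    fun ν => pderiv_proj τ ν y
  rw [funext (pderiv_taylorCoframe j i μ κ)]
  unfold pderiv
  rw [fderiv_add_apply _ (by fun_prop) (by fun_prop),
    fderiv_const_mul_apply _ _ (by fun_prop), fderiv_sum_apply _ _ fun ν => by fun_prop]
  have e2 : ∀ σ, fderiv ℝ (fun z : Coord n => (j.2.2 i μ κ σ + j.2.2 i μ σ κ) * z σ) y (basisVec τ)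
      = (j.2.2 i μ κ σ + j.2.2 i μ σ κ) * (if σ = τ then 1 else 0) := by
    intro ν
    rw [fderiv_const_mul_apply _ _ (hp ν), hq]
  simp [e2]

theorem matAt_taylorCoframe_zero (j : Jet n) : matAt (taylorCoframe j) 0 = Matrix.of j.1 := by
  ext i μ
  simp [matAt, taylorCoframe]

theorem famSmooth2_taylorCoframe (j : Jet n) (y : Coord n) :
    FamSmooth2 (fun j : Jet n => taylorCoframe j) j y := fun i μ => by
  unfold FamSmooth taylorCoframe
  fun_prop

theorem isCoframeAt_taylorCoframe {j : Jet n} (h : (Matrix.of j.1).det ≠ 0) :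
    IsCoframeAt (taylorCoframe j) 0 :=
  ⟨(famSmooth2_taylorCoframe j 0).slice, by rwa [matAt_taylorCoframe_zero]⟩

/-- The Taylor coframe is polynomial in the jet and the coordinates jointly, so the jet can serve as
the parameter of a smooth family of coframes. -/
theorem contDiffAt_ricciLagrangian {j : Jet n} (h : (Matrix.of j.1).det ≠ 0) :
    ContDiffAt ℝ ∞ (ricciLagrangian n) j :=
  ((famSmooth2_taylorCoframe j 0).metric.scalarCurvature
    (det_metric_ne_zero (isCoframeAt_taylorCoframe h).det_ne)).param

/-- The Taylor coframe at the origin has the same two-jet as `θ` at `y`: the symmetrisation of the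
second-order slots does nothing here, since second partial derivatives of `θ` commute. -/
theorem ricciLagrangian_jetOf {θ : Field2 n} {y : Coord n} (h : IsCoframeAt θ y) :
    ricciLagrangian n (jetOf θ y) = scalarCurvature (metric θ) y := by
  refine scalarCurvature_eq_of_jetOf_eq (isCoframeAt_taylorCoframe h.det_ne) h ?_
  refine Prod.ext ?_ (Prod.ext ?_ ?_)
  · funext i μ
    exact congrFun (congrFun (matAt_taylorCoframe_zero (jetOf θ y)) i) μ
  · funext i μ ν
    simp only [jetOf]
    rw [pderiv_taylorCoframe]
    simp
  · funext i μ ν σ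
    simp only [jetOf]
    rw [pderiv_pderiv_taylorCoframe]
    simp only
    rw [pderiv_comm (f := θ i μ) (h.smooth i μ) ν σ]
    ring

end JetDependence

/-! ### Invariance of the scalar curvature under changes of coordinates -/

section Curvature

variable {n : ℕ}

/-- The curvature matrices `∂_μ Γ_ν - ∂_ν Γ_μ + [Γ_μ, Γ_ν]` of a connection. -/
def curvMat (C : Field3 n) (μ ν : Fin n) (y : Coord n) : Matrix (Fin n) (Fin n) ℝ :=
  matDeriv (basisVec μ) (connMat C ν) y - matDeriv (basisVec ν) (connMat C μ) y
    + connMat C μ y * connMat C ν y - connMat C ν y * connMat C μ y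

/-- Moves the Ricci tensor to curvature matrices, for which a change of coordinates acts by
conjugation; the index rearrangement uses only that the connection is symmetric. -/
theorem ricci_eq_curvMat (θ : Field2 n) (β ν : Fin n) (y : Coord n) :
    ricci (metric θ) β ν y = ∑ α, curvMat (christoffel (metric θ)) α ν y α β := by
  have hs := christoffel_symm (metric_symm θ)
  unfold ricci curvMat
  rw [← Finset.sum_add_distrib]
  refine Finset.sum_congr rfl fun α _ => ?_
  rw [Finset.sum_sub_distrib]
  simp only [Matrix.add_apply, Matrix.sub_apply, Matrix.mul_apply, matDeriv_apply, connMat,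
    Matrix.of_apply, hs α α, hs α ν]
  unfold pderiv
  ring

theorem scalarCurvature_eq_trace (g : Field2 n) (y : Coord n) :
    scalarCurvature g y = ((matAt g y)⁻¹ * (matAt (ricci g) y).transpose).trace := rfl

theorem pderiv_comp {f : Coord n → ℝ} {φ : Coord n → Coord n} {y : Coord n}
    (hf : DifferentiableAt ℝ f (φ y)) (hφ : DifferentiableAt ℝ φ y) (ν : Fin n) :
    pderiv ν (fun z => f (φ z)) y = ∑ c, pderiv ν (fun z => φ z c) y * pderiv c f (φ y) := by
  have h1 : fderiv ℝ (fun z => f (φ z)) y = (fderiv ℝ f (φ y)).comp (fderiv ℝ φ y) :=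
    fderiv_comp y hf hφ
  have h2 : ∀ c, pderiv ν (fun z => φ z c) y = (fderiv ℝ φ y (basisVec ν)) c := by
    intro c
    have : HasFDerivAt (fun z => φ z c)
        ((EuclideanSpace.proj c : Coord n →L[ℝ] ℝ).comp (fderiv ℝ φ y)) y :=
      (EuclideanSpace.proj c : Coord n →L[ℝ] ℝ).hasFDerivAt.comp y hφ.hasFDerivAt
    unfold pderiv
    rw [this.fderiv]
    rfl
  have h3 : fderiv ℝ φ y (basisVec ν)
      = ∑ c, (fderiv ℝ φ y (basisVec ν)) c • basisVec c := by
    ext k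
    simp [Pi.single_apply]
  simp only [h2]
  unfold pderiv
  rw [h1, ContinuousLinearMap.comp_apply]
  conv_lhs => rw [h3, map_sum]
  simp only [map_smul, smul_eq_mul]

/-- The Jacobian matrix `∂φ^a/∂x^β`. -/
def jacobian (φ : Coord n → Coord n) (z : Coord n) : Matrix (Fin n) (Fin n) ℝ :=
  Matrix.of fun a β => pderiv β (fun w => φ w a) z

theorem contDiffAt_coord {φ : Coord n → Coord n} {y : Coord n} (h : ContDiffAt ℝ ∞ φ y)
    (a : Fin n) : ContDiffAt ℝ ∞ (fun w => φ w a) y := by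
  fun_prop

theorem jacobian_smooth {φ : Coord n → Coord n} {y : Coord n} (h : ContDiffAt ℝ ∞ φ y) :
    MSmooth (jacobian φ) y := fun a β => contDiffAt_pderiv (contDiffAt_coord h a) β

theorem matAt_pullback (φ : Coord n → Coord n) (θ : Field2 n) (y : Coord n) :
    matAt (pullback φ θ) y = matAt θ (φ y) * jacobian φ y := rfl

theorem MSmooth.comp {A : Coord n → Matrix (Fin n) (Fin n) ℝ} {φ : Coord n → Coord n}
    {y : Coord n} (hA : MSmooth A (φ y)) (hφ : ContDiffAt ℝ ∞ φ y) :
    MSmooth (fun z => A (φ z)) y := fun i j => (hA i j).comp y hφ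

theorem matDeriv_comp {A : Coord n → Matrix (Fin n) (Fin n) ℝ} {φ : Coord n → Coord n}
    {y : Coord n} (hA : MSmooth A (φ y)) (hφ : ContDiffAt ℝ ∞ φ y) (ν : Fin n) :
    matDeriv (basisVec ν) (fun z => A (φ z)) y
      = ∑ c, jacobian φ y c ν • matDeriv (basisVec c) A (φ y) := by
  ext i j
  rw [Matrix.sum_apply]
  exact pderiv_comp (hA i j).diffAt hφ.diffAt ν

theorem matDeriv_sum {ι : Type*} {s : Finset ι} {v : Coord n}
    {A : ι → Coord n → Matrix (Fin n) (Fin n) ℝ} {y : Coord n} (hA : ∀ i, MSmooth (A i) y) :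
    matDeriv v (fun z => ∑ i ∈ s, A i z) y = ∑ i ∈ s, matDeriv v (A i) y := by
  ext i j
  rw [Matrix.sum_apply, matDeriv_apply]
  simp only [Matrix.sum_apply]
  exact fderiv_sum_apply s v fun k => (hA k i j).diffAt

/-- The hypotheses on a change of coordinates `φ` and a coframe `θ` near a point `y`. -/
structure PullbackAt (φ : Coord n → Coord n) (θ : Field2 n) (y : Coord n) : Prop where
  smooth : ContDiffAt ℝ ∞ φ y
  det_ne : (jacobian φ y).det ≠ 0
  coframe : IsCoframeAt θ (φ y)

variable {φ : Coord n → Coord n} {θ : Field2 n} {y : Coord n}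

theorem PullbackAt.isCoframeAt (h : PullbackAt φ θ y) : IsCoframeAt (pullback φ θ) y where
  smooth := (h.coframe.smooth.comp h.smooth).mul (jacobian_smooth h.smooth)
  det_ne := by
    rw [matAt_pullback, Matrix.det_mul]
    exact mul_ne_zero h.coframe.det_ne h.det_ne

theorem matAt_metric_pullback (φ : Coord n → Coord n) (θ : Field2 n) (y : Coord n) :
    matAt (metric (pullback φ θ)) y
      = (jacobian φ y).transpose * matAt (metric θ) (φ y) * jacobian φ y := by
  rw [matAt_metric, matAt_metric, matAt_pullback, Matrix.transpose_mul]
  simp only [mul_assoc]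

/-- The pulled back connection matrices `∑ c, ∂φ^c/∂x^ν Γ_c`. -/
def pullConn (φ : Coord n → Coord n) (C : Field3 n) (ν : Fin n) (y : Coord n) :
    Matrix (Fin n) (Fin n) ℝ :=
  ∑ c, jacobian φ y c ν • connMat C c (φ y)

/-- The transformation law of the Christoffel symbols. -/
theorem jacobian_mul_christoffel (h : PullbackAt φ θ y) (ν : Fin n) :
    jacobian φ y * connMat (christoffel (metric (pullback φ θ))) ν y
      = pullConn φ (christoffel (metric θ)) ν y * jacobian φ y
        + matDeriv (basisVec ν) (jacobian φ) y := by
  set Φ := jacobian φ y with hΦ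
  have hu : IsUnit Φ.det := isUnit_iff_ne_zero.mpr h.det_ne
  set g := metric θ with hg
  have hs : ∀ α μ ν, christoffel g α μ ν = christoffel g α ν μ := christoffel_symm (metric_symm θ)
  set A := fun ν => pullConn φ (christoffel g) ν y with hA
  set D := fun ν => matDeriv (basisVec ν) (jacobian φ) y with hD
  have hgd := det_metric_ne_zero h.coframe.det_ne
  have hgs : (matAt g (φ y)).transpose = matAt g (φ y) := by
    rw [hg, matAt_metric, Matrix.transpose_mul, Matrix.transpose_transpose]
  -- By uniqueness of the Levi-Civita connection it is enough that the candidate `Φ⁻¹ (A_ν Φ + ∂_ν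
  -- Φ)` is symmetric in its lower indices, where the second derivatives of `φ` commute, and metric
  -- for the pulled back metric.
  have h1 : ∀ ν, connMat (christoffel (metric (pullback φ θ))) ν y
      = Φ⁻¹ * (A ν * Φ + D ν) := by
    refine christoffel_unique (C := fun ν => Φ⁻¹ * (A ν * Φ + D ν)) (metric_symm _)
      (det_metric_ne_zero h.isCoframeAt.det_ne) ?_ ?_
    · intro α μ ν
      rw [Matrix.mul_apply, Matrix.mul_apply]
      refine Finset.sum_congr rfl fun a _ => ?_
      congr 1
      rw [Matrix.add_apply, Matrix.add_apply]
      congr 1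
      · simp only [hA, pullConn, Matrix.mul_apply, Matrix.sum_apply, Matrix.smul_apply,
          smul_eq_mul, Finset.sum_mul]
        rw [Finset.sum_comm]
        refine Finset.sum_congr rfl fun c _ => Finset.sum_congr rfl fun b _ => ?_
        simp only [connMat, Matrix.of_apply, hs a c b, hΦ]
        ring
      · exact pderiv_comm (contDiffAt_coord h.smooth a) ν μ
    · intro ν
      have e1 : matDeriv (basisVec ν) (matAt (metric (pullback φ θ))) y
          = ((D ν).transpose * matAt g (φ y)
              + Φ.transpose * ((A ν).transpose * matAt g (φ y) + matAt g (φ y) * A ν)) * Φ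
            + Φ.transpose * matAt g (φ y) * D ν := by
        rw [funext (matAt_metric_pullback φ θ)]
        have hJ := jacobian_smooth h.smooth
        have hG := h.coframe.metric_smooth.comp h.smooth
        rw [matDeriv_mul (hJ.transpose.mul hG) hJ, matDeriv_mul hJ.transpose hG,
          matDeriv_transpose, matDeriv_comp h.coframe.metric_smooth h.smooth]
        have e2 : ∑ c, jacobian φ y c ν • matDeriv (basisVec c) (matAt (metric θ)) (φ y)
            = (A ν).transpose * matAt g (φ y) + matAt g (φ y) * A ν := by
          simp only [matDeriv_metric_eq (metric_symm θ) hgd, hA, pullConn,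
            Matrix.transpose_sum, Matrix.transpose_smul, Finset.sum_mul, Finset.mul_sum,
            Matrix.smul_mul, Matrix.mul_smul, smul_add, Finset.sum_add_distrib]
          rfl
        rw [e2]
      have e3 : matAt (metric (pullback φ θ)) y * (Φ⁻¹ * (A ν * Φ + D ν))
          = Φ.transpose * matAt g (φ y) * (A ν * Φ + D ν) := by
        rw [matAt_metric_pullback, ← mul_assoc, mul_assoc _ (jacobian φ y), ← hΦ,
          Matrix.mul_nonsing_inv _ hu, mul_one]
      have e4 : (Φ⁻¹ * (A ν * Φ + D ν)).transpose * matAt (metric (pullback φ θ)) y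
          = (Φ.transpose * matAt g (φ y) * (A ν * Φ + D ν)).transpose := by
        rw [← e3, Matrix.transpose_mul (matAt _ _)]
        congr 1
        rw [matAt_metric, Matrix.transpose_mul, Matrix.transpose_transpose]
      rw [e1, e3, e4]
      simp only [Matrix.transpose_mul, Matrix.transpose_add, hgs, Matrix.transpose_transpose]
      noncomm_ring
  rw [h1, ← mul_assoc, Matrix.mul_nonsing_inv _ hu, one_mul]

theorem connMat_smooth (h : IsCoframeAt θ y) (ν : Fin n) :
    MSmooth (connMat (christoffel (metric θ)) ν) y := fun α β => h.christoffel_smooth α β ν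

theorem pullConn_smooth (h : PullbackAt φ θ y) (ν : Fin n) :
    MSmooth (pullConn φ (christoffel (metric θ)) ν) y :=
  MSmooth.sum fun c => MSmooth.smul (jacobian_smooth h.smooth c ν)
    ((connMat_smooth h.coframe c).comp h.smooth)

theorem matDeriv_pullConn (h : PullbackAt φ θ y) (μ ν : Fin n) :
    matDeriv (basisVec μ) (pullConn φ (christoffel (metric θ)) ν) y
      = (∑ c, pderiv μ (fun z => jacobian φ z c ν) y • connMat (christoffel (metric θ)) c (φ y))
        + ∑ d, ∑ c, (jacobian φ y d μ * jacobian φ y c ν) •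
          matDeriv (basisVec d) (connMat (christoffel (metric θ)) c) (φ y) := by
  unfold pullConn
  rw [matDeriv_sum fun c => MSmooth.smul (jacobian_smooth h.smooth c ν)
    ((connMat_smooth h.coframe c).comp h.smooth)]
  rw [Finset.sum_comm, ← Finset.sum_add_distrib]
  refine Finset.sum_congr rfl fun c _ => ?_
  rw [matDeriv_smul (jacobian_smooth h.smooth c ν) ((connMat_smooth h.coframe c).comp h.smooth),
    matDeriv_comp (connMat_smooth h.coframe c) h.smooth, Finset.smul_sum]
  congr 1
  refine Finset.sum_congr rfl fun d _ => ?_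
  rw [smul_smul, mul_comm]

/-- The curvature of the pulled back connection. -/
theorem curvature_pullConn (h : PullbackAt φ θ y) (μ ν : Fin n) :
    matDeriv (basisVec μ) (pullConn φ (christoffel (metric θ)) ν) y
        - matDeriv (basisVec ν) (pullConn φ (christoffel (metric θ)) μ) y
        + pullConn φ (christoffel (metric θ)) μ y * pullConn φ (christoffel (metric θ)) ν y
        - pullConn φ (christoffel (metric θ)) ν y * pullConn φ (christoffel (metric θ)) μ y
      = ∑ d, ∑ c, (jacobian φ y d μ * jacobian φ y c ν) •
          curvMat (christoffel (metric θ)) d c (φ y) := by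
  -- The second derivatives of `φ` are symmetric in `μ` and `ν`, so they drop out of the
  -- antisymmetrised derivative.
  have hsym : ∀ c, pderiv μ (fun z => jacobian φ z c ν) y = pderiv ν (fun z => jacobian φ z c μ) y :=
    fun c => pderiv_comm (contDiffAt_coord h.smooth c) μ ν
  have hprod : ∀ μ ν, pullConn φ (christoffel (metric θ)) μ y
      * pullConn φ (christoffel (metric θ)) ν y
      = ∑ d, ∑ c, (jacobian φ y d μ * jacobian φ y c ν) •
        (connMat (christoffel (metric θ)) d (φ y) * connMat (christoffel (metric θ)) c (φ y)) := by
    intro μ ν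
    simp only [pullConn, Finset.sum_mul, Finset.mul_sum, Matrix.smul_mul, Matrix.mul_smul, smul_smul]
    rw [Finset.sum_comm]
    exact Finset.sum_congr rfl fun _ _ => Finset.sum_congr rfl fun _ _ => by rw [mul_comm]
  have hswap : ∀ M : Fin n → Fin n → Matrix (Fin n) (Fin n) ℝ,
      ∑ d, ∑ c, (jacobian φ y d ν * jacobian φ y c μ) • M d c
        = ∑ d, ∑ c, (jacobian φ y d μ * jacobian φ y c ν) • M c d := by
    intro M
    rw [Finset.sum_comm]
    exact Finset.sum_congr rfl fun _ _ => Finset.sum_congr rfl fun _ _ => by rw [mul_comm]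
  rw [matDeriv_pullConn h, matDeriv_pullConn h, hprod, hprod, hswap, hswap]
  simp only [hsym, curvMat, smul_add, smul_sub, Finset.sum_add_distrib, Finset.sum_sub_distrib]
  abel

/-- The curvature is a tensor. -/
theorem jacobian_mul_curvMat (h : ∀ᶠ z in 𝓝 y, PullbackAt φ θ z) (μ ν : Fin n) :
    jacobian φ y * curvMat (christoffel (metric (pullback φ θ))) μ ν y
      = (∑ d, ∑ c, (jacobian φ y d μ * jacobian φ y c ν) •
          curvMat (christoffel (metric θ)) d c (φ y)) * jacobian φ y := by
  have h0 := h.self_of_nhds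
  rw [← curvature_pullConn h0]
  have hJ := jacobian_smooth h0.smooth
  have hD : ∀ ν, MSmooth (fun z => matDeriv (basisVec ν) (jacobian φ) z) y := fun ν a β =>
    contDiffAt_pderiv (hJ a β) ν
  -- The transformation law of the Christoffel symbols holds near `y` and may be differentiated. In
  -- the antisymmetrisation the second derivatives of the Jacobian cancel by `hcomm`, and the
  -- first-derivative terms cancel against those of the products.
  have hd : ∀ μ ν, matDeriv (basisVec μ) (jacobian φ) y
        * connMat (christoffel (metric (pullback φ θ))) ν y
      + jacobian φ y * matDeriv (basisVec μ)
        (connMat (christoffel (metric (pullback φ θ))) ν) y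
      = matDeriv (basisVec μ) (pullConn φ (christoffel (metric θ)) ν) y * jacobian φ y
        + pullConn φ (christoffel (metric θ)) ν y * matDeriv (basisVec μ) (jacobian φ) y
        + matDeriv (basisVec μ) (fun z => matDeriv (basisVec ν) (jacobian φ) z) y := by
    intro μ ν
    rw [← matDeriv_mul hJ (connMat_smooth h0.isCoframeAt ν),
      ← matDeriv_mul (pullConn_smooth h0 ν) hJ,
      ← matDeriv_add ((pullConn_smooth h0 ν).mul hJ) (hD ν)]
    apply matDeriv_congr
    filter_upwards [h] with z hz
    exact jacobian_mul_christoffel hz ν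
  have hcomm : matDeriv (basisVec μ) (fun z => matDeriv (basisVec ν) (jacobian φ) z) y
      = matDeriv (basisVec ν) (fun z => matDeriv (basisVec μ) (jacobian φ) z) y := by
    ext a β
    exact pderiv_comm (hJ a β) μ ν
  have e1 := hd μ ν
  have e2 := hd ν μ
  have e3 := jacobian_mul_christoffel h0 ν
  have e4 := jacobian_mul_christoffel h0 μ
  rw [hcomm] at e1
  unfold curvMat
  set Φ := jacobian φ y
  set X := matDeriv (basisVec μ) (connMat (christoffel (metric (pullback φ θ))) ν) y
  set Y := matDeriv (basisVec ν) (connMat (christoffel (metric (pullback φ θ))) μ) y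
  set W := connMat (christoffel (metric (pullback φ θ))) ν y
  set V := connMat (christoffel (metric (pullback φ θ))) μ y
  set A := pullConn φ (christoffel (metric θ)) μ y
  set B := pullConn φ (christoffel (metric θ)) ν y
  have f1 := eq_sub_of_add_eq' e1
  have f2 := eq_sub_of_add_eq' e2
  have f3 : Φ * (V * W) = A * (B * Φ + matDeriv (basisVec ν) (jacobian φ) y)
      + matDeriv (basisVec μ) (jacobian φ) y * W := by
    rw [← mul_assoc, e4, add_mul, mul_assoc, e3]
  have f4 : Φ * (W * V) = B * (A * Φ + matDeriv (basisVec μ) (jacobian φ) y)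
      + matDeriv (basisVec ν) (jacobian φ) y * V := by
    rw [← mul_assoc, e3, add_mul, mul_assoc, e4]
  rw [mul_sub, mul_add, mul_sub, f1, f2, f3, f4]
  noncomm_ring

/-- The curvature carries two Jacobian factors for its form indices and a conjugation by `Φ`.
Contraction cancels one Jacobian factor against the conjugating `Φ⁻¹`, which leaves `Φᵀ Ric Φ`. -/
theorem matAt_ricci_pullback (h : ∀ᶠ z in 𝓝 y, PullbackAt φ θ z) :
    matAt (ricci (metric (pullback φ θ))) y
      = (jacobian φ y).transpose * matAt (ricci (metric θ)) (φ y) * jacobian φ y := by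
  have h0 := h.self_of_nhds
  have hu : IsUnit (jacobian φ y).det := isUnit_iff_ne_zero.mpr h0.det_ne
  set Φ := jacobian φ y with hΦ
  have hF : ∀ μ ν, curvMat (christoffel (metric (pullback φ θ))) μ ν y
      = ∑ d, ∑ c, (Φ d μ * Φ c ν) •
        (Φ⁻¹ * (curvMat (christoffel (metric θ)) d c (φ y) * Φ)) := by
    intro μ ν
    have := congrArg (fun M => Φ⁻¹ * M) (jacobian_mul_curvMat h μ ν)
    simp only [← hΦ] at this
    rw [← mul_assoc, Matrix.nonsing_inv_mul _ hu, one_mul] at this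
    rw [this]
    simp only [Finset.sum_mul, Finset.mul_sum, Matrix.smul_mul, Matrix.mul_smul]
  have hcontract : ∀ (M : Matrix (Fin n) (Fin n) ℝ) d β, ∑ α, Φ d α * (Φ⁻¹ * M) α β = M d β := by
    intro M d β
    rw [← Matrix.mul_apply, ← mul_assoc, Matrix.mul_nonsing_inv _ hu, one_mul]
  ext β ν
  change ricci (metric (pullback φ θ)) β ν y = _
  rw [ricci_eq_curvMat]
  simp only [hF, Matrix.sum_apply, Matrix.smul_apply, smul_eq_mul]
  have e1 : ∑ α, ∑ d, ∑ c, Φ d α * Φ c ν *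
        (Φ⁻¹ * (curvMat (christoffel (metric θ)) d c (φ y) * Φ)) α β
      = ∑ d, ∑ c, Φ c ν * (curvMat (christoffel (metric θ)) d c (φ y) * Φ) d β := by
    rw [Finset.sum_comm]
    refine Finset.sum_congr rfl fun d _ => ?_
    rw [Finset.sum_comm]
    refine Finset.sum_congr rfl fun c _ => ?_
    rw [← hcontract (curvMat (christoffel (metric θ)) d c (φ y) * Φ) d β, Finset.mul_sum]
    exact Finset.sum_congr rfl fun α _ => by ring
  rw [e1, Finset.sum_comm, Matrix.mul_apply]
  refine Finset.sum_congr rfl fun c _ => ?_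
  rw [← Finset.mul_sum, mul_comm, Matrix.mul_apply]
  congr 1
  simp only [Matrix.mul_apply]
  rw [Finset.sum_comm]
  refine Finset.sum_congr rfl fun b _ => ?_
  rw [← Finset.sum_mul, ← ricci_eq_curvMat, mul_comm]
  rfl

/-- The scalar curvature is a scalar. -/
theorem scalarCurvature_pullback (h : ∀ᶠ z in 𝓝 y, PullbackAt φ θ z) :
    scalarCurvature (metric (pullback φ θ)) y = scalarCurvature (metric θ) (φ y) := by
  have hu : IsUnit (jacobian φ y).det := isUnit_iff_ne_zero.mpr h.self_of_nhds.det_ne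
  have hut : IsUnit (jacobian φ y).transpose.det := by rwa [Matrix.det_transpose]
  rw [scalarCurvature_eq_trace, scalarCurvature_eq_trace, matAt_ricci_pullback h,
    matAt_metric_pullback, Matrix.mul_inv_rev, Matrix.mul_inv_rev, Matrix.transpose_mul,
    Matrix.transpose_mul, Matrix.transpose_transpose]
  set Φ := jacobian φ y
  set G := (matAt (metric θ) (φ y))⁻¹
  set R := (matAt (ricci (metric θ)) (φ y)).transpose
  have : Φ⁻¹ * (G * Φ.transpose⁻¹) * (Φ.transpose * (R * Φ)) = Φ⁻¹ * (G * R * Φ) := by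
    rw [mul_assoc, mul_assoc, ← mul_assoc Φ.transpose⁻¹, Matrix.nonsing_inv_mul _ hut, one_mul,
      mul_assoc G]
  rw [this, Matrix.trace_mul_comm, mul_assoc, Matrix.mul_nonsing_inv _ hu, mul_one]

theorem jacobian_mul_jacobian {φ ψ : Coord n → Coord n} {y : Coord n}
    (hφ : DifferentiableAt ℝ φ y) (hψ : DifferentiableAt ℝ ψ (φ y)) :
    jacobian (fun z => ψ (φ z)) y = jacobian ψ (φ y) * jacobian φ y := by
  ext a β
  rw [Matrix.mul_apply]
  have hψa : DifferentiableAt ℝ (fun w => ψ w a) (φ y) := by fun_prop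
  refine (pderiv_comp (f := fun w => ψ w a) hψa hφ β).trans ?_
  exact Finset.sum_congr rfl fun c _ => mul_comm _ _

theorem jacobian_id (y : Coord n) : jacobian (fun z : Coord n => z) y = 1 := by
  ext a β
  rw [Matrix.one_apply]
  exact pderiv_proj β a y

theorem pullbackAt_of_diffeo {φ : OpenPartialHomeomorph (Coord n) (Coord n)}
    (hφ : ContDiffOn ℝ ∞ φ φ.source) (hs : ContDiffOn ℝ ∞ φ.symm φ.target)
    (hθ : ∀ i μ, ContDiffOn ℝ ∞ (θ i μ) φ.target) (hd : ∀ y ∈ φ.target, (matAt θ y).det ≠ 0)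
    (hy : y ∈ φ.source) : PullbackAt φ θ y := by
  have h1 : ContDiffAt ℝ ∞ φ y := hφ.contDiffAt (φ.open_source.mem_nhds hy)
  have ht := φ.map_source hy
  have h2 : ContDiffAt ℝ ∞ φ.symm (φ y) := hs.contDiffAt (φ.open_target.mem_nhds ht)
  refine ⟨h1, ?_, fun i μ => (hθ i μ).contDiffAt (φ.open_target.mem_nhds ht), hd _ ht⟩
  have h3 := jacobian_mul_jacobian h1.diffAt h2.diffAt
  have h4 : jacobian (fun z => φ.symm (φ z)) y = 1 := by
    rw [← jacobian_id y]
    ext a β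
    refine pderiv_congr ?_ β
    filter_upwards [φ.open_source.mem_nhds hy] with z hz
    rw [φ.left_inv hz]
  rw [h4] at h3
  intro h0
  have := congrArg Matrix.det h3
  rw [Matrix.det_mul, h0, mul_zero, Matrix.det_one] at this
  exact one_ne_zero this

/-- The Ricci scalar is a Lagrangian function. -/
theorem isLagrangian_ricciLagrangian (n : ℕ) : IsLagrangian (ricciLagrangian n) where
  smooth := fun _ hj => (contDiffAt_ricciLagrangian hj).contDiffWithinAt
  scalar := fun φ hφ hs θ hθ hd y hy => by
    have h := fun z (hz : z ∈ φ.source) => pullbackAt_of_diffeo hφ hs hθ hd hz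
    rw [ricciLagrangian_jetOf (h y hy).isCoframeAt, ricciLagrangian_jetOf (h y hy).coframe]
    exact scalarCurvature_pullback (Filter.eventually_of_mem (φ.open_source.mem_nhds hy) h)

end Curvature

/-! ### Test functions and integration by parts -/

section TestFunctions

open MeasureTheory

variable {n : ℕ} {U : Set (Coord n)}

/-- Smooth functions with compact support in `U`. -/
structure IsTest (U : Set (Coord n)) (f : Coord n → ℝ) : Prop where
  smooth : ContDiff ℝ ∞ f
  compact : HasCompactSupport f
  subset : tsupport f ⊆ U

/-- `U` and the complement of `K` cover the space, and the function is smooth on both. This lets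
functions known to be smooth only on `U` be multiplied by test functions and integrated over the
whole space. -/
theorem IsTest.of_compact {f : Coord n → ℝ} {K : Set (Coord n)} (hK : IsCompact K) (hKU : K ⊆ U)
    (hf : ∀ z ∈ U, ContDiffAt ℝ ∞ f z) (h0 : ∀ z, z ∉ K → f z = 0) : IsTest U f := by
  have hs : tsupport f ⊆ K := closure_minimal (fun z hz => by
    by_contra h
    exact hz (h0 z h)) hK.isClosed
  refine ⟨contDiff_iff_contDiffAt.mpr fun z => ?_, hK.of_isClosed_subset (isClosed_tsupport f) hs,
    hs.trans hKU⟩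
  by_cases hz : z ∈ U
  · exact hf z hz
  · have hzK : Kᶜ ∈ 𝓝 z := hK.isClosed.isOpen_compl.mem_nhds fun h => hz (hKU h)
    refine (contDiffAt_const (c := (0 : ℝ))).congr_of_eventuallyEq ?_
    filter_upwards [hzK] with w hw
    exact h0 w hw

theorem eventually_zero_of_notMem {f : Coord n → ℝ} {z : Coord n}
    (hz : z ∉ tsupport f) : f =ᶠ[𝓝 z] fun _ => 0 :=
  notMem_tsupport_iff_eventuallyEq.mp hz

theorem pderiv_const (μ : Fin n) (c : ℝ) (z : Coord n) : pderiv μ (fun _ => c) z = 0 := by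
  simp [pderiv]

theorem pderiv_zero_of_notMem {f : Coord n → ℝ} {z : Coord n}
    (hz : z ∉ tsupport f) (μ : Fin n) : pderiv μ f z = 0 := by
  rw [pderiv_congr (eventually_zero_of_notMem hz), pderiv_const]

theorem IsTest.pderiv {f : Coord n → ℝ} (h : IsTest U f) (μ : Fin n) :
    IsTest U (PAP.pderiv μ f) :=
  IsTest.of_compact h.compact h.subset (fun _ _ => contDiffAt_pderiv h.smooth.contDiffAt μ)
    fun _ hz => pderiv_zero_of_notMem hz μ

theorem IsTest.smooth_mul {f ρ : Coord n → ℝ} (h : IsTest U ρ)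
    (hf : ∀ z ∈ U, ContDiffAt ℝ ∞ f z) : IsTest U (fun z => f z * ρ z) :=
  IsTest.of_compact h.compact h.subset (fun z hz => (hf z hz).mul h.smooth.contDiffAt)
    fun z hz => by rw [image_eq_zero_of_notMem_tsupport hz, mul_zero]

theorem IsTest.add {f g : Coord n → ℝ} (hf : IsTest U f) (hg : IsTest U g) :
    IsTest U (fun z => f z + g z) :=
  IsTest.of_compact (hf.compact.isCompact.union hg.compact.isCompact)
    (Set.union_subset hf.subset hg.subset)
    (fun _ _ => hf.smooth.contDiffAt.add hg.smooth.contDiffAt)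
    fun z hz => by
      rw [image_eq_zero_of_notMem_tsupport fun h => hz (Or.inl h),
        image_eq_zero_of_notMem_tsupport fun h => hz (Or.inr h), add_zero]

theorem IsTest.zero : IsTest U (fun _ : Coord n => (0 : ℝ)) :=
  IsTest.of_compact isCompact_empty (Set.empty_subset U) (fun _ _ => contDiffAt_const)
    fun _ _ => rfl

theorem IsTest.sum {ι : Type*} {s : Finset ι} {f : ι → Coord n → ℝ} (hf : ∀ i, IsTest U (f i)) :
    IsTest U (fun z => ∑ i ∈ s, f i z) := by
  classical
  induction s using Finset.induction_on with
  | empty => simpa using IsTest.zero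
  | insert i s hi ih =>
    simp only [Finset.sum_insert hi]
    exact (hf i).add ih

theorem IsTest.integrable {f : Coord n → ℝ} (h : IsTest U f) : Integrable f :=
  h.smooth.continuous.integrable_of_hasCompactSupport h.compact

theorem IsTest.integral_pderiv {f : Coord n → ℝ} (h : IsTest U f) (μ : Fin n) :
    ∫ z, PAP.pderiv μ f z = 0 := by
  -- Integration by parts against the constant function `1`.
  have h1 := integral_mul_fderiv_eq_neg_fderiv_mul_of_integrable (μ := (volume : Measure (Coord n)))
    (f := fun _ : Coord n => (1 : ℝ)) (g := f) (v := basisVec μ) (by simp)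
    (by simpa using! (h.pderiv μ).integrable) (by simpa using h.integrable)
    (fun _ _ => differentiableAt_const _) fun _ _ => h.smooth.contDiffAt.diffAt
  simpa [PAP.pderiv] using h1

/-- The product rule holds even off `U`, where nothing is known about `f`: there `ρ` vanishes in a
neighbourhood. -/
theorem IsTest.pderiv_mul {f ρ : Coord n → ℝ} (h : IsTest U ρ)
    (hf : ∀ z ∈ U, ContDiffAt ℝ ∞ f z) (μ : Fin n) (z : Coord n) :
    PAP.pderiv μ (fun z => f z * ρ z) z = PAP.pderiv μ f z * ρ z + f z * PAP.pderiv μ ρ z := by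
  by_cases hz : z ∈ U
  · exact fderiv_mul_apply _ (hf z hz).diffAt h.smooth.contDiffAt.diffAt
  · have hz' : z ∉ tsupport ρ := fun H => hz (h.subset H)
    rw [pderiv_zero_of_notMem hz', image_eq_zero_of_notMem_tsupport hz', mul_zero, mul_zero, add_zero,
      ← pderiv_const μ 0 z]
    refine pderiv_congr ?_ μ
    filter_upwards [eventually_zero_of_notMem hz'] with w hw
    rw [hw, mul_zero]

theorem IsTest.integral_mul_pderiv {f ρ : Coord n → ℝ} (h : IsTest U ρ)
    (hf : ∀ z ∈ U, ContDiffAt ℝ ∞ f z) (μ : Fin n) :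
    ∫ z, f z * PAP.pderiv μ ρ z = ∫ z, -PAP.pderiv μ f z * ρ z := by
  have h1 := (h.smooth_mul hf).integral_pderiv μ
  simp only [h.pderiv_mul hf] at h1
  rw [integral_add (h.smooth_mul fun z hz => contDiffAt_pderiv (hf z hz) μ).integrable
    ((h.pderiv μ).smooth_mul hf).integrable] at h1
  simp only [neg_mul]
  rw [integral_neg]
  linarith

/-- The fundamental lemma of the calculus of variations: vanishing almost everywhere, improved by
continuity to vanishing everywhere on `U`. -/
theorem eq_zero_of_integral_mul_test {f : Coord n → ℝ} (hU : IsOpen U) (hf : ContinuousOn f U)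
    (h : ∀ ρ, IsTest U ρ → ∫ z, f z * ρ z = 0) : ∀ z ∈ U, f z = 0 := by
  have hl : LocallyIntegrableOn f U := hf.locallyIntegrableOn hU.measurableSet
  have h1 := hU.ae_eq_zero_of_integral_contDiff_smul_eq_zero (μ := volume) hl fun g g1 g2 g3 => by
    have := h g ⟨g1, g2, g3⟩
    simpa [mul_comm] using this
  have h2 : f =ᵐ[volume.restrict U] fun _ => 0 := by
    rw [Filter.EventuallyEq, ae_restrict_iff' hU.measurableSet]
    exact h1
  exact Measure.eqOn_open_of_ae_eq h2 hU hf continuousOn_const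

end TestFunctions

/-! ### The first variation -/

section FirstVariation

open MeasureTheory

variable {n : ℕ} {U : Set (Coord n)} {θ : Field2 n} {F : Jet n → ℝ}

/-- The Euler-Lagrange expression of `F`. -/
def eulerLagrange (F : Jet n → ℝ) (θ : Field2 n) (i β : Fin n) (y : Coord n) : ℝ :=
  dJet0 F i β (jetOf θ y)
    - (∑ γ, pderiv γ (fun z => dJet1 F i β γ (jetOf θ z)) y)
    + ∑ γ, ∑ σ, pderiv γ (pderiv σ (fun z => dJet2 F i β γ σ (jetOf θ z))) y

/-- The expansion runs over all ordered pairs `γ, σ` as independent directions, in agreement with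
the convention in `dJet2`. -/
theorem jet_eq_sum (j : Jet n) :
    j = (∑ i, ∑ β, j.1 i β • ((Pi.single i (Pi.single β 1), 0, 0) : Jet n))
      + (∑ i, ∑ β, ∑ γ, j.2.1 i β γ • ((0, Pi.single i (Pi.single β (Pi.single γ 1)), 0) : Jet n))
      + ∑ i, ∑ β, ∑ γ, ∑ σ, j.2.2 i β γ σ •
        ((0, 0, Pi.single i (Pi.single β (Pi.single γ (Pi.single σ 1)))) : Jet n) := by
  have s2 : ∀ {V : Type} [AddCommGroup V] [Module ℝ V] (a : Fin n → V),
      ∑ i, (Pi.single i (a i) : Fin n → V) = a := fun a => Finset.univ_sum_single a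
  have t2 : ∀ {V : Type} [AddCommGroup V] [Module ℝ V] (i : Fin n) (s : Finset (Fin n))
      (a : Fin n → V), ∑ β ∈ s, (Pi.single i (a β) : Fin n → V) = Pi.single i (∑ β ∈ s, a β) :=
    fun i s a => (map_sum (AddMonoidHom.single (fun _ => _) i) a s).symm
  refine Prod.ext ?_ (Prod.ext ?_ ?_)
  · simp only [Prod.fst_add, Prod.fst_sum, Prod.smul_fst, smul_zero, Finset.sum_const_zero,
      add_zero, ← Pi.single_smul, t2, s2, smul_eq_mul, mul_one]
  · simp only [Prod.snd_add, Prod.fst_add, Prod.snd_sum, Prod.fst_sum, Prod.smul_fst,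
      Prod.smul_snd, smul_zero, Finset.sum_const_zero,
      add_zero, zero_add, ← Pi.single_smul, t2, s2, smul_eq_mul, mul_one]
  · simp only [Prod.snd_add, Prod.snd_sum,
      Prod.smul_snd, smul_zero, Finset.sum_const_zero,
      zero_add, ← Pi.single_smul, t2, s2, smul_eq_mul, mul_one]

theorem fderiv_jet_apply (F : Jet n → ℝ) (p j : Jet n) :
    fderiv ℝ F p j = (∑ i, ∑ β, dJet0 F i β p * j.1 i β)
      + (∑ i, ∑ β, ∑ γ, dJet1 F i β γ p * j.2.1 i β γ)
      + ∑ i, ∑ β, ∑ γ, ∑ σ, dJet2 F i β γ σ p * j.2.2 i β γ σ := by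
  conv_lhs => rw [jet_eq_sum j]
  simp only [map_add, map_sum, map_smul, smul_eq_mul, dJet0, dJet1, dJet2,
    mul_comm (fderiv ℝ F p _)]

theorem contDiffAt_jetOf {y : Coord n} (h : MSmooth (matAt θ) y) :
    ContDiffAt ℝ ∞ (jetOf θ) y := by
  refine ContDiffAt.prodMk ?_ (ContDiffAt.prodMk ?_ ?_)
  · exact contDiffAt_pi.mpr fun i => contDiffAt_pi.mpr fun μ => h i μ
  · exact contDiffAt_pi.mpr fun i => contDiffAt_pi.mpr fun μ => contDiffAt_pi.mpr fun ν =>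
      contDiffAt_pderiv (h i μ) ν
  · exact contDiffAt_pi.mpr fun i => contDiffAt_pi.mpr fun μ => contDiffAt_pi.mpr fun ν =>
      contDiffAt_pi.mpr fun σ => contDiffAt_pderiv (contDiffAt_pderiv (h i μ) ν) σ

theorem contDiffAt_fderiv_jetOf {y : Coord n} (hF : ContDiffAt ℝ ∞ F (jetOf θ y))
    (h : MSmooth (matAt θ) y) (v : Jet n) :
    ContDiffAt ℝ ∞ (fun z => fderiv ℝ F (jetOf θ z) v) y :=
  ((hF.fderiv_right (m := ∞) (by simp)).comp y (contDiffAt_jetOf h)).clm_apply contDiffAt_const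

theorem contDiffAt_eulerLagrange {y : Coord n} (hF : ContDiffAt ℝ ∞ F (jetOf θ y))
    (h : MSmooth (matAt θ) y) (i β : Fin n) : ContDiffAt ℝ ∞ (eulerLagrange F θ i β) y :=
  ((contDiffAt_fderiv_jetOf hF h _).sub (ContDiffAt.sum fun γ _ =>
    contDiffAt_pderiv (contDiffAt_fderiv_jetOf hF h _) γ)).add
    (ContDiffAt.sum fun γ _ => ContDiffAt.sum fun σ _ =>
      contDiffAt_pderiv (contDiffAt_pderiv (contDiffAt_fderiv_jetOf hF h _) σ) γ)

theorem integral_sum_test {ι : Type*} {s : Finset ι} {f : ι → Coord n → ℝ}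
    (hf : ∀ i, IsTest U (f i)) : ∫ z, ∑ i ∈ s, f i z = ∑ i ∈ s, ∫ z, f i z :=
  integral_finsetSum s fun i _ => (hf i).integrable

/-- The first variation formula. -/
theorem integral_fderiv_jetOf (hF : ∀ y ∈ U, ContDiffAt ℝ ∞ F (jetOf θ y))
    (hθ : ∀ y ∈ U, MSmooth (matAt θ) y) {η : Field2 n} (hη : ∀ i β, IsTest U (η i β)) :
    ∫ y, fderiv ℝ F (jetOf θ y) (jetOf η y) = ∫ y, ∑ i, ∑ β, eulerLagrange F θ i β y * η i β y := by
  have hd : ∀ v, ∀ z ∈ U, ContDiffAt ℝ ∞ (fun z => fderiv ℝ F (jetOf θ z) v) z := fun v z hz =>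
    contDiffAt_fderiv_jetOf (hF z hz) (hθ z hz) v
  have d1 : ∀ v γ, ∀ z ∈ U,
      ContDiffAt ℝ ∞ (pderiv γ (fun z => fderiv ℝ F (jetOf θ z) v)) z := fun v γ z hz =>
    contDiffAt_pderiv (hd v z hz) γ
  have d2 : ∀ v σ γ, ∀ z ∈ U,
      ContDiffAt ℝ ∞ (pderiv γ (pderiv σ (fun z => fderiv ℝ F (jetOf θ z) v))) z :=
    fun v σ γ z hz => contDiffAt_pderiv (d1 v σ z hz) γ
  have i1 : ∀ v i β γ, ∫ z, fderiv ℝ F (jetOf θ z) v * pderiv γ (η i β) z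
      = ∫ z, -pderiv γ (fun z => fderiv ℝ F (jetOf θ z) v) z * η i β z := fun v i β γ =>
    (hη i β).integral_mul_pderiv (hd v) γ
  -- Two integrations by parts, the outer derivative `σ` first, so that the derivatives land in the
  -- order used in `eulerLagrange`.
  have i2 : ∀ v i β γ σ, ∫ z, fderiv ℝ F (jetOf θ z) v * pderiv σ (pderiv γ (η i β)) z
      = ∫ z, pderiv γ (pderiv σ (fun z => fderiv ℝ F (jetOf θ z) v)) z * η i β z := by
    intro v i β γ σ
    rw [((hη i β).pderiv γ).integral_mul_pderiv (hd v) σ]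
    simp only [neg_mul]
    rw [integral_neg, (hη i β).integral_mul_pderiv (d1 v σ) γ]
    simp only [neg_mul]
    rw [integral_neg, neg_neg]
  have hL := fun y => fderiv_jet_apply F (jetOf θ y) (jetOf η y)
  have t0 : ∀ i β, IsTest U fun z => dJet0 F i β (jetOf θ z) * η i β z :=
    fun i β => (hη i β).smooth_mul (hd _)
  have t1 : ∀ i β γ, IsTest U fun z => dJet1 F i β γ (jetOf θ z) * pderiv γ (η i β) z :=
    fun i β γ => ((hη i β).pderiv γ).smooth_mul (hd _)
  have t2 : ∀ i β γ σ, IsTest U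
      fun z => dJet2 F i β γ σ (jetOf θ z) * pderiv σ (pderiv γ (η i β)) z :=
    fun i β γ σ => (((hη i β).pderiv γ).pderiv σ).smooth_mul (hd _)
  have u1 : ∀ i β γ, IsTest U
      fun z => -pderiv γ (fun z => dJet1 F i β γ (jetOf θ z)) z * η i β z :=
    fun i β γ => (hη i β).smooth_mul fun z hz => (d1 _ γ z hz).neg
  have u2 : ∀ i β γ σ, IsTest U
      fun z => pderiv γ (pderiv σ (fun z => dJet2 F i β γ σ (jetOf θ z))) z * η i β z :=
    fun i β γ σ => (hη i β).smooth_mul (d2 _ σ γ)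
  have hR : ∀ y, ∑ i, ∑ β, eulerLagrange F θ i β y * η i β y
      = (∑ i, ∑ β, dJet0 F i β (jetOf θ y) * η i β y)
        + (∑ i, ∑ β, ∑ γ, -pderiv γ (fun z => dJet1 F i β γ (jetOf θ z)) y * η i β y)
        + ∑ i, ∑ β, ∑ γ, ∑ σ,
          pderiv γ (pderiv σ (fun z => dJet2 F i β γ σ (jetOf θ z))) y * η i β y := by
    intro y
    simp only [← Finset.sum_add_distrib]
    refine Finset.sum_congr rfl fun i _ => Finset.sum_congr rfl fun β _ => ?_
    rw [eulerLagrange, add_mul, sub_mul, Finset.sum_mul, Finset.sum_mul, sub_eq_add_neg,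
      ← Finset.sum_neg_distrib]
    simp only [Finset.sum_mul, neg_mul]
  simp only [hR, hL]
  change ∫ y, (∑ i, ∑ β, dJet0 F i β (jetOf θ y) * η i β y)
    + (∑ i, ∑ β, ∑ γ, dJet1 F i β γ (jetOf θ y) * pderiv γ (η i β) y)
    + (∑ i, ∑ β, ∑ γ, ∑ σ, dJet2 F i β γ σ (jetOf θ y) * pderiv σ (pderiv γ (η i β)) y) = _
  rw [integral_add, integral_add, integral_add, integral_add]
  · congr 1
    · congr 1
      rw [integral_sum_test fun i => IsTest.sum fun β => IsTest.sum fun γ => t1 i β γ,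
        integral_sum_test fun i => IsTest.sum fun β => IsTest.sum fun γ => u1 i β γ]
      refine Finset.sum_congr rfl fun i _ => ?_
      rw [integral_sum_test fun β => IsTest.sum fun γ => t1 i β γ,
        integral_sum_test fun β => IsTest.sum fun γ => u1 i β γ]
      refine Finset.sum_congr rfl fun β _ => ?_
      rw [integral_sum_test fun γ => t1 i β γ, integral_sum_test fun γ => u1 i β γ]
      exact Finset.sum_congr rfl fun γ _ => i1 _ i β γ
    · rw [integral_sum_test fun i => IsTest.sum fun β => IsTest.sum fun γ => IsTest.sum fun σ =>
          t2 i β γ σ,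
        integral_sum_test fun i => IsTest.sum fun β => IsTest.sum fun γ => IsTest.sum fun σ =>
          u2 i β γ σ]
      refine Finset.sum_congr rfl fun i _ => ?_
      rw [integral_sum_test fun β => IsTest.sum fun γ => IsTest.sum fun σ => t2 i β γ σ,
        integral_sum_test fun β => IsTest.sum fun γ => IsTest.sum fun σ => u2 i β γ σ]
      refine Finset.sum_congr rfl fun β _ => ?_
      rw [integral_sum_test fun γ => IsTest.sum fun σ => t2 i β γ σ,
        integral_sum_test fun γ => IsTest.sum fun σ => u2 i β γ σ]
      refine Finset.sum_congr rfl fun γ _ => ?_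
      rw [integral_sum_test fun σ => t2 i β γ σ, integral_sum_test fun σ => u2 i β γ σ]
      exact Finset.sum_congr rfl fun σ _ => i2 _ i β γ σ
  · exact (IsTest.sum fun i => IsTest.sum fun β => t0 i β).integrable
  · exact (IsTest.sum fun i => IsTest.sum fun β => IsTest.sum fun γ => u1 i β γ).integrable
  · exact ((IsTest.sum fun i => IsTest.sum fun β => t0 i β).add
      (IsTest.sum fun i => IsTest.sum fun β => IsTest.sum fun γ => u1 i β γ)).integrable
  · exact (IsTest.sum fun i => IsTest.sum fun β => IsTest.sum fun γ => IsTest.sum fun σ =>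
      u2 i β γ σ).integrable
  · exact (IsTest.sum fun i => IsTest.sum fun β => t0 i β).integrable
  · exact (IsTest.sum fun i => IsTest.sum fun β => IsTest.sum fun γ => t1 i β γ).integrable
  · exact ((IsTest.sum fun i => IsTest.sum fun β => t0 i β).add
      (IsTest.sum fun i => IsTest.sum fun β => IsTest.sum fun γ => t1 i β γ)).integrable
  · exact (IsTest.sum fun i => IsTest.sum fun β => IsTest.sum fun γ => IsTest.sum fun σ =>
      t2 i β γ σ).integrable

/-- The derivative of the two-jet of a one-parameter family. -/
theorem hasDerivAt_jetOf {Θ : ℝ → Field2 n} {y : Coord n}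
    (h : ∀ᶠ z in 𝓝 y, FamSmooth2 Θ 0 z) :
    HasDerivAt (fun t => jetOf (Θ t) y)
      (jetOf (fun i μ => variation fun t => Θ t i μ) y) 0 := by
  have h0 := h.self_of_nhds
  refine HasDerivAt.prodMk ?_ (HasDerivAt.prodMk ?_ ?_)
  · exact hasDerivAt_pi.mpr fun i => hasDerivAt_pi.mpr fun μ => (h0 i μ).hasDerivAt
  · refine hasDerivAt_pi.mpr fun i => hasDerivAt_pi.mpr fun μ => hasDerivAt_pi.mpr fun ν => ?_
    rw [← variation_pderiv (h0 i μ)]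
    exact ((h0 i μ).pderiv ν).hasDerivAt
  · refine hasDerivAt_pi.mpr fun i => hasDerivAt_pi.mpr fun μ => hasDerivAt_pi.mpr fun ν =>
      hasDerivAt_pi.mpr fun σ => ?_
    have e : pderiv ν (variation fun t => Θ t i μ)
        =ᶠ[𝓝 y] variation fun t => pderiv ν (Θ t i μ) := by
      filter_upwards [h] with z hz
      exact (variation_pderiv (hz i μ) ν).symm
    rw [pderiv_congr e, ← variation_pderiv ((h0 i μ).pderiv ν)]
    exact (((h0 i μ).pderiv ν).pderiv σ).hasDerivAt

theorem hasDerivAt_comp_jetOf {Θ : ℝ → Field2 n} {y : Coord n}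
    (h : ∀ᶠ z in 𝓝 y, FamSmooth2 Θ 0 z) (hF : DifferentiableAt ℝ F (jetOf (Θ 0) y)) :
    HasDerivAt (fun t => F (jetOf (Θ t) y))
      (fderiv ℝ F (jetOf (Θ 0) y) (jetOf (fun i μ => variation fun t => Θ t i μ) y)) 0 :=
  hF.hasFDerivAt.comp_hasDerivAt (0 : ℝ) (hasDerivAt_jetOf h)

theorem jetOf_congr {a b : Field2 n} {y : Coord n} (h : ∀ i μ, a i μ =ᶠ[𝓝 y] b i μ) :
    jetOf a y = jetOf b y := by
  refine Prod.ext ?_ (Prod.ext ?_ ?_)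
  · funext i μ
    exact (h i μ).self_of_nhds
  · funext i μ ν
    exact pderiv_congr (h i μ) ν
  · funext i μ ν σ
    exact pderiv_congr (pderiv_eventuallyEq (h i μ) ν) σ

theorem jetOf_eq_zero {a : Field2 n} {y : Coord n} (h : ∀ i μ, a i μ =ᶠ[𝓝 y] fun _ => 0) :
    jetOf a y = 0 := by
  have h0 : ∀ (ν : Fin n), pderiv ν (fun _ : Coord n => (0 : ℝ)) = fun _ => 0 := fun ν =>
    funext fun z => pderiv_const ν 0 z
  rw [jetOf_congr (b := fun _ _ _ => 0) h]
  refine Prod.ext ?_ (Prod.ext ?_ ?_)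
  · rfl
  · funext i μ ν
    exact congrFun (h0 ν) y
  · funext i μ ν σ
    simp only [jetOf, h0]
    rfl

end FirstVariation

/-! ### Noether's identity for Lagrangian functions -/

section Noether

open MeasureTheory

variable {n : ℕ} {U : Set (Coord n)} {θ : Field2 n} {L : Jet n → ℝ}

theorem fderiv_apply_coord {f : Coord n → Coord n} {y : Coord n} (hf : DifferentiableAt ℝ f y)
    (w : Coord n) (a : Fin n) :
    (fderiv ℝ f y w) a = (jacobian f y).mulVec (fun β => w β) a := by
  have h1 : HasFDerivAt (fun z => f z a)
      ((EuclideanSpace.proj a : Coord n →L[ℝ] ℝ).comp (fderiv ℝ f y)) y :=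
    (EuclideanSpace.proj a : Coord n →L[ℝ] ℝ).hasFDerivAt.comp y hf.hasFDerivAt
  have h2 : w = ∑ β, w β • basisVec β := by
    ext k
    simp [Pi.single_apply]
  conv_lhs => rw [h2, map_sum]
  simp only [Matrix.mulVec, dotProduct, jacobian, Matrix.of_apply, pderiv, h1.fderiv, map_smul]
  simp [mul_comm]

/-- A map with invertible Jacobian matrix has an invertible derivative. -/
theorem exists_equiv_hasFDerivAt {f : Coord n → Coord n} {y : Coord n}
    (hf : DifferentiableAt ℝ f y) (hd : (jacobian f y).det ≠ 0) :
    ∃ f' : Coord n ≃L[ℝ] Coord n, HasFDerivAt f (f' : Coord n →L[ℝ] Coord n) y := by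
  have hinj : Function.Injective (fderiv ℝ f y : Coord n →ₗ[ℝ] Coord n) := by
    rw [← LinearMap.ker_eq_bot, LinearMap.ker_eq_bot']
    intro w hw
    have h1 : (jacobian f y).mulVec (fun β => w β) = 0 := by
      funext a
      rw [← fderiv_apply_coord hf]
      change ((fderiv ℝ f y : Coord n →ₗ[ℝ] Coord n) w) a = _
      rw [hw]
      rfl
    have h2 := Matrix.eq_zero_of_mulVec_eq_zero hd h1
    ext β
    exact congrFun h2 β
  refine ⟨(LinearEquiv.ofInjectiveEndo _ hinj).toContinuousLinearEquiv, ?_⟩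
  convert hf.hasFDerivAt using 1
  ext w
  rfl

/-- The inverse function theorem, with the image contained in a given open set. -/
theorem exists_local_diffeo {f : Coord n → Coord n} (hf : ContDiff ℝ ∞ f) (hU : IsOpen U)
    {y : Coord n} (hy : f y ∈ U) (hd : (jacobian f y).det ≠ 0) :
    ∃ φ : OpenPartialHomeomorph (Coord n) (Coord n), (φ : Coord n → Coord n) = f ∧
      y ∈ φ.source ∧ φ.target ⊆ U ∧ ContDiffOn ℝ ∞ φ φ.source ∧
      ContDiffOn ℝ ∞ φ.symm φ.target := by
  obtain ⟨f', hf'⟩ := exists_equiv_hasFDerivAt hf.contDiffAt.diffAt hd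
  set ψ := (hf.contDiffAt (x := y)).toOpenPartialHomeomorph f hf' (by simp) with hψ
  have hψf : (ψ : Coord n → Coord n) = f := rfl
  -- The source is cut down to points with invertible Jacobian, so that the inverse is smooth on the
  -- whole target, and with image in `U`.
  let W : Set (Coord n) := {z | (jacobian f z).det ≠ 0} ∩ f ⁻¹' U
  have hW : IsOpen W := by
    refine IsOpen.inter ?_ (hU.preimage hf.continuous)
    have hc : Continuous fun z => (jacobian f z).det :=
      continuous_iff_continuousAt.mpr fun z =>
        (jacobian_smooth hf.contDiffAt).det.continuousAt
    exact isOpen_ne.preimage hc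
  let φ := ψ.restrOpen W hW
  have hφf : (φ : Coord n → Coord n) = f := rfl
  have hsrc : ∀ z ∈ φ.source, z ∈ W := fun z hz => by
    rw [ψ.restrOpen_source W hW] at hz
    exact hz.2
  refine ⟨φ, hφf, ?_, ?_, ?_, ?_⟩
  · rw [ψ.restrOpen_source W hW]
    exact ⟨ContDiffAt.mem_toOpenPartialHomeomorph_source _ hf' _, hd, hy⟩
  · intro x hx
    have h1 := hsrc _ (φ.map_target hx)
    have h2 := φ.right_inv hx
    rw [hφf] at h2
    rw [← h2]
    exact h1.2
  · rw [hφf]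
    exact hf.contDiffOn
  · intro x hx
    have h1 := hsrc _ (φ.map_target hx)
    obtain ⟨f'', hf''⟩ := exists_equiv_hasFDerivAt hf.contDiffAt.diffAt h1.1
    exact (φ.contDiffAt_symm hx hf'' hf.contDiffAt).contDiffWithinAt

theorem contDiffAt_density {j : Jet n} (hL : ContDiffOn ℝ ∞ L {j | (Matrix.of j.1).det ≠ 0})
    (hj : (Matrix.of j.1).det ≠ 0) : ContDiffAt ℝ ∞ (density L) j := by
  have hdet : ∀ j : Jet n, ContDiffAt ℝ ∞ (fun j : Jet n => (Matrix.of j.1).det) j := fun j =>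
    MSmooth.det (A := fun j : Jet n => Matrix.of j.1) fun i k => by
      simp only [Matrix.of_apply]
      fun_prop
  have hopen : IsOpen {j : Jet n | (Matrix.of j.1).det ≠ 0} :=
    isOpen_ne.preimage (continuous_iff_continuousAt.mpr fun j => (hdet j).continuousAt)
  exact (hdet j).mul (hL.contDiffAt (hopen.mem_nhds hj))

/-- The transformation law of a Lagrangian density. -/
theorem density_pullback (hL : IsLagrangian L) (hU : IsOpen U)
    (hθ : ∀ z ∈ U, IsCoframeAt θ z) {f : Coord n → Coord n} (hf : ContDiff ℝ ∞ f)
    {y : Coord n} (hy : f y ∈ U) (hd : (jacobian f y).det ≠ 0) :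
    density L (jetOf (pullback f θ) y)
      = (jacobian f y).det * density L (jetOf θ (f y)) := by
  -- Invariance of a Lagrangian function is stated for diffeomorphisms only, so `f` is first
  -- restricted to one near `y`; the jets are unaffected.
  obtain ⟨φ, hφ, hys, ht, h1, h2⟩ := exists_local_diffeo hf hU hy hd
  have h3 := hL.scalar φ h1 h2 θ
    (fun i μ z hz => ((hθ z (ht hz)).smooth i μ).contDiffWithinAt)
    (fun z hz => (hθ z (ht hz)).det_ne) y hys
  rw [hφ] at h3
  have h4 : (Matrix.of (jetOf (pullback f θ) y).1).det
      = (jacobian f y).det * (Matrix.of (jetOf θ (f y)).1).det := by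
    change (matAt (pullback f θ) y).det = _ * (matAt θ (f y)).det
    rw [matAt_pullback, Matrix.det_mul, mul_comm]
  unfold density
  rw [h3, h4, mul_assoc]

/-- The translation along a coordinate axis, cut off by `ρ`. -/
def cutoffShift (ρ : Coord n → ℝ) (ν : Fin n) (t : ℝ) (z : Coord n) : Coord n :=
  z + (t * ρ z) • basisVec ν

theorem cutoffShift_zero (ρ : Coord n → ℝ) (ν : Fin n) (z : Coord n) :
    cutoffShift ρ ν 0 z = z := by
  simp [cutoffShift]

theorem contDiff_cutoffShift {ρ : Coord n → ℝ} (hρ : ContDiff ℝ ∞ ρ) (ν : Fin n) :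
    ContDiff ℝ ∞ (fun q : ℝ × Coord n => cutoffShift ρ ν q.1 q.2) := by
  unfold cutoffShift
  fun_prop

theorem pderiv_cutoffShift {ρ : Coord n → ℝ} (hρ : ContDiff ℝ ∞ ρ) (ν : Fin n) (t : ℝ)
    (z : Coord n) (a β : Fin n) :
    pderiv β (fun w => cutoffShift ρ ν t w a) z
      = (if a = β then 1 else 0) + t * (pderiv β ρ z * if a = ν then 1 else 0) := by
  have hr : DifferentiableAt ℝ ρ z := hρ.contDiffAt.diffAt
  have h1 : (fun w : Coord n => cutoffShift ρ ν t w a)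
      = fun w => w a + (t * if a = ν then 1 else 0) * ρ w := by
    funext w
    simp only [cutoffShift, PiLp.add_apply, PiLp.smul_apply, smul_eq_mul, basisVec,
      PiLp.single_apply]
    ring
  rw [h1]
  unfold pderiv
  rw [fderiv_add_apply _ (by fun_prop) (by fun_prop), fderiv_const_mul_apply _ _ hr]
  have h2 : fderiv ℝ (fun w : Coord n => w a) z (basisVec β) = if a = β then 1 else 0 :=
    pderiv_proj β a z
  rw [h2]
  ring

theorem jacobian_cutoffShift {ρ : Coord n → ℝ} (hρ : ContDiff ℝ ∞ ρ) (ν : Fin n) (t : ℝ)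
    (z : Coord n) :
    jacobian (cutoffShift ρ ν t) z
      = 1 + t • Matrix.of fun a β => pderiv β ρ z * if a = ν then 1 else 0 := by
  ext a β
  rw [Matrix.add_apply, Matrix.one_apply]
  exact pderiv_cutoffShift hρ ν t z a β

theorem hasDerivAt_cutoffShift {ρ f : Coord n → ℝ} {z : Coord n} (hf : DifferentiableAt ℝ f z)
    (ν : Fin n) :
    HasDerivAt (fun t : ℝ => f (cutoffShift ρ ν t z)) (ρ z * pderiv ν f z) 0 := by
  have h1 : HasDerivAt (fun t : ℝ => cutoffShift ρ ν t z) (ρ z • basisVec ν) 0 := by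
    have : HasDerivAt (fun t : ℝ => t * ρ z) (ρ z) 0 := by
      simpa using (hasDerivAt_id (0 : ℝ)).mul_const (ρ z)
    exact (this.smul_const (basisVec ν)).const_add z
  have h2 : HasFDerivAt f (fderiv ℝ f z) (cutoffShift ρ ν 0 z) := by
    rw [cutoffShift_zero]
    exact hf.hasFDerivAt
  have h3 := h2.comp_hasDerivAt (0 : ℝ) h1
  rw [map_smul, smul_eq_mul] at h3
  exact h3

theorem famSmooth2_pullback_cutoffShift {ρ : Coord n → ℝ} (hρ : ContDiff ℝ ∞ ρ) (ν : Fin n)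
    {z : Coord n} (hθ : MSmooth (matAt θ) z) :
    FamSmooth2 (fun t => pullback (cutoffShift ρ ν t) θ) 0 z := fun i μ => by
  refine FamSmooth.sum fun κ => FamSmooth.mul ?_ ?_
  · have h1 : ContDiffAt ℝ ∞ (θ i κ) ((fun q : ℝ × Coord n => cutoffShift ρ ν q.1 q.2) (0, z)) := by
      simp only [cutoffShift_zero]
      exact hθ i κ
    exact h1.comp (0, z) (contDiff_cutoffShift hρ ν).contDiffAt
  · refine FamSmooth.pderiv (f := fun (t : ℝ) w => cutoffShift ρ ν t w κ) ?_ μ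
    have := (contDiff_cutoffShift hρ ν).contDiffAt (x := ((0 : ℝ), z))
    unfold FamSmooth
    fun_prop

/-- The result is the Lie derivative of the one-form `θ_i` along the vector field `ρ ∂_ν`. -/
theorem variation_pullback_cutoffShift {ρ : Coord n → ℝ} (hρ : ContDiff ℝ ∞ ρ) (ν : Fin n)
    {z : Coord n} (hθ : MSmooth (matAt θ) z) (i μ : Fin n) :
    variation (fun t => pullback (cutoffShift ρ ν t) θ i μ) z
      = pderiv ν (θ i μ) z * ρ z + θ i ν z * pderiv μ ρ z := by
  have h1 : ∀ κ, HasDerivAt (fun t : ℝ => θ i κ (cutoffShift ρ ν t z)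
        * pderiv μ (fun w => cutoffShift ρ ν t w κ) z)
      (ρ z * pderiv ν (θ i κ) z * (if κ = μ then 1 else 0)
        + θ i κ z * (pderiv μ ρ z * if κ = ν then 1 else 0)) 0 := by
    intro κ
    simp only [pderiv_cutoffShift hρ]
    have h2 : HasDerivAt (fun t : ℝ => (if κ = μ then (1 : ℝ) else 0)
        + t * (pderiv μ ρ z * if κ = ν then 1 else 0))
        (pderiv μ ρ z * if κ = ν then 1 else 0) 0 := by
      simpa using ((hasDerivAt_id (0 : ℝ)).mul_const
        (pderiv μ ρ z * if κ = ν then (1 : ℝ) else 0)).const_add (if κ = μ then (1 : ℝ) else 0)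
    have h3 := (hasDerivAt_cutoffShift (ρ := ρ) (hθ i κ).diffAt ν).fun_mul h2
    simp only [zero_mul, add_zero, cutoffShift_zero] at h3
    exact h3
  have h4 := HasDerivAt.fun_sum (u := Finset.univ) fun κ _ => h1 κ
  refine h4.deriv.trans ?_
  rw [Finset.sum_add_distrib]
  simp
  ring

/-- The variation of a Lagrangian density under an infinitesimal change of coordinates is a
divergence. -/
theorem fderiv_density_lieDerivative (hL : IsLagrangian L) (hU : IsOpen U)
    (hθ : ∀ z ∈ U, IsCoframeAt θ z) {ρ : Coord n → ℝ} (hρ : ContDiff ℝ ∞ ρ) (ν : Fin n)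
    {y : Coord n} (hy : y ∈ U) :
    fderiv ℝ (density L) (jetOf θ y)
        (jetOf (fun i μ z => pderiv ν (θ i μ) z * ρ z + θ i ν z * pderiv μ ρ z) y)
      = pderiv ν (fun z => density L (jetOf θ z) * ρ z) y := by
  have hUy : U ∈ 𝓝 y := hU.mem_nhds hy
  have hF : ContDiffAt ℝ ∞ (density L) (jetOf θ y) :=
    contDiffAt_density hL.smooth (hθ y hy).det_ne
  have hl : ContDiffAt ℝ ∞ (fun z => density L (jetOf θ z)) y :=
    hF.comp y (contDiffAt_jetOf (hθ y hy).smooth)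
  have hzero : pullback (cutoffShift ρ ν 0) θ = θ := by
    funext i μ z
    simp only [pullback, cutoffShift_zero, pderiv_proj]
    simp
  have hj := hasDerivAt_comp_jetOf (F := density L)
    (Θ := fun t => pullback (cutoffShift ρ ν t) θ) (y := y)
    (by
      filter_upwards [hUy] with z hz
      exact famSmooth2_pullback_cutoffShift hρ ν (hθ z hz).smooth)
    (by rw [hzero]; exact hF.diffAt)
  rw [hzero] at hj
  have e1 : jetOf (fun i μ => variation fun t => pullback (cutoffShift ρ ν t) θ i μ) y
      = jetOf (fun i μ z => pderiv ν (θ i μ) z * ρ z + θ i ν z * pderiv μ ρ z) y :=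
    jetOf_congr fun i μ => by
      filter_upwards [hUy] with z hz
      exact variation_pullback_cutoffShift hρ ν (hθ z hz).smooth i μ
  rw [e1] at hj
  set B : Matrix (Fin n) (Fin n) ℝ :=
    Matrix.of fun a β => pderiv β ρ y * if a = ν then 1 else 0 with hB
  have hdet : HasDerivAt (fun t : ℝ => (1 + t • B).det) B.trace 0 := hasDerivAt_det_one_add_smul B
  have htr : B.trace = pderiv ν ρ y := by
    simp [hB, Matrix.trace]
  have hright := hdet.fun_mul (hasDerivAt_cutoffShift (ρ := ρ) hl.diffAt ν)
  simp only [cutoffShift_zero, zero_smul, add_zero, Matrix.det_one, one_mul] at hright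
  have hcont : Continuous fun t : ℝ => cutoffShift ρ ν t y := by
    unfold cutoffShift
    fun_prop
  -- For small `t` the Jacobian is invertible and the shifted point is still in `U`, so the
  -- transformation law of the density applies.
  have hev : (fun t => density L (jetOf (pullback (cutoffShift ρ ν t) θ) y)) =ᶠ[𝓝 0]
      fun t => (1 + t • B).det * density L (jetOf θ (cutoffShift ρ ν t y)) := by
    have h1 : ∀ᶠ t : ℝ in 𝓝 0, (1 + t • B).det ≠ 0 :=
      hdet.continuousAt.eventually_ne (by simp)
    have h2 : ∀ᶠ t : ℝ in 𝓝 0, cutoffShift ρ ν t y ∈ U := by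
      refine hcont.continuousAt.eventually_mem (hU.mem_nhds ?_)
      rwa [cutoffShift_zero]
    filter_upwards [h1, h2] with t ht1 ht2
    have hs : ContDiff ℝ ∞ (cutoffShift ρ ν t) :=
      (contDiff_cutoffShift hρ ν).comp (by fun_prop : ContDiff ℝ ∞ fun z : Coord n => (t, z))
    have hJ := jacobian_cutoffShift hρ ν t y
    rw [density_pullback hL hU hθ hs ht2 (by rw [hJ]; exact ht1), hJ]
  -- The determinant contributes `tr B = ∂_ν ρ` and the moving point contributes `ρ ∂_ν` of the
  -- density; together they form `∂_ν (ρ λL)`.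
  rw [hj.unique (hright.congr_of_eventuallyEq hev), htr]
  have := fderiv_mul_apply (basisVec ν) hl.diffAt hρ.contDiffAt.diffAt
  unfold pderiv
  rw [this]
  ring

/-- Varying `θ` by its Lie derivative along `ρ ∂_ν` changes the density by a total derivative of
compact support, so the Euler-Lagrange expression paired with this variation integrates to zero.
Integrating by parts to free `ρ` from derivatives and using that `ρ` is arbitrary gives the
pointwise identity. -/
theorem noether_identity (hL : IsLagrangian L) (hU : IsOpen U)
    (hθ : ∀ z ∈ U, IsCoframeAt θ z) (ν : Fin n) :
    ∀ y ∈ U, ∑ β, pderiv β (fun z => ∑ i, eulerLagrange (density L) θ i β z * θ i ν z) y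
      = ∑ i, ∑ β, eulerLagrange (density L) θ i β y * pderiv ν (θ i β) y := by
  have hF : ∀ y ∈ U, ContDiffAt ℝ ∞ (density L) (jetOf θ y) := fun y hy =>
    contDiffAt_density hL.smooth (hθ y hy).det_ne
  have hE : ∀ i β, ∀ y ∈ U, ContDiffAt ℝ ∞ (eulerLagrange (density L) θ i β) y :=
    fun i β y hy => contDiffAt_eulerLagrange (hF y hy) (hθ y hy).smooth i β
  have hl : ∀ y ∈ U, ContDiffAt ℝ ∞ (fun z => density L (jetOf θ z)) y := fun y hy =>
    (hF y hy).comp y (contDiffAt_jetOf (hθ y hy).smooth)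
  have hθs : ∀ i β, ∀ y ∈ U, ContDiffAt ℝ ∞ (θ i β) y := fun i β y hy => (hθ y hy).smooth i β
  set f : Fin n → Coord n → ℝ := fun β z =>
    ∑ i, eulerLagrange (density L) θ i β z * θ i ν z with hf
  set k : Coord n → ℝ := fun z =>
    ∑ i, ∑ β, eulerLagrange (density L) θ i β z * pderiv ν (θ i β) z with hk
  have hfs : ∀ β, ∀ y ∈ U, ContDiffAt ℝ ∞ (f β) y := fun β y hy =>
    ContDiffAt.sum fun i _ => (hE i β y hy).mul (hθs i ν y hy)
  have hks : ∀ y ∈ U, ContDiffAt ℝ ∞ k y := fun y hy =>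
    ContDiffAt.sum fun i _ => ContDiffAt.sum fun β _ =>
      (hE i β y hy).mul (contDiffAt_pderiv (hθs i β y hy) ν)
  have hdf : ∀ y ∈ U, ContDiffAt ℝ ∞ (fun z => ∑ β, pderiv β (f β) z) y := fun y hy =>
    ContDiffAt.sum fun β _ => contDiffAt_pderiv (hfs β y hy) β
  suffices h : ∀ y ∈ U, k y - ∑ β, pderiv β (f β) y = 0 by
    intro y hy
    exact (sub_eq_zero.mp (h y hy)).symm
  refine eq_zero_of_integral_mul_test hU
    (fun y hy => ((hks y hy).sub (hdf y hy)).continuousAt.continuousWithinAt) fun ρ hρ => ?_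
  set η : Field2 n := fun i μ z => pderiv ν (θ i μ) z * ρ z + θ i ν z * pderiv μ ρ z with hη
  have hηt : ∀ i μ, IsTest U (η i μ) := fun i μ =>
    (hρ.smooth_mul fun z hz => contDiffAt_pderiv (hθs i μ z hz) ν).add
      ((hρ.pderiv μ).smooth_mul (hθs i ν))
  have hvar := integral_fderiv_jetOf hF (fun y hy => (hθ y hy).smooth) hηt
  -- Off `U` the coframe is uncontrolled, but the variation and `ρ` vanish nearby, so both sides are
  -- zero.
  have hpt : ∀ y, fderiv ℝ (density L) (jetOf θ y) (jetOf η y)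
      = pderiv ν (fun z => density L (jetOf θ z) * ρ z) y := by
    intro y
    by_cases hy : y ∈ U
    · exact fderiv_density_lieDerivative hL hU hθ hρ.smooth ν hy
    · rw [jetOf_eq_zero fun i μ =>
        eventually_zero_of_notMem fun h => hy ((hηt i μ).subset h), map_zero,
        pderiv_zero_of_notMem fun h => hy ((hρ.smooth_mul hl).subset h)]
  simp only [hpt] at hvar
  rw [(hρ.smooth_mul hl).integral_pderiv] at hvar
  have hsum : ∀ y, ∑ i, ∑ β, eulerLagrange (density L) θ i β y * η i β y
      = k y * ρ y + ∑ β, f β y * pderiv β ρ y := by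
    intro y
    simp only [hη, hk, hf, Finset.sum_mul]
    rw [Finset.sum_comm (f := fun β i => eulerLagrange (density L) θ i β y * θ i ν y * _),
      ← Finset.sum_add_distrib]
    refine Finset.sum_congr rfl fun i _ => ?_
    rw [← Finset.sum_add_distrib]
    exact Finset.sum_congr rfl fun β _ => by ring
  have t1 : IsTest U fun z => k z * ρ z := hρ.smooth_mul hks
  have t2 : ∀ β, IsTest U fun z => f β z * pderiv β ρ z := fun β =>
    (hρ.pderiv β).smooth_mul (hfs β)
  have t3 : ∀ β, IsTest U fun z => pderiv β (f β) z * ρ z := fun β =>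
    hρ.smooth_mul fun y hy => contDiffAt_pderiv (hfs β y hy) β
  simp only [hsum] at hvar
  rw [integral_add t1.integrable (IsTest.sum t2).integrable, integral_sum_test t2] at hvar
  simp only [fun β => hρ.integral_mul_pderiv (hfs β) β, neg_mul, integral_neg,
    Finset.sum_neg_distrib] at hvar
  simp only [sub_mul, Finset.sum_mul]
  rw [integral_sub t1.integrable (IsTest.sum t3).integrable, integral_sum_test t3]
  linarith

theorem variationalTensor_eq (L : Jet n → ℝ) (θ : Field2 n) (μ ν : Fin n) (y : Coord n) :
    variationalTensor L θ μ ν y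
      = (1 / (matAt θ y).det) * ∑ i, eulerLagrange (density L) θ i μ y * θ i ν y := by
  unfold variationalTensor
  rw [Finset.mul_sum]
  exact Finset.sum_congr rfl fun i _ => mul_assoc _ _ _

/-- The variational tensor of a Lagrangian function is divergence-free with respect to the dual of
the Weitzenböck connection. -/
theorem divergence_weitzenbock_variationalTensor (hL : IsLagrangian L) (hU : IsOpen U)
    {lam : Field2 n} (hlam : ∀ z ∈ U, (matAt lam z).det ≠ 0)
    (hθ : ∀ z ∈ U, IsCoframeAt (coframe lam) z) {y : Coord n} (hy : y ∈ U) (ν : Fin n) :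
    divergence (dual (weitzenbock lam)) (variationalTensor L (coframe lam)) ν y = 0 := by
  set θ := coframe lam with hθdef
  have h0 := hθ y hy
  have hu : IsUnit (matAt θ y).det := isUnit_iff_ne_zero.mpr h0.det_ne
  set E := variationalTensor L θ with hE
  set l : Coord n → ℝ := fun z => (matAt θ z).det with hl
  set X : Matrix (Fin n) (Fin n) ℝ :=
    Matrix.of fun i β => eulerLagrange (density L) θ i β y with hX
  let f : Fin n → Fin n → Coord n → ℝ := fun μ ν z =>
    ∑ i, eulerLagrange (density L) θ i μ z * θ i ν z
  have hfs : ∀ μ ν, ContDiffAt ℝ ∞ (f μ ν) y := fun μ ν =>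
    ContDiffAt.sum fun i _ => (contDiffAt_eulerLagrange
      (contDiffAt_density (j := jetOf θ y) hL.smooth h0.det_ne) h0.smooth i μ).mul (h0.smooth i ν)
  have hls : ContDiffAt ℝ ∞ l y := h0.smooth.det
  have hly : l y ≠ 0 := h0.det_ne
  have hEs : ∀ μ ν, ContDiffAt ℝ ∞ (E μ ν) y := fun μ ν => by
    have : E μ ν = fun z => (1 / l z) * f μ ν z := funext fun z => variationalTensor_eq L θ μ ν z
    rw [this]
    exact (contDiffAt_const.div hls hly).mul (hfs μ ν)
  have hEf : ∀ μ ν, ∀ z ∈ U, l z * E μ ν z = f μ ν z := fun μ ν z hz => by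
    have hz' : l z ≠ 0 := (hθ z hz).det_ne
    rw [hE, variationalTensor_eq]
    change l z * (1 / l z * f μ ν z) = _
    field_simp
  -- Jacobi's formula supplies the trace term of the divergence when the factor `λ` is
  -- differentiated.
  have hdl : ∀ μ, pderiv μ l y = l y * (connMat (weitzenbock lam) μ y).trace := fun μ => by
    unfold pderiv
    rw [connMat_weitzenbock μ (hlam y hy)]
    exact fderiv_det h0.smooth h0.det_ne
  have h1 : ∀ μ, pderiv μ (f μ ν) y
      = l y * (connMat (weitzenbock lam) μ y).trace * E μ ν y + l y * pderiv μ (E μ ν) y := by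
    intro μ
    have e : f μ ν =ᶠ[𝓝 y] fun z => l z * E μ ν z := by
      filter_upwards [hU.mem_nhds hy] with z hz
      exact (hEf μ ν z hz).symm
    rw [pderiv_congr e, ← hdl]
    exact fderiv_mul_apply _ hls.diffAt (hEs μ ν).diffAt
  have h2 := noether_identity hL hU hθ ν y hy
  have h3 : l y • matAt E y = X.transpose * matAt θ y := by
    ext μ ν
    exact hEf μ ν y hy
  -- Since `∂_ν T = T W_ν`, the right-hand side of Noether's identity is the remaining term `λ tr (E
  -- W_ν)` of the divergence.
  have h4 : ∑ i, ∑ β, eulerLagrange (density L) θ i β y * pderiv ν (θ i β) y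
      = l y * (matAt E y * connMat (weitzenbock lam) ν y).trace := by
    rw [← smul_eq_mul, ← Matrix.trace_smul, ← Matrix.smul_mul, h3,
      connMat_weitzenbock ν (hlam y hy), ← mul_assoc, mul_assoc _ (matAt θ y),
      Matrix.mul_nonsing_inv _ hu, mul_one, Finset.sum_comm]
    rfl
  rw [h4] at h2
  have h5 : l y * divergence (dual (weitzenbock lam)) E ν y = 0 := by
    rw [divergence_dual, mul_sub, mul_add, ← h2, Finset.mul_sum, Finset.mul_sum,
      ← Finset.sum_add_distrib, sub_eq_zero]
    refine Finset.sum_congr rfl fun μ _ => ?_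
    refine Eq.trans ?_ (h1 μ).symm
    ring
  exact (mul_eq_zero.mp h5).resolve_left hly

end Noether

/-! ### The variation of the scalar curvature -/

section Palatini

variable {n : ℕ} {θ : Field2 n} {y : Coord n}

/-- With a sum over quadruples, each renaming of four indices is one permutation of components. -/
theorem sum4_eq_sum_prod (f : Fin n → Fin n → Fin n → Fin n → ℝ) :
    ∑ a, ∑ b, ∑ c, ∑ d, f a b c d
      = ∑ x : Fin n × Fin n × Fin n × Fin n, f x.1 x.2.1 x.2.2.1 x.2.2.2 := by
  simp only [Fintype.sum_prod_type]

/-- The densitized inverse metric `λ g^{βν}`. -/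
def densMetric (θ : Field2 n) : Field2 n :=
  fun β ν z => (matAt θ z).det * invMetric (metric θ) β ν z

theorem IsCoframeAt.densMetric_smooth (h : IsCoframeAt θ y) (β ν : Fin n) :
    ContDiffAt ℝ ∞ (densMetric θ β ν) y := h.smooth.det.mul (h.invMetric_smooth β ν)

/-- The densitized inverse metric is parallel: both `λ` and `g⁻¹` are parallel for the Levi-Civita
connection. -/
theorem pderiv_densMetric (h : IsCoframeAt θ y) (α β ν : Fin n) :
    pderiv α (densMetric θ β ν) y
      = ∑ σ, (christoffel (metric θ) σ σ α y * densMetric θ β ν y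
        - christoffel (metric θ) β σ α y * densMetric θ σ ν y
        - christoffel (metric θ) ν σ α y * densMetric θ β σ y) := by
  have h1 := fderiv_mul_apply (basisVec α) h.smooth.det.diffAt (h.invMetric_smooth β ν).diffAt
  have h2 : fderiv ℝ (invMetric (metric θ) β ν) y (basisVec α)
      = -(∑ σ, christoffel (metric θ) β σ α y * invMetric (metric θ) σ ν y
        + ∑ σ, invMetric (metric θ) β σ y * christoffel (metric θ) ν σ α y) :=
    congrFun (congrFun (matDeriv_invMetric h α) β) ν
  have h3 := pderiv_det h α
  unfold pderiv at h3 ⊢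
  refine h1.trans ?_
  rw [h2, h3]
  simp only [Finset.sum_sub_distrib, densMetric, ← Finset.sum_mul]
  have e1 : ∑ σ, christoffel (metric θ) β σ α y * ((matAt θ y).det * invMetric (metric θ) σ ν y)
      = (matAt θ y).det * ∑ σ, christoffel (metric θ) β σ α y * invMetric (metric θ) σ ν y := by
    rw [Finset.mul_sum]
    exact Finset.sum_congr rfl fun σ _ => by ring
  have e2 : ∑ σ, christoffel (metric θ) ν σ α y * ((matAt θ y).det * invMetric (metric θ) β σ y)
      = (matAt θ y).det * ∑ σ, invMetric (metric θ) β σ y * christoffel (metric θ) ν σ α y := by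
    rw [Finset.mul_sum]
    exact Finset.sum_congr rfl fun σ _ => by ring
  rw [e1, e2]
  ring

/-- The variation of the Ricci tensor for the variation `D` of the connection `G`. -/
def ricciVariation (G D : Field3 n) (β ν : Fin n) (y : Coord n) : ℝ :=
  (∑ α, (pderiv α (D α β ν) y - pderiv ν (D α β α) y)) +
  ∑ α, ∑ σ, ((D α α σ y * G σ β ν y + G α α σ y * D σ β ν y)
    - (D α ν σ y * G σ β α y + G α ν σ y * D σ β α y))

/-- The vector density `λ (g^{βν} D^α_{βν} - g^{βα} D^σ_{βσ})`. -/
def palatiniVector (θ : Field2 n) (D : Field3 n) (α : Fin n) (y : Coord n) : ℝ :=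
  (∑ β, ∑ ν, densMetric θ β ν y * D α β ν y) - ∑ β, ∑ σ, densMetric θ β α y * D σ β σ y

/-- The Palatini identity. -/
theorem palatini_identity (h : IsCoframeAt θ y) {D : Field3 n}
    (hD : ∀ α β ν, ContDiffAt ℝ ∞ (D α β ν) y) (hs : ∀ α β ν, D α β ν y = D α ν β y) :
    ∑ β, ∑ ν, densMetric θ β ν y * ricciVariation (christoffel (metric θ)) D β ν y
      = ∑ α, pderiv α (palatiniVector θ D α) y := by
  set G := christoffel (metric θ) with hG
  set H := densMetric θ with hH
  have hGs : ∀ α μ ν, G α μ ν y = G α ν μ y := fun α μ ν =>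
    congrFun (christoffel_symm (metric_symm θ) α μ ν) y
  have hHs : ∀ β ν, ContDiffAt ℝ ∞ (H β ν) y := h.densMetric_smooth
  have hdiv : ∀ α, pderiv α (palatiniVector θ D α) y
      = (∑ β, ∑ ν, (pderiv α (H β ν) y * D α β ν y + H β ν y * pderiv α (D α β ν) y))
        - ∑ β, ∑ σ, (pderiv α (H β α) y * D σ β σ y + H β α y * pderiv α (D σ β σ) y) := by
    intro α
    have m1 : ∀ β ν, ContDiffAt ℝ ∞ (fun z => H β ν z * D α β ν z) y := fun β ν =>
      (hHs β ν).mul (hD α β ν)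
    have m2 : ∀ β σ, ContDiffAt ℝ ∞ (fun z => H β α z * D σ β σ z) y := fun β σ =>
      (hHs β α).mul (hD σ β σ)
    have m3 : ∀ β, ContDiffAt ℝ ∞ (fun z => ∑ ν, H β ν z * D α β ν z) y := fun β =>
      ContDiffAt.sum fun ν _ => m1 β ν
    have m4 : ∀ β, ContDiffAt ℝ ∞ (fun z => ∑ σ, H β α z * D σ β σ z) y := fun β =>
      ContDiffAt.sum fun σ _ => m2 β σ
    have e1 := fderiv_sub_apply (basisVec α)
      (ContDiffAt.sum (s := Finset.univ) fun β _ => m3 β).diffAt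
      (ContDiffAt.sum (s := Finset.univ) fun β _ => m4 β).diffAt
    refine e1.trans ?_
    rw [fderiv_sum_apply _ _ fun β => (m3 β).diffAt, fderiv_sum_apply _ _ fun β => (m4 β).diffAt]
    congr 1
    · refine Finset.sum_congr rfl fun β _ => ?_
      rw [fderiv_sum_apply _ _ fun ν => (m1 β ν).diffAt]
      exact Finset.sum_congr rfl fun ν _ =>
        fderiv_mul_apply _ (hHs β ν).diffAt (hD α β ν).diffAt
    · refine Finset.sum_congr rfl fun β _ => ?_
      rw [fderiv_sum_apply _ _ fun σ => (m2 β σ).diffAt]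
      exact Finset.sum_congr rfl fun σ _ =>
        fderiv_mul_apply _ (hHs β α).diffAt (hD σ β σ).diffAt
  have hL : ∑ β, ∑ ν, H β ν y * ricciVariation G D β ν y
      = (∑ β, ∑ ν, ∑ α, H β ν y * pderiv α (D α β ν) y)
        - (∑ β, ∑ ν, ∑ α, H β ν y * pderiv ν (D α β α) y)
        + ((∑ β, ∑ ν, ∑ α, ∑ σ, H β ν y * D α α σ y * G σ β ν y)
        + (∑ β, ∑ ν, ∑ α, ∑ σ, H β ν y * G α α σ y * D σ β ν y)
        - (∑ β, ∑ ν, ∑ α, ∑ σ, H β ν y * D α ν σ y * G σ β α y)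
        - (∑ β, ∑ ν, ∑ α, ∑ σ, H β ν y * G α ν σ y * D σ β α y)) := by
    simp only [← Finset.sum_sub_distrib, ← Finset.sum_add_distrib]
    refine Finset.sum_congr rfl fun β _ => Finset.sum_congr rfl fun ν _ => ?_
    rw [ricciVariation, mul_add, Finset.mul_sum, Finset.mul_sum, ← Finset.sum_add_distrib]
    refine Finset.sum_congr rfl fun α _ => ?_
    rw [Finset.mul_sum, mul_sub]
    congr 1
    exact Finset.sum_congr rfl fun σ _ => by ring
  have hR : ∑ α, pderiv α (palatiniVector θ D α) y
      = (∑ α, ∑ β, ∑ ν, H β ν y * pderiv α (D α β ν) y)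
        - (∑ α, ∑ β, ∑ σ, H β α y * pderiv α (D σ β σ) y)
        + ((∑ α, ∑ β, ∑ ν, ∑ σ, G σ σ α y * H β ν y * D α β ν y)
        - (∑ α, ∑ β, ∑ ν, ∑ σ, G β σ α y * H σ ν y * D α β ν y)
        - (∑ α, ∑ β, ∑ ν, ∑ σ, G ν σ α y * H β σ y * D α β ν y)
        - (∑ α, ∑ β, ∑ σ, ∑ τ, G τ τ α y * H β α y * D σ β σ y)
        + (∑ α, ∑ β, ∑ σ, ∑ τ, G β τ α y * H τ α y * D σ β σ y)
        + (∑ α, ∑ β, ∑ σ, ∑ τ, G α τ α y * H β τ y * D σ β σ y)) := by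
    simp only [hdiv, ← Finset.sum_sub_distrib, ← Finset.sum_add_distrib]
    refine Finset.sum_congr rfl fun α _ => Finset.sum_congr rfl fun β _ =>
      Finset.sum_congr rfl fun ν _ => ?_
    rw [pderiv_densMetric h, pderiv_densMetric h, Finset.sum_mul, Finset.sum_mul]
    have e : ∀ a b c d : ℝ, a + b - (c + d) = b - d + (a - c) := fun a b c d => by ring
    rw [e, ← Finset.sum_sub_distrib]
    congr 1
    refine Finset.sum_congr rfl fun σ _ => ?_
    rw [← hG, ← hH]
    ring
  -- Matching after renaming of indices: `d1` and `d2` for the derivatives of `D`, `r1` to `r4` for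
  -- the products with the connection. The two remaining terms on the right, with opposite signs,
  -- cancel by `r5`.
  have d1 : ∑ β, ∑ ν, ∑ α, H β ν y * pderiv α (D α β ν) y
      = ∑ α, ∑ β, ∑ ν, H β ν y * pderiv α (D α β ν) y :=
     (Finset.sum_congr rfl fun β _ => Finset.sum_comm).trans Finset.sum_comm
  have d2 : ∑ β, ∑ ν, ∑ α, H β ν y * pderiv ν (D α β α) y
      = ∑ α, ∑ β, ∑ σ, H β α y * pderiv α (D σ β σ) y := Finset.sum_comm
  have r1 : ∑ α, ∑ β, ∑ σ, ∑ τ, G β τ α y * H τ α y * D σ β σ y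
      = ∑ β, ∑ ν, ∑ α, ∑ σ, H β ν y * D α α σ y * G σ β ν y := by
    rw [sum4_eq_sum_prod, sum4_eq_sum_prod]
    refine Fintype.sum_equiv ⟨fun x => (x.2.2.2, x.1, x.2.2.1, x.2.1),
      fun x => (x.2.1, x.2.2.2, x.2.2.1, x.1), fun _ => rfl, fun _ => rfl⟩ _ _ fun x => ?_
    simp only [Equiv.coe_fn_mk]
    rw [hs x.2.2.1 x.2.2.1 x.2.1]
    ring
  have r2 : ∑ α, ∑ β, ∑ ν, ∑ σ, G σ σ α y * H β ν y * D α β ν y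
      = ∑ β, ∑ ν, ∑ α, ∑ σ, H β ν y * G α α σ y * D σ β ν y := by
    rw [sum4_eq_sum_prod, sum4_eq_sum_prod]
    refine Fintype.sum_equiv ⟨fun x => (x.2.1, x.2.2.1, x.2.2.2, x.1),
      fun x => (x.2.2.2, x.1, x.2.1, x.2.2.1), fun _ => rfl, fun _ => rfl⟩ _ _ fun x => ?_
    simp only [Equiv.coe_fn_mk]
    ring
  have r3 : ∑ α, ∑ β, ∑ ν, ∑ σ, G β σ α y * H σ ν y * D α β ν y
      = ∑ β, ∑ ν, ∑ α, ∑ σ, H β ν y * D α ν σ y * G σ β α y := by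
    rw [sum4_eq_sum_prod, sum4_eq_sum_prod]
    refine Fintype.sum_equiv ⟨fun x => (x.2.2.2, x.2.2.1, x.1, x.2.1),
      fun x => (x.2.2.1, x.2.2.2, x.2.1, x.1), fun _ => rfl, fun _ => rfl⟩ _ _ fun x => ?_
    simp only [Equiv.coe_fn_mk]
    rw [hs x.1 x.2.1 x.2.2.1]
    ring
  have r4 : ∑ α, ∑ β, ∑ ν, ∑ σ, G ν σ α y * H β σ y * D α β ν y
      = ∑ β, ∑ ν, ∑ α, ∑ σ, H β ν y * G α ν σ y * D σ β α y := by
    rw [sum4_eq_sum_prod, sum4_eq_sum_prod]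
    refine Fintype.sum_equiv ⟨fun x => (x.2.1, x.2.2.2, x.2.2.1, x.1),
      fun x => (x.2.2.2, x.1, x.2.2.1, x.2.1), fun _ => rfl, fun _ => rfl⟩ _ _ fun x => ?_
    simp only [Equiv.coe_fn_mk]
    ring
  have r5 : ∑ α, ∑ β, ∑ σ, ∑ τ, G α τ α y * H β τ y * D σ β σ y
      = ∑ α, ∑ β, ∑ σ, ∑ τ, G τ τ α y * H β α y * D σ β σ y := by
    rw [sum4_eq_sum_prod, sum4_eq_sum_prod]
    refine Fintype.sum_equiv ⟨fun x => (x.2.2.2, x.2.1, x.2.2.1, x.1),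
      fun x => (x.2.2.2, x.2.1, x.2.2.1, x.1), fun _ => rfl, fun _ => rfl⟩ _ _ fun x => ?_
    simp only [Equiv.coe_fn_mk]
    rw [hGs x.1 x.2.2.2 x.1]
  rw [hL, hR, d1, d2, r1, r2, r3, r4, r5]
  ring

/-- The derivative of the Ricci tensor of a one-parameter family of metrics. -/
theorem hasDerivAt_ricci {g : ℝ → Field2 n} (hg : FamSmooth2 g 0 y)
    (hd : (matAt (g 0) y).det ≠ 0) (β ν : Fin n) :
    HasDerivAt (fun t => ricci (g t) β ν y)
      (ricciVariation (christoffel (g 0))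
        (fun α μ ν => variation fun t => christoffel (g t) α μ ν) β ν y) 0 := by
  have hc := hg.christoffel hd
  have h0 : ∀ α μ ν, HasDerivAt (fun t => christoffel (g t) α μ ν y)
      (variation (fun t => christoffel (g t) α μ ν) y) 0 := fun α μ ν => (hc α μ ν).hasDerivAt
  have h1 : ∀ α μ ν κ, HasDerivAt (fun t => pderiv κ (christoffel (g t) α μ ν) y)
      (pderiv κ (variation fun t => christoffel (g t) α μ ν) y) 0 := fun α μ ν κ => by
    rw [← variation_pderiv (hc α μ ν)]
    exact ((hc α μ ν).pderiv κ).hasDerivAt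
  exact (HasDerivAt.fun_sum fun α _ => (h1 α β ν α).fun_sub (h1 α β α ν)).fun_add
    (HasDerivAt.fun_sum fun α _ => HasDerivAt.fun_sum fun σ _ =>
      ((h0 α α σ).fun_mul (h0 σ β ν)).fun_sub ((h0 α ν σ).fun_mul (h0 σ β α)))

end Palatini

/-! ### The Euler-Lagrange expression of the scalar curvature -/

section EinsteinTensor

open MeasureTheory

variable {n : ℕ} {U : Set (Coord n)} {θ η : Field2 n} {y : Coord n}

/-- The one-parameter family `θ + t η`. -/
def linearFamily (θ η : Field2 n) (t : ℝ) : Field2 n := fun i μ z => θ i μ z + t * η i μ z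

theorem linearFamily_zero (θ η : Field2 n) : linearFamily θ η 0 = θ := by
  funext i μ z
  simp [linearFamily]

theorem famSmooth2_linearFamily (hθ : MSmooth (matAt θ) y) (hη : MSmooth (matAt η) y) :
    FamSmooth2 (linearFamily θ η) 0 y := fun i μ =>
  (famSmooth_const (hθ i μ)).add
    (FamSmooth.mul (f := fun t _ => t) (contDiffAt_fst) (famSmooth_const (hη i μ)))

theorem hasDerivAt_linearFamily (θ η : Field2 n) (i μ : Fin n) (z : Coord n) :
    HasDerivAt (fun t => linearFamily θ η t i μ z) (η i μ z) 0 := by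
  have := ((hasDerivAt_id (0 : ℝ)).mul_const (η i μ z)).const_add (θ i μ z)
  simpa [linearFamily] using this

theorem variation_linearFamily (θ η : Field2 n) (i μ : Fin n) :
    variation (fun t => linearFamily θ η t i μ) = η i μ :=
  funext fun z => (hasDerivAt_linearFamily θ η i μ z).deriv

/-- The variation of the Christoffel symbols along `θ + t η`. -/
def christoffelVariation (θ η : Field2 n) : Field3 n :=
  fun α μ ν => variation fun t => christoffel (metric (linearFamily θ η t)) α μ ν

theorem christoffelVariation_symm (θ η : Field2 n) (α μ ν : Fin n) :
    christoffelVariation θ η α μ ν = christoffelVariation θ η α ν μ := by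
  unfold christoffelVariation
  simp only [christoffel_symm (metric_symm _) α μ ν]

theorem christoffelVariation_smooth (h : IsCoframeAt θ y) (hη : MSmooth (matAt η) y)
    (α μ ν : Fin n) : ContDiffAt ℝ ∞ (christoffelVariation θ η α μ ν) y := by
  refine FamSmooth.contDiffAt_variation ?_
  refine (famSmooth2_linearFamily h.smooth hη).metric.christoffel ?_ α μ ν
  rw [linearFamily_zero]
  exact det_metric_ne_zero h.det_ne

/-- The Christoffel symbols at `y` depend only on the germ of the metric, so their variation lives
on the support of `η`. -/
theorem christoffelVariation_eq_zero (h : ∀ i μ, η i μ =ᶠ[𝓝 y] fun _ => 0) (α μ ν : Fin n) :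
    christoffelVariation θ η α μ ν y = 0 := by
  have h1 : ∀ t μ ν, metric (linearFamily θ η t) μ ν =ᶠ[𝓝 y] metric θ μ ν := by
    intro t μ ν
    have h2 : ∀ᶠ z in 𝓝 y, ∀ i μ, η i μ z = 0 :=
      eventually_all.mpr fun i => eventually_all.mpr fun μ => h i μ
    filter_upwards [h2] with z hz
    simp [metric, linearFamily, hz]
  have h3 : ∀ t, christoffel (metric (linearFamily θ η t)) α μ ν y
      = christoffel (metric θ) α μ ν y := by
    intro t
    have hm : matAt (metric (linearFamily θ η t)) y = matAt (metric θ) y := by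
      ext μ ν
      exact (h1 t μ ν).self_of_nhds
    unfold christoffel invMetric
    simp only [hm, fun μ ν κ => pderiv_congr (h1 t μ ν) κ]
  unfold christoffelVariation variation
  simp only [h3, deriv_const]

/-- Ensures that the divergence in the variation of `λ R` integrates to zero. -/
theorem palatiniVector_isTest (hθ : ∀ z ∈ U, IsCoframeAt θ z) (hη : ∀ i μ, IsTest U (η i μ))
    (α : Fin n) : IsTest U (palatiniVector θ (christoffelVariation θ η) α) := by
  have hK : IsCompact (⋃ i, ⋃ μ, tsupport (η i μ)) :=
    isCompact_iUnion fun i => isCompact_iUnion fun μ => (hη i μ).compact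
  refine IsTest.of_compact hK (Set.iUnion_subset fun i => Set.iUnion_subset fun μ =>
    (hη i μ).subset) (fun z hz => ?_) fun z hz => ?_
  · have hD := christoffelVariation_smooth (hθ z hz)
      (fun i μ => (hη i μ).smooth.contDiffAt : MSmooth (matAt η) z)
    have hH := (hθ z hz).densMetric_smooth
    exact (ContDiffAt.sum fun β _ => ContDiffAt.sum fun ν _ => (hH β ν).mul (hD α β ν)).sub
      (ContDiffAt.sum fun β _ => ContDiffAt.sum fun σ _ => (hH β α).mul (hD σ β σ))
  · have h0 := christoffelVariation_eq_zero (θ := θ) (η := η) (y := z) fun i μ =>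
      eventually_zero_of_notMem fun h => hz (Set.mem_iUnion₂.mpr ⟨i, μ, h⟩)
    simp [palatiniVector, h0]

theorem matAt_einstein (θ : Field2 n) (y : Coord n) :
    matAt (einstein (metric θ)) y = (matAt (metric θ) y)⁻¹ * matAt (ricci (metric θ)) y
      - (1 / 2 * scalarCurvature (metric θ) y) • (1 : Matrix (Fin n) (Fin n) ℝ) := by
  ext μ ν
  have h : matAt (einstein (metric θ)) y μ ν
      = ((matAt (metric θ) y)⁻¹ * matAt (ricci (metric θ)) y) μ ν
        - (1 / 2) * (if μ = ν then 1 else 0) * scalarCurvature (metric θ) y := rfl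
  rw [h, Matrix.sub_apply, Matrix.smul_apply, Matrix.one_apply, smul_eq_mul]
  ring

theorem ricci_transpose (h : ∀ᶠ z in 𝓝 y, IsCoframeAt θ z) :
    (matAt (ricci (metric θ)) y).transpose = matAt (ricci (metric θ)) y := by
  ext β ν
  exact ricci_symm h ν β

/-- The variation of the density `λ R` along `θ + t η`. -/
theorem hasDerivAt_det_mul_scalarCurvature (h : ∀ᶠ z in 𝓝 y, IsCoframeAt θ z)
    (hη : MSmooth (matAt η) y) :
    HasDerivAt (fun t => (matAt (linearFamily θ η t) y).det
        * scalarCurvature (metric (linearFamily θ η t)) y)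
      (-2 * (matAt θ y).det
          * (matAt (einstein (metric θ)) y * (matAt θ y)⁻¹ * matAt η y).trace
        + ∑ α, pderiv α (palatiniVector θ (christoffelVariation θ η) α) y) 0 := by
  have h0 := h.self_of_nhds
  have hu : IsUnit (matAt θ y).det := isUnit_iff_ne_zero.mpr h0.det_ne
  have hF := famSmooth2_linearFamily h0.smooth hη
  have hg0 : (matAt (metric (linearFamily θ η 0)) y).det ≠ 0 := by
    rw [linearFamily_zero]
    exact det_metric_ne_zero h0.det_ne
  have hT : MSmooth (fun t => matAt (linearFamily θ η t) y) 0 := fun i μ => (hF i μ).param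
  have hN : matDeriv (1 : ℝ) (fun t => matAt (linearFamily θ η t) y) 0 = matAt η y := by
    ext i μ
    exact (hasDerivAt_linearFamily θ η i μ y).deriv
  have hdet : HasDerivAt (fun t => (matAt (linearFamily θ η t) y).det)
      ((matAt θ y).det * ((matAt θ y)⁻¹ * matAt η y).trace) 0 := by
    have e := fderiv_det (v := (1 : ℝ)) hT (by rw [linearFamily_zero]; exact h0.det_ne)
    rw [hN, linearFamily_zero] at e
    rw [← e]
    exact hT.det.diffAt.hasDerivAt
  set T := matAt θ y with hTdef
  set N := matAt η y with hNdef
  set g := (matAt (metric θ) y)⁻¹ with hgdef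
  set R := matAt (ricci (metric θ)) y with hRdef
  have hgsm : MSmooth (fun t => matAt (metric (linearFamily θ η t)) y) 0 := fun μ ν =>
    (hF.metric μ ν).param
  have hg' : matDeriv (1 : ℝ) (fun t => matAt (metric (linearFamily θ η t)) y) 0
      = N.transpose * T + T.transpose * N := by
    simp only [matAt_metric]
    rw [matDeriv_mul hT.transpose hT, matDeriv_transpose, hN, linearFamily_zero]
  have hinv : ∀ μ ν, HasDerivAt (fun t => invMetric (metric (linearFamily θ η t)) μ ν y)
      ((-(g * (N.transpose * T + T.transpose * N) * g)) μ ν) 0 := by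
    intro μ ν
    have e := matDeriv_inv (v := (1 : ℝ)) hgsm hg0
    rw [hg', linearFamily_zero] at e
    rw [← e]
    exact (hgsm.inv hg0 μ ν).diffAt.hasDerivAt
  have hric : ∀ β ν, HasDerivAt (fun t => ricci (metric (linearFamily θ η t)) β ν y)
      (ricciVariation (christoffel (metric θ)) (christoffelVariation θ η) β ν y) 0 := by
    intro β ν
    have := hasDerivAt_ricci hF.metric hg0 β ν
    rw [linearFamily_zero] at this
    exact this
  have hscal : HasDerivAt (fun t => scalarCurvature (metric (linearFamily θ η t)) y)
      (∑ μ, ∑ ν, ((-(g * (N.transpose * T + T.transpose * N) * g)) μ ν * R μ ν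
        + g μ ν * ricciVariation (christoffel (metric θ)) (christoffelVariation θ η) μ ν y)) 0 := by
    have := HasDerivAt.fun_sum (u := Finset.univ) fun μ _ => HasDerivAt.fun_sum
      (u := Finset.univ) fun ν _ => (hinv μ ν).fun_mul (hric μ ν)
    rw [linearFamily_zero] at this
    exact this
  have hprod := hdet.fun_mul hscal
  rw [linearFamily_zero] at hprod
  have hpal := palatini_identity h0 (christoffelVariation_smooth h0 hη) fun α β ν =>
    congrFun (christoffelVariation_symm θ η α β ν) y
  have hpal' : T.det * ∑ μ, ∑ ν,
      g μ ν * ricciVariation (christoffel (metric θ)) (christoffelVariation θ η) μ ν y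
        = ∑ α, pderiv α (palatiniVector θ (christoffelVariation θ η) α) y := by
    rw [← hpal, Finset.mul_sum]
    refine Finset.sum_congr rfl fun μ _ => ?_
    rw [Finset.mul_sum]
    exact Finset.sum_congr rfl fun ν _ => (mul_assoc _ _ _).symm
  have hRs : R.transpose = R := ricci_transpose h
  have hgs : g.transpose = g := invMetric_transpose θ y
  have hgT : g * T.transpose = T⁻¹ := by
    rw [hgdef, matAt_metric, Matrix.mul_inv_rev, mul_assoc, Matrix.nonsing_inv_mul _
      (by rwa [Matrix.det_transpose]), mul_one]
  -- Here `g` is the inverse metric. The two halves of `δ(TᵀT) = Nᵀ T + Tᵀ N` have equal traces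
  -- because the Ricci tensor is symmetric, whence the factor `-2`; the variation of `λ` later adds
  -- the scalar curvature part of the Einstein tensor.
  have htr : ∑ μ, ∑ ν, (-(g * (N.transpose * T + T.transpose * N) * g)) μ ν * R μ ν
      = -2 * (g * R * T⁻¹ * N).trace := by
    have e1 : ∑ μ, ∑ ν, (-(g * (N.transpose * T + T.transpose * N) * g)) μ ν * R μ ν
        = (-(g * (N.transpose * T + T.transpose * N) * g) * R.transpose).trace := rfl
    have e2 : (g * (T.transpose * N) * g * R).trace = (g * R * T⁻¹ * N).trace := by
      rw [← mul_assoc g, hgT, mul_assoc (T⁻¹ * N), Matrix.trace_mul_comm, ← mul_assoc (g * R)]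
    have e3 : (g * (N.transpose * T) * g * R).trace = (g * R * T⁻¹ * N).trace := by
      rw [← Matrix.trace_transpose]
      simp only [Matrix.transpose_mul, Matrix.transpose_transpose, hgs, hRs]
      rw [← hgT, ← mul_assoc R, ← mul_assoc (R * g), Matrix.trace_mul_comm]
      simp only [mul_assoc]
    rw [e1, hRs, mul_add, add_mul, Matrix.neg_mul, add_mul, Matrix.trace_neg, Matrix.trace_add,
      e2, e3]
    ring
  refine hprod.congr_deriv ?_
  simp only [Finset.sum_add_distrib]
  rw [htr, mul_add, hpal', matAt_einstein, sub_mul, sub_mul, Matrix.trace_sub, Matrix.smul_mul,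
    Matrix.smul_mul, Matrix.trace_smul, one_mul, smul_eq_mul]
  ring

theorem isLagrangian_const_mul {L : Jet n → ℝ} (hL : IsLagrangian L) (c : ℝ) :
    IsLagrangian fun j => c * L j where
  smooth := contDiffOn_const.mul hL.smooth
  scalar := fun φ h1 h2 θ h3 h4 y hy => by rw [hL.scalar φ h1 h2 θ h3 h4 y hy]

/-- Chain rule along `θ + t η`, which for small `t` is still a coframe at `y`, so that the Ricci
Lagrangian on its jet is the actual scalar curvature. -/
theorem fderiv_density_ricciLagrangian (c : ℝ) (h : ∀ᶠ z in 𝓝 y, IsCoframeAt θ z)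
    (hη : ∀ᶠ z in 𝓝 y, MSmooth (matAt η) z) :
    fderiv ℝ (density fun j => c * ricciLagrangian n j) (jetOf θ y) (jetOf η y)
      = c * (-2 * (matAt θ y).det
          * (matAt (einstein (metric θ)) y * (matAt θ y)⁻¹ * matAt η y).trace
        + ∑ α, pderiv α (palatiniVector θ (christoffelVariation θ η) α) y) := by
  have h0 := h.self_of_nhds
  have hF : ContDiffAt ℝ ∞ (density fun j => c * ricciLagrangian n j) (jetOf θ y) :=
    contDiffAt_density (isLagrangian_const_mul (isLagrangian_ricciLagrangian n) c).smooth h0.det_ne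
  have h1 := hasDerivAt_comp_jetOf (F := density fun j => c * ricciLagrangian n j)
    (Θ := linearFamily θ η) (y := y)
    (by
      filter_upwards [h, hη] with z hz hz'
      exact famSmooth2_linearFamily hz.smooth hz')
    (by rw [linearFamily_zero]; exact hF.diffAt)
  rw [linearFamily_zero] at h1
  simp only [variation_linearFamily] at h1
  have h2 := (hasDerivAt_det_mul_scalarCurvature h hη.self_of_nhds).const_mul c
  refine h1.unique (h2.congr_of_eventuallyEq ?_)
  have hT : MSmooth (fun t => matAt (linearFamily θ η t) y) 0 := fun i μ =>
    (famSmooth2_linearFamily h0.smooth hη.self_of_nhds i μ).param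
  have hd : ∀ᶠ t : ℝ in 𝓝 0, (matAt (linearFamily θ η t) y).det ≠ 0 :=
    hT.det.continuousAt.eventually_ne (by rw [linearFamily_zero]; exact h0.det_ne)
  filter_upwards [hd] with t ht
  have hco : IsCoframeAt (linearFamily θ η t) y := ⟨fun i μ =>
    (h0.smooth i μ).add (contDiffAt_const.mul (hη.self_of_nhds i μ)), ht⟩
  change (matAt (linearFamily θ η t) y).det * (c * ricciLagrangian n _) = _
  rw [ricciLagrangian_jetOf hco]
  ring

/-- The variational tensor of `c R` is `-2 c` times the Einstein tensor. -/
theorem variationalTensor_ricciLagrangian (c : ℝ) (hU : IsOpen U)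
    (hθ : ∀ z ∈ U, IsCoframeAt θ z) (hy : y ∈ U) :
    matAt (variationalTensor (fun j => c * ricciLagrangian n j) θ) y
      = (-2 * c) • matAt (einstein (metric θ)) y := by
  set F := density fun j => c * ricciLagrangian n j with hFdef
  have hev : ∀ z ∈ U, ∀ᶠ w in 𝓝 z, IsCoframeAt θ w := fun z hz =>
    Filter.eventually_of_mem (hU.mem_nhds hz) hθ
  have hF : ∀ z ∈ U, ContDiffAt ℝ ∞ F (jetOf θ z) := fun z hz =>
    contDiffAt_density (isLagrangian_const_mul (isLagrangian_ricciLagrangian n) c).smooth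
      (hθ z hz).det_ne
  -- The expected Euler-Lagrange expression, read off from the trace term of the first variation.
  set Z : Coord n → Matrix (Fin n) (Fin n) ℝ := fun z =>
    (-2 * c * (matAt θ z).det) • (matAt (einstein (metric θ)) z * (matAt θ z)⁻¹) with hZ
  have hein : ∀ z ∈ U, MSmooth (matAt (einstein (metric θ))) z := by
    intro z hz
    have hm := (famSmooth2_const (P := ℝ) (p := 0) (hθ z hz).smooth).metric
    have hd := det_metric_ne_zero (hθ z hz).det_ne
    have hr : ∀ μ ν, ContDiffAt ℝ ∞ (ricci (metric θ) μ ν) z := fun μ ν => (hm.ricci hd μ ν).slice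
    exact fun μ ν => (ContDiffAt.sum fun α _ =>
      ((hθ z hz).invMetric_smooth μ α).mul (hr α ν)).sub
        (contDiffAt_const.mul (hm.scalarCurvature hd).slice)
  have hZs : ∀ z ∈ U, MSmooth Z z := fun z hz =>
    MSmooth.smul (contDiffAt_const.mul (hθ z hz).smooth.det)
      ((hein z hz).mul ((hθ z hz).smooth.inv (hθ z hz).det_ne))
  have hEs : ∀ i β, ∀ z ∈ U, ContDiffAt ℝ ∞ (eulerLagrange F θ i β) z := fun i β z hz =>
    contDiffAt_eulerLagrange (hF z hz) (hθ z hz).smooth i β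
  have key : ∀ i β, ∀ z ∈ U, eulerLagrange F θ i β z - Z z β i = 0 := by
    intro i β
    refine eq_zero_of_integral_mul_test hU (fun z hz =>
      ((hEs i β z hz).sub (hZs z hz β i)).continuousAt.continuousWithinAt) fun ρ hρ => ?_
    -- Only the component `θ_{iβ}` is varied, by `ρ`, which isolates one entry of the Euler-Lagrange
    -- expression.
    let η : Field2 n := fun k μ z => if k = i ∧ μ = β then ρ z else 0
    have hη : ∀ k μ, IsTest U (η k μ) := fun k μ => by
      by_cases hk : k = i ∧ μ = β
      · simpa only [η, if_pos hk] using hρ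
      · simpa only [η, if_neg hk] using IsTest.zero
    have hpick : ∀ (X : Fin n → Fin n → ℝ) z, ∑ k, ∑ μ, X k μ * η k μ z = X i β * ρ z := by
      intro X z
      rw [Finset.sum_eq_single i, Finset.sum_eq_single β]
      · simp [η]
      · intro μ _ hμ
        simp [η, hμ]
      · simp
      · intro k _ hk
        simp [η, hk]
      · simp
    have hvar := integral_fderiv_jetOf hF (fun z hz => (hθ z hz).smooth) hη
    have hW := palatiniVector_isTest hθ hη
    have hpt : ∀ z, fderiv ℝ F (jetOf θ z) (jetOf η z)
        = Z z β i * ρ z + ∑ α, c * pderiv α (palatiniVector θ (christoffelVariation θ η) α) z := by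
      intro z
      by_cases hz : z ∈ U
      · rw [hFdef, fderiv_density_ricciLagrangian (η := η) c (hev z hz)
          (Eventually.of_forall fun w k μ => (hη k μ).smooth.contDiffAt), mul_add, Finset.mul_sum]
        congr 1
        have e1 : (matAt (einstein (metric θ)) z * (matAt θ z)⁻¹ * matAt η z).trace
            = ∑ k, ∑ μ, (matAt (einstein (metric θ)) z * (matAt θ z)⁻¹) μ k * η k μ z := by
          rw [Finset.sum_comm]
          rfl
        rw [e1, hpick fun k μ => (matAt (einstein (metric θ)) z * (matAt θ z)⁻¹) μ k]
        simp only [hZ, Matrix.smul_apply, smul_eq_mul]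
        ring
      · have hz' : z ∉ tsupport ρ := fun h => hz (hρ.subset h)
        rw [jetOf_eq_zero fun k μ =>
          eventually_zero_of_notMem fun h => hz ((hη k μ).subset h), map_zero,
          image_eq_zero_of_notMem_tsupport hz', mul_zero, zero_add]
        refine (Finset.sum_eq_zero fun α _ => ?_).symm
        rw [pderiv_zero_of_notMem fun h => hz ((hW α).subset h), mul_zero]
    have t1 : IsTest U fun z => Z z β i * ρ z := hρ.smooth_mul fun z hz => hZs z hz β i
    have t2 : ∀ α, IsTest U
        fun z => c * pderiv α (palatiniVector θ (christoffelVariation θ η) α) z := fun α =>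
      ((hW α).pderiv α).smooth_mul fun _ _ => contDiffAt_const
    have t3 : IsTest U fun z => eulerLagrange F θ i β z * ρ z := hρ.smooth_mul (hEs i β)
    simp only [hpt, fun z => hpick (fun k μ => eulerLagrange F θ k μ z) z] at hvar
    rw [integral_add t1.integrable (IsTest.sum t2).integrable, integral_sum_test t2] at hvar
    simp only [integral_const_mul, (hW _).integral_pderiv, mul_zero, Finset.sum_const_zero,
      add_zero] at hvar
    simp only [sub_mul]
    rw [integral_sub t3.integrable t1.integrable, hvar, sub_self]
  have hl := (hθ y hy).det_ne
  have hu : IsUnit (matAt θ y).det := isUnit_iff_ne_zero.mpr hl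
  have hZT : Z y * matAt θ y = (-2 * c * (matAt θ y).det) • matAt (einstein (metric θ)) y := by
    simp only [hZ]
    rw [Matrix.smul_mul, mul_assoc (matAt (einstein (metric θ)) y), Matrix.nonsing_inv_mul _ hu,
      mul_one]
  ext μ ν
  have e1 : matAt (variationalTensor (fun j => c * ricciLagrangian n j) θ) y μ ν
      = (1 / (matAt θ y).det) * (Z y * matAt θ y) μ ν := by
    refine (variationalTensor_eq _ θ μ ν y).trans ?_
    congr 1
    refine Finset.sum_congr rfl fun i _ => ?_
    rw [sub_eq_zero.mp (key i μ y hy)]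
    rfl
  rw [e1, hZT, Matrix.smul_apply, Matrix.smul_apply, smul_eq_mul, smul_eq_mul]
  field_simp

end EinsteinTensor

/-! ### The components of an AP-structure in a chart -/

section Charts

variable {n : ℕ} {M : Type*} [TopologicalSpace M] [ChartedSpace (Coord n) M]

theorem mfderiv_injective_of_mem_maximalAtlas {e : OpenPartialHomeomorph M (Coord n)}
    (he : e ∈ IsManifold.maximalAtlas (𝓡 n) ∞ M) {x : M} (hx : x ∈ e.source) :
    Function.Injective (mfderiv (𝓡 n) 𝓘(ℝ, Coord n) e x) := by
  have hd : e.MDifferentiable (𝓡 n) 𝓘(ℝ, Coord n) :=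
    ⟨(contMDiffOn_of_mem_maximalAtlas he).mdifferentiableOn (by simp),
      (contMDiffOn_symm_of_mem_maximalAtlas he).mdifferentiableOn (by simp)⟩
  exact hd.mfderiv_injective hx

theorem ker_coordForm {e : OpenPartialHomeomorph M (Coord n)}
    (he : e ∈ IsManifold.maximalAtlas (𝓡 n) ∞ M) {x : M} (hx : x ∈ e.source) :
    LinearMap.ker (LinearMap.pi fun μ => coordForm e μ x) = ⊥ := by
  rw [LinearMap.ker_eq_bot']
  intro w hw
  refine mfderiv_injective_of_mem_maximalAtlas he hx (Eq.trans ?_ (map_zero _).symm)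
  have h1 : ∀ μ, coordForm e μ x w = 0 := fun μ => congrFun hw μ
  exact PiLp.ext h1

variable [IsManifold (𝓡 n) ∞ M]

/-- The tangent map of the chart, applied to the vector field along `e.symm`, is a smooth map into
the tangent bundle of the model space; its fibre part has the frame components as coordinates. -/
theorem APStructure.frame_smooth (A : APStructure n M) {e : OpenPartialHomeomorph M (Coord n)}
    (he : e ∈ IsManifold.maximalAtlas (𝓡 n) ∞ M) {y : Coord n} (hy : y ∈ e.target) :
    MSmooth (matAt (A.frame e)) y := by
  intro i μ
  have hes := contMDiffOn_of_mem_maximalAtlas he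
  have h1 := hes.contMDiffOn_tangentMapWithin (m := ∞) (by simp) e.open_source.uniqueMDiffOn
  have h2 : ContMDiffOn (𝓡 n) (𝓡 n).tangent ∞
      (fun z : Coord n => (⟨e.symm z, A.vf i (e.symm z)⟩ : TangentBundle (𝓡 n) M)) e.target :=
    (A.smooth i).comp_contMDiffOn (contMDiffOn_symm_of_mem_maximalAtlas he)
  have h3 := (h1.comp h2 fun z hz => e.map_target hz).contMDiffAt (e.open_target.mem_nhds hy)
  have h4 := ((contMDiff_snd_tangentBundle_modelSpace (Coord n) (𝓡 n)).contMDiffAt.comp y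
    h3).contDiffAt
  have h5 : ContDiffAt ℝ ∞ (fun z : Coord n =>
      (mfderiv (𝓡 n) 𝓘(ℝ, Coord n) e (e.symm z) (A.vf i (e.symm z)) : Coord n)) y := by
    refine h4.congr_of_eventuallyEq ?_
    filter_upwards [e.open_target.mem_nhds hy] with z hz
    have : mfderivWithin (𝓡 n) 𝓘(ℝ, Coord n) e e.source (e.symm z)
        = mfderiv (𝓡 n) 𝓘(ℝ, Coord n) e (e.symm z) :=
      mfderivWithin_of_isOpen e.open_source (e.map_target hz)
    simp only [Function.comp, tangentMapWithin]
    rw [this]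
  exact contDiffAt_coord h5 μ

/-- A linear relation between the component rows is one between the vectors, because the coordinate
differentials have no common kernel. -/
theorem APStructure.linearIndependent_frame (A : APStructure n M)
    {e : OpenPartialHomeomorph M (Coord n)}
    (he : e ∈ IsManifold.maximalAtlas (𝓡 n) ∞ M) {y : Coord n} (hy : y ∈ e.target) :
    LinearIndependent ℝ (matAt (A.frame e) y).row := by
  rw [Fintype.linearIndependent_iff]
  intro c hc
  refine Fintype.linearIndependent_iff.mp (A.independent (e.symm y)) c ?_
  have h1 : ∑ i, c i • A.vf i (e.symm y)
      ∈ LinearMap.ker (LinearMap.pi fun μ => coordForm e μ (e.symm y)) := by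
    rw [LinearMap.mem_ker]
    funext μ
    rw [LinearMap.pi_apply, map_sum, Pi.zero_apply]
    simp only [map_smul]
    have h2 := congrFun hc μ
    rw [Finset.sum_apply] at h2
    exact h2
  rwa [ker_coordForm he (e.map_target hy), Submodule.mem_bot] at h1

theorem APStructure.det_frame_ne_zero (A : APStructure n M)
    {e : OpenPartialHomeomorph M (Coord n)}
    (he : e ∈ IsManifold.maximalAtlas (𝓡 n) ∞ M) {y : Coord n} (hy : y ∈ e.target) :
    (matAt (A.frame e) y).det ≠ 0 :=
  ((Matrix.isUnit_iff_isUnit_det _).mp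
    (Matrix.linearIndependent_rows_iff_isUnit.mp (A.linearIndependent_frame he hy))).ne_zero

theorem isCoframeAt_coframe {lam : Field2 n} {y : Coord n} (h : MSmooth (matAt lam) y)
    (hd : (matAt lam y).det ≠ 0) : IsCoframeAt (coframe lam) y where
  smooth := (h.inv hd).transpose
  det_ne := by
    rw [matAt_coframe, Matrix.det_transpose, Matrix.det_nonsing_inv, Ring.inverse_eq_inv']
    exact inv_ne_zero hd

theorem APStructure.isCoframeAt (A : APStructure n M) {e : OpenPartialHomeomorph M (Coord n)}
    (he : e ∈ IsManifold.maximalAtlas (𝓡 n) ∞ M) {y : Coord n} (hy : y ∈ e.target) :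
    IsCoframeAt (coframe (A.frame e)) y :=
  isCoframeAt_coframe (A.frame_smooth he hy) (A.det_frame_ne_zero he hy)

/-- Raising the index gives `c (g⁻¹ Ric g⁻¹ - ½ R g⁻¹)`, in which both terms are symmetric. -/
theorem raiseSnd_symm_of_einstein {θ E : Field2 n} {y : Coord n}
    (h : ∀ᶠ z in 𝓝 y, IsCoframeAt θ z) {c : ℝ}
    (hE : matAt E y = c • matAt (einstein (PAP.metric θ)) y) :
    (matAt (raiseSnd (PAP.metric θ) E) y).transpose = matAt (raiseSnd (PAP.metric θ) E) y := by
  rw [matAt_raiseSnd, hE, matAt_einstein, Matrix.transpose_mul, invMetric_transpose]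
  simp only [Matrix.transpose_smul, Matrix.transpose_sub, Matrix.transpose_mul,
    invMetric_transpose, ricci_transpose h, Matrix.transpose_one]
  simp only [Matrix.smul_mul, Matrix.mul_smul, mul_sub, sub_mul, mul_one, one_mul, mul_assoc]

end Charts

end PAP

end

/-! ### The theorem for AP-spaces, in the charts of the maximal atlas -/

theorem mainTheorem4 (n : ℕ) (M : Type*) [TopologicalSpace M] [ChartedSpace (PAP.Coord n) M]
    [IsManifold (𝓡 n) ∞ M] (A : PAP.APStructure n M) :
    -- (a) the three divergences of a symmetric tensor agree
    (∀ E : (x : M) → LinearMap.BilinForm ℝ (Module.Dual ℝ (TangentSpace (𝓡 n) x)),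
      PAP.IsC1Tensor E → (∀ x, (E x).IsSymm) →
      ∀ (b : ℝ), ∀ e ∈ IsManifold.maximalAtlas (𝓡 n) ∞ M, ∀ y ∈ e.target, ∀ ν,
        PAP.divergence (PAP.dual (PAP.papConnection b (A.frame e)))
            (PAP.lowerSnd (A.metric e) (PAP.tensorComp E e)) ν y
          = PAP.divergence (PAP.dual (PAP.weitzenbock (A.frame e)))
            (PAP.lowerSnd (A.metric e) (PAP.tensorComp E e)) ν y ∧
        PAP.divergence (PAP.dual (PAP.weitzenbock (A.frame e)))
            (PAP.lowerSnd (A.metric e) (PAP.tensorComp E e)) ν y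
          = PAP.divergence (PAP.christoffel (A.metric e))
            (PAP.lowerSnd (A.metric e) (PAP.tensorComp E e)) ν y) ∧
    -- (b) the Ricci scalar as Lagrangian function
    (PAP.IsLagrangian (PAP.ricciLagrangian n) ∧
      ∀ e ∈ IsManifold.maximalAtlas (𝓡 n) ∞ M, ∀ y ∈ e.target,
        PAP.ricciLagrangian n (PAP.jetOf (PAP.coframe (A.frame e)) y)
            = PAP.scalarCurvature (A.metric e) y ∧
        ∀ c : ℝ,
          (∀ μ ν, PAP.variationalTensor (fun j => c * PAP.ricciLagrangian n j)
              (PAP.coframe (A.frame e)) μ ν y = -2 * c * PAP.einstein (A.metric e) μ ν y) ∧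
          (∀ ν, PAP.divergence (PAP.christoffel (A.metric e))
              (PAP.variationalTensor (fun j => c * PAP.ricciLagrangian n j)
                (PAP.coframe (A.frame e))) ν y = 0)) ∧
    -- (b) every symmetric tensor defined by the variational formula
    (∀ L : PAP.Jet n → ℝ, PAP.IsLagrangian L →
      ∀ e ∈ IsManifold.maximalAtlas (𝓡 n) ∞ M,
        (∀ y ∈ e.target, ∀ μ ν,
          PAP.raiseSnd (A.metric e)
              (PAP.variationalTensor L (PAP.coframe (A.frame e))) μ ν y
            = PAP.raiseSnd (A.metric e)
              (PAP.variationalTensor L (PAP.coframe (A.frame e))) ν μ y) →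
        ∀ y ∈ e.target, ∀ ν,
          PAP.divergence (PAP.dual (PAP.weitzenbock (A.frame e)))
              (PAP.variationalTensor L (PAP.coframe (A.frame e))) ν y = 0 ∧
          ∀ b : ℝ, PAP.divergence (PAP.dual (PAP.papConnection b (A.frame e)))
              (PAP.variationalTensor L (PAP.coframe (A.frame e))) ν y = 0) := by
  have hframe := fun e he y hy => A.det_frame_ne_zero (e := e) he (y := y) hy
  have hco := fun e he y hy => A.isCoframeAt (e := e) he (y := y) hy
  refine ⟨fun E _ hE b e he y hy ν => ?_, ⟨PAP.isLagrangian_ricciLagrangian n,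
    fun e he y hy => ⟨PAP.ricciLagrangian_jetOf (hco e he y hy), fun c => ?_⟩⟩,
    fun L hL e he hsymm y hy ν => ?_⟩
  · have hS : (PAP.matAt (PAP.tensorComp E e) y).transpose = PAP.matAt (PAP.tensorComp E e) y := by
      ext μ κ
      exact (hE (e.symm y)).eq _ _
    have hl := PAP.matAt_lowerSnd (A.metric e) (PAP.tensorComp E e) y
    have h1 := PAP.divergence_papConnection (hframe e he y hy) (hco e he y hy) hS hl b ν
    have h2 := PAP.divergence_weitzenbock (hframe e he y hy) (hco e he y hy) hS hl ν
    exact ⟨h1.trans h2.symm, h2⟩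
  · have hev : ∀ᶠ z in nhds y, PAP.IsCoframeAt (PAP.coframe (A.frame e)) z :=
      Filter.eventually_of_mem (e.open_target.mem_nhds hy) (hco e he)
    have hE := PAP.variationalTensor_ricciLagrangian c e.open_target (hco e he) hy
    refine ⟨fun μ ν => congrFun (congrFun hE μ) ν, fun ν => ?_⟩
    -- The symmetry of the Einstein tensor replaces the Levi-Civita divergence by the dual
    -- Weitzenböck one, which vanishes by Noether's identity.
    refine (PAP.divergence_weitzenbock (hframe e he y hy) (hco e he y hy)
      (PAP.raiseSnd_symm_of_einstein hev hE)
      (PAP.matAt_eq_raiseSnd_mul (PAP.det_metric_ne_zero (hco e he y hy).det_ne)) ν).symm.trans ?_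
    exact PAP.divergence_weitzenbock_variationalTensor
      (PAP.isLagrangian_const_mul (PAP.isLagrangian_ricciLagrangian n) c) e.open_target
      (hframe e he) (hco e he) hy ν
  · have h0 := PAP.divergence_weitzenbock_variationalTensor hL e.open_target
      (hframe e he) (hco e he) hy ν
    refine ⟨h0, fun b => ?_⟩
    have hS : (PAP.matAt (PAP.raiseSnd (A.metric e)
        (PAP.variationalTensor L (PAP.coframe (A.frame e)))) y).transpose
        = PAP.matAt (PAP.raiseSnd (A.metric e)
          (PAP.variationalTensor L (PAP.coframe (A.frame e)))) y := by
      ext μ κ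
      exact hsymm y hy κ μ
    have hl := PAP.matAt_eq_raiseSnd_mul (g := A.metric e)
      (E := PAP.variationalTensor L (PAP.coframe (A.frame e)))
      (PAP.det_metric_ne_zero (hco e he y hy).det_ne)
    rw [PAP.divergence_papConnection (hframe e he y hy) (hco e he y hy) hS hl b ν,
      ← PAP.divergence_weitzenbock (hframe e he y hy) (hco e he y hy) hS hl ν, h0]
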